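/- Let $\mathbb F$ be an algebraically closed field of characteristic zero, $V$ a vector space over $\mathbb F$ of finite dimension $n$ with a non-degenerate bilinear form $(\ ,\ )$ that is symmetric or alternating, and let $\mathfrak g=\mathfrak{so}(V)$, $G=SO(V)$, respectively $\mathfrak g=\mathfrak{sp}(V)$, $G=Sp(V)$. Let $e\in\mathfrak g$ be nilpotent with Jordan blocks of sizes $d_1+1\ge d_2+1\ge\dots\ge d_k+1$, and assume that all block sizes are odd if $\mathfrak g=\mathfrak{so}(V)$, and all are even if $\mathfrak g=\mathfrak{sp}(V)$. Let $\mathfrak g_e$ and $G_e$ be the centralisers of $e$ in $\mathfrak g$ and $G$, and let the null-cone $\mathcal N(e)\subset\mathfrak g_e^*$ be the fibre through $0$ of the quotient morphism $\mathfrak g_e^*\to\mathrm{Spec}\,\mathcal S(\mathfrak g_e)^{G_e}$, that is, $\mathcal N(e)=\{\gamma\in\mathfrak g_e^*\mid P(\gamma)=P(0)\text{ for all }P\in\mathcal S(\mathfrak g_e)^{G_e}\}$. Then every irreducible component of $\mathcal N(e)$ has codimension $\mathrm{rk}\,\mathfrak g$ in $\mathfrak g_e^*$. Moreover, $e$ belongs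 to an $\mathfrak{sl}_2$-triple $(e,h,f)$ in $\mathfrak g$ (the triple $(0,0,0)$ if $e=0$), and the following holds for every such triple. Use the trace form to identify $\mathfrak g_e^*$ with the Slodowy slice $e+\mathfrak g_f$: to $\gamma\in\mathfrak g_e^*$ corresponds $e+y$, where $y\in\mathfrak g_f$ is the element with $\mathrm{tr}(yx)=\gamma(x)$ for all $x\in\mathfrak g_e$. For $1\le i\le\mathrm{rk}\,\mathfrak g$ let $F_i$ be the coefficient of $t^{n-2i}$ in the characteristic polynomial of an element of $\mathfrak g$, let ${}^eF_i\in\mathcal S(\mathfrak g_e)=\mathbb F[\mathfrak g_e^*]$ be the homogeneous component of minimal degree of the restriction of $F_i$ to $e+\mathfrak g_f$, and let $\mathcal N_F(e)\subset\mathfrak g_e^*$ be the set of common zeros of ${}^eF_1,\dots,{}^eF_{\mathrm{rk}\,\mathfrak g}$. (a) There are vectors $w_1,\dots,w_k\in V$ such that $e^{d_i+1}w_i=0$, the $e^aw_i$ with $0\le a\le d_i$ form a basis of $V$, $(e^aw_i,e^bw_j)=0$ for $i\ne j$ and all $a,b$, $(w_i,e^sw_i)=0$ for $s<d_i$, and $(w_i,e^{d_i}w_i)=1$.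 For any such $w_1,\dots,w_k$ let $\xi_i^{j,s}$, with $\max(d_j-d_i,0)\le s\le d_j$, be the element of the centraliser $\mathfrak{gl}(V)_e$ with $\xi_i^{j,s}w_i=e^sw_j$ and $\xi_i^{j,s}w_t=0$ for $t\ne i$. These elements form a basis of $\mathfrak{gl}(V)_e$; for $1\le m\le k$ let $V_m^*\subset(\mathfrak{gl}(V)_e)^*$ be the span of those elements of the dual basis that correspond to $\xi_i^{j,s}$ with $i+j=m+1$, and let $V_{\mathfrak g,m}^*=V_m^*\cap\mathfrak g_e^*$, where $\mathfrak g_e^*$ is identified with the annihilator in $(\mathfrak{gl}(V)_e)^*$ of the elements of $\mathfrak{gl}(V)_e$ that are self-adjoint with respect to $(\ ,\ )$. Then there are subspaces $W_{\mathfrak g,m}\subset V_{\mathfrak g,m}^*$ such that the sum $W_{\mathfrak g}=\bigoplus_{m=1}^kW_{\mathfrak g,m}$ is direct, $\dim W_{\mathfrak g}=\mathrm{rk}\,\mathfrak g$, and $W_{\mathfrak g}\cap\mathcal N_F(e)=\{0\}$. (b) Every irreducible component of $\mathcal N_F(e)$ has codimension $\mathrm{rk}\,\mathfrak g$ in $\mathfrak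 g_e^*$. (c) ${}^eF_1,\dots,{}^eF_{\mathrm{rk}\,\mathfrak g}$ is a regular sequence in $\mathcal S(\mathfrak g_e)$. -/

import Mathlib

open scoped TensorProduct

namespace NullCone

noncomputable section

/-! ### Polynomial functions and the Zariski topology on the dual of a vector space -/

section Zariski

variable {F : Type*} [Field F] {M : Type*} [AddCommGroup M] [Module F M]

/-- The value at `γ ∈ M*` of an element of `S(M) = F[M*]`. -/
def evalAt (γ : Module.Dual F M) : SymmetricAlgebra F M →ₐ[F] F :=
  SymmetricAlgebra.lift γ

/-- The Zariski topology on `M*`: its closed sets are the zero sets in `M*` of subsets of `S(M)`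
(it is induced from the prime spectrum of `S(M)` by sending a point to the kernel of evaluation). -/
@[reducible] def zariskiTopology (F : Type*) [Field F] (M : Type*) [AddCommGroup M] [Module F M] :
    TopologicalSpace (Module.Dual F M) :=
  TopologicalSpace.induced
    (fun γ => (⟨RingHom.ker (evalAt γ), RingHom.ker_isPrime _⟩ :
      PrimeSpectrum (SymmetricAlgebra F M)))
    inferInstance

/-- Zariski closed sets of `M*` are exactly the zero sets of families of polynomial functions. -/
theorem isClosed_zariski_iff (Z : Set (Module.Dual F M)) :
    @IsClosed _ (zariskiTopology F M) Z ↔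
      ∃ s : Set (SymmetricAlgebra F M), Z = {γ | ∀ P ∈ s, evalAt γ P = 0} := by
  constructor
  · intro h
    obtain ⟨t, ht, rfl⟩ := isClosed_induced_iff.1 h
    obtain ⟨s, rfl⟩ := (PrimeSpectrum.isClosed_iff_zeroLocus t).1 ht
    exact ⟨s, rfl⟩
  · rintro ⟨s, rfl⟩
    exact isClosed_induced_iff.2 ⟨_, PrimeSpectrum.isClosed_zeroLocus s, rfl⟩

/-- The irreducible components of a subset `N` of `M*`: the maximal irreducible subsets of `N`. -/
def components (N : Set (Module.Dual F M)) : Set (Set (Module.Dual F M)) :=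
  {Z | Maximal (fun Y => @IsIrreducible _ (zariskiTopology F M) Y ∧ Y ⊆ N) Z}

/-- The ideal of all polynomial functions on `M*` vanishing on `Z`. -/
def vanishingIdeal (Z : Set (Module.Dual F M)) : Ideal (SymmetricAlgebra F M) :=
  ⨅ γ ∈ Z, RingHom.ker (evalAt γ)

/-- The codimension in `M*` of an irreducible closed subset `Z`: the height of its ideal. -/
def codim (Z : Set (Module.Dual F M)) : ℕ∞ :=
  (vanishingIdeal Z).height

/-- The algebra map `S(M) → S(M)[T]`, `x ↦ x T` for `x ∈ M`. It sends `P` to `∑ P_m T ^ m`, where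
`P_m` is the homogeneous component of `P` of degree `m`. -/
def gradeHom : SymmetricAlgebra F M →ₐ[F] Polynomial (SymmetricAlgebra F M) :=
  SymmetricAlgebra.lift
    ((Polynomial.monomial (R := SymmetricAlgebra F M) 1).restrictScalars F ∘ₗ
      SymmetricAlgebra.ι F M)

/-- The nonzero homogeneous component of `P` of minimal degree (and `0` if `P = 0`). -/
def minComponent (P : SymmetricAlgebra F M) : SymmetricAlgebra F M :=
  (gradeHom P).trailingCoeff

end Zariski

/-! ### Centralisers in orthogonal and symplectic Lie algebras -/

variable {F : Type*} [Field F] {V : Type*} [AddCommGroup V] [Module F V]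

/-- The centraliser of `e` in `𝔤𝔩(V)`. -/
def glCentraliser (e : Module.End F V) : Submodule F (Module.End F V) :=
  LinearMap.ker (LinearMap.mulLeft F e - LinearMap.mulRight F e)

/-- The centraliser `𝔤_e` of `e` in the Lie algebra `𝔤` of the endomorphisms that are
skew-adjoint with respect to `B`. -/
def centraliser (B : LinearMap.BilinForm F V) (e : Module.End F V) :
    Submodule F (Module.End F V) :=
  B.skewAdjointSubmodule ⊓ glCentraliser e

theorem mem_centraliser {B : LinearMap.BilinForm F V} {e x : Module.End F V} :
    x ∈ centraliser B e ↔ (∀ v w, B (x v) w = - B v (x w)) ∧ e * x = x * e := by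
  rw [centraliser, Submodule.mem_inf, glCentraliser, LinearMap.mem_ker, LinearMap.sub_apply,
    LinearMap.mulLeft_apply, LinearMap.mulRight_apply, sub_eq_zero]
  refine and_congr_left fun _ => ?_
  rw [LinearMap.mem_skewAdjointSubmodule]
  simp [LinearMap.IsSkewAdjoint, LinearMap.IsAdjointPair]

/-- The group `G_e`: the isometries of `B` of determinant one (that is, the elements of `SO(V)`
or `Sp(V)`) that commute with `e`. -/
def groupCentraliser (B : LinearMap.BilinForm F V) (e : Module.End F V) :
    Subgroup (V ≃ₗ[F] V) where
  carrier := {g | (∀ v w, B (g v) (g w) = B v w) ∧ LinearEquiv.det g = 1 ∧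
    ∀ v, g (e v) = e (g v)}
  one_mem' := by simp
  mul_mem' := by
    rintro a b ⟨ha, ha', ha''⟩ ⟨hb, hb', hb''⟩
    refine ⟨fun v w => ?_, by simp [ha', hb'], fun v => ?_⟩
    · simp [ha, hb]
    · simp [ha'', hb'']
  inv_mem' := by
    rintro a ⟨ha, ha', ha''⟩
    refine ⟨fun v w => ?_, by simp [ha'], fun v => ?_⟩
    · rw [← ha (a⁻¹ v) (a⁻¹ w)]
      change B (a (a.symm v)) (a (a.symm w)) = _
      simp
    · change a.symm (e v) = e (a.symm v)
      rw [LinearEquiv.symm_apply_eq, ha'', LinearEquiv.apply_symm_apply]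

theorem conj_mem_centraliser {B : LinearMap.BilinForm F V} {e : Module.End F V}
    {g : V ≃ₗ[F] V} (hg : g ∈ groupCentraliser B e) {x : Module.End F V}
    (hx : x ∈ centraliser B e) : g.conj x ∈ centraliser B e := by
  obtain ⟨h1, -, h3⟩ := hg
  rw [mem_centraliser] at hx ⊢
  obtain ⟨hx1, hx2⟩ := hx
  have key : ∀ v, e (g.symm v) = g.symm (e v) := fun v => by
    rw [eq_comm, LinearEquiv.symm_apply_eq, h3, LinearEquiv.apply_symm_apply]
  refine ⟨fun v w => ?_, LinearMap.ext fun v => ?_⟩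
  · have h4 := h1 (x (g.symm v)) (g.symm w)
    have h5 := h1 (g.symm v) (x (g.symm w))
    rw [LinearEquiv.apply_symm_apply] at h4 h5
    simp only [LinearEquiv.conj_apply_apply]
    rw [h4, h5, hx1]
  · have h6 := LinearMap.congr_fun hx2 (g.symm v)
    simp only [Module.End.mul_apply] at h6
    simp only [Module.End.mul_apply, LinearEquiv.conj_apply_apply]
    rw [← h3, h6, key]

/-- The adjoint action `x ↦ g x g⁻¹` of an element of `G_e` on `𝔤_e`. -/
def adjointAction (B : LinearMap.BilinForm F V) (e : Module.End F V)
    (g : groupCentraliser B e) : centraliser B e →ₗ[F] centraliser B e :=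
  (LinearEquiv.conj g.1).toLinearMap.restrict fun _ hx => conj_mem_centraliser g.2 hx

/-- The algebra `S(𝔤_e)^{G_e}` of symmetric `G_e`-invariants. -/
def invariants (B : LinearMap.BilinForm F V) (e : Module.End F V) :
    Subalgebra F (SymmetricAlgebra F (centraliser B e)) :=
  ⨅ g : groupCentraliser B e,
    AlgHom.equalizer
      (SymmetricAlgebra.lift (SymmetricAlgebra.ι F (centraliser B e) ∘ₗ adjointAction B e g))
      (AlgHom.id F _)

/-- The null-cone `N(e)`: the fibre through `0` of the quotient morphism
`𝔤_e* → 𝔤_e* // G_e = Spec S(𝔤_e)^{G_e}`, that is, the set of points of `𝔤_e*` that the invariants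
do not separate from `0`. -/
def nullCone (B : LinearMap.BilinForm F V) (e : Module.End F V) :
    Set (Module.Dual F (centraliser B e)) :=
  {γ | ∀ P ∈ invariants B e, evalAt γ P = evalAt 0 P}

/-! ### Slodowy slices and the polynomials `^eF_i` -/

/-- `(e, h, f)` is an `𝔰𝔩₂`-triple with `h` and `f` in `𝔤` (for `e = 0` this is `(0, 0, 0)`). -/
def IsTriple (B : LinearMap.BilinForm F V) (e h f : Module.End F V) : Prop :=
  h ∈ skewAdjointLieSubalgebra B ∧ f ∈ skewAdjointLieSubalgebra B ∧
    h * e - e * h = (2 : F) • e ∧ h * f - f * h = (-2 : F) • f ∧ e * f - f * e = h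

/-- The map `𝔤_f → 𝔤_e*`, `y ↦ (x ↦ tr (y x))`. It is bijective if `e` and `f` belong to an
`𝔰𝔩₂`-triple in `𝔤`. -/
def slicePairing (B : LinearMap.BilinForm F V) (e f : Module.End F V) :
    centraliser B f →ₗ[F] Module.Dual F (centraliser B e) :=
  ((LinearMap.mul F (Module.End F V)).compr₂ (LinearMap.trace F V)).domRestrict₁₂
    (centraliser B f) (centraliser B e)

open Classical in
/-- The inverse `𝔤_e* → 𝔤_f ⊂ 𝔤` of `slicePairing`. Translated by `e`, it is the isomorphism of
`𝔤_e*` with the Slodowy slice `e + 𝔤_f`. -/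
def sliceMap (B : LinearMap.BilinForm F V) (e f : Module.End F V) :
    Module.Dual F (centraliser B e) →ₗ[F] Module.End F V :=
  if hb : Function.Bijective (slicePairing B e f) then
    (centraliser B f).subtype ∘ₗ (LinearEquiv.ofBijective _ hb).symm.toLinearMap
  else 0

section Slice

variable [FiniteDimensional F V]

/-- The generic point of the Slodowy slice `e + 𝔤_f`, as an endomorphism of `V` with coefficients
in `F[e + 𝔤_f] = F[𝔤_e*] = S(𝔤_e)`; its value at `γ ∈ 𝔤_e*` is `e + sliceMap γ`. -/
def genericPoint (B : LinearMap.BilinForm F V) (e f : Module.End F V) :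
    Module.End (SymmetricAlgebra F (centraliser B e))
      (SymmetricAlgebra F (centraliser B e) ⊗[F] V) :=
  e.baseChange _ + ∑ j, SymmetricAlgebra.ι F _ (Module.finBasis F (centraliser B e) j) •
    (sliceMap B e f ((Module.finBasis F (centraliser B e)).coord j)).baseChange _

/-- The restriction to the Slodowy slice of `Δ_ℓ`, the coefficient of `t ^ (n - ℓ)` in the
characteristic polynomial of an endomorphism of the `n`-dimensional space `V`. -/
def sliceRestriction (B : LinearMap.BilinForm F V) (e f : Module.End F V) (l : ℕ) :
    SymmetricAlgebra F (centraliser B e) :=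
  (genericPoint B e f).charpoly.coeff (Module.finrank F V - l)

/-- The polynomials `^eF_1, …, ^eF_r` with `r = rk 𝔤` (here numbered from `0`): the components of
minimal degree of the restrictions of `F_i = Δ_{2i}` to the Slodowy slice. -/
def eF (B : LinearMap.BilinForm F V) (e f : Module.End F V)
    (i : Fin (LieAlgebra.rank F (skewAdjointLieSubalgebra B))) :
    SymmetricAlgebra F (centraliser B e) :=
  minComponent (sliceRestriction B e f (2 * (i.1 + 1)))

/-- The zero set `N_F(e)` of `^eF_1, …, ^eF_r` in `𝔤_e*`. -/
def nullConeF (B : LinearMap.BilinForm F V) (e f : Module.End F V) :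
    Set (Module.Dual F (centraliser B e)) :=
  {γ | ∀ i, evalAt γ (eF B e f i) = 0}

end Slice

/-! ### Cyclic vectors and the anti-diagonal subspaces -/

/-- `w_1, …, w_k` are cyclic vectors for the nilpotent endomorphism `e`, with Jordan blocks of
sizes `d_1 + 1, …, d_k + 1`: one has `e ^ (d_i + 1) w_i = 0`, and the vectors `e ^ a w_i` with
`0 ≤ a ≤ d_i` form a basis of `V`. -/
def IsCyclicSystem (e : Module.End F V) {k : ℕ} (d : Fin k → ℕ) (w : Fin k → V) : Prop :=
  (∀ i, (e ^ (d i + 1)) (w i) = 0) ∧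
    LinearIndependent F (fun p : Σ i : Fin k, Fin (d i + 1) => (e ^ (p.2 : ℕ)) (w p.1)) ∧
    Submodule.span F
      (Set.range fun p : Σ i : Fin k, Fin (d i + 1) => (e ^ (p.2 : ℕ)) (w p.1)) = ⊤

/-- Cyclic vectors adapted to `B` and normalised, in the case `i' = i` for all `i`: the spaces
`V[i] = span {e ^ a w_i}` are pairwise orthogonal, `(w_i, e ^ s w_i) = 0` for `s < d_i`, and
`(w_i, e ^ d_i w_i) = 1`. -/
def IsAdapted (B : LinearMap.BilinForm F V) (e : Module.End F V) {k : ℕ} (d : Fin k → ℕ)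
    (w : Fin k → V) : Prop :=
  IsCyclicSystem e d w ∧
    (∀ i j, i ≠ j → ∀ a b : ℕ, B ((e ^ a) (w i)) ((e ^ b) (w j)) = 0) ∧
    (∀ i, ∀ s < d i, B (w i) ((e ^ s) (w i)) = 0) ∧
    ∀ i, B (w i) ((e ^ d i) (w i)) = 1

/-- `x` is the element `ξ_i^{j,s}` of the centraliser of `e` in `𝔤𝔩(V)`: it sends `w_i` to
`e ^ s w_j` and all other cyclic vectors to `0`. -/
def IsXi (e : Module.End F V) {k : ℕ} (w : Fin k → V) (i j : Fin k) (s : ℕ)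
    (x : glCentraliser e) : Prop :=
  x.1 (w i) = (e ^ s) (w j) ∧ ∀ t, t ≠ i → x.1 (w t) = 0

/-- The subspace `V_m*` of the dual of the centraliser of `e` in `𝔤𝔩(V)`, spanned by those members
of the basis dual to `{ξ_i^{j,s}}` that have `i + j = m + 1`; that is, the functions vanishing on
all the other `ξ_i^{j,s}`. (Here `i`, `j` and `m` are numbered from `0`, so the condition reads
`i + j = m`.) -/
def antidiagDual (e : Module.End F V) {k : ℕ} (w : Fin k → V) (m : Fin k) :
    Submodule F (Module.Dual F (glCentraliser e)) :=
  (Submodule.span F {x : glCentraliser e |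
    ∃ i j : Fin k, ∃ s : ℕ, (i : ℕ) + j ≠ m ∧ IsXi e w i j s x}).dualAnnihilator

/-- The subspace `V_{𝔤,m}* = V_m* ∩ 𝔤_e*` of `𝔤_e*`, where `𝔤_e*` is identified by restriction with
the annihilator of the self-adjoint elements in the dual of the centraliser of `e` in `𝔤𝔩(V)`. -/
def antidiagDualLie (B : LinearMap.BilinForm F V) (e : Module.End F V) {k : ℕ} (w : Fin k → V)
    (m : Fin k) : Submodule F (Module.Dual F (centraliser B e)) :=
  (antidiagDual e w m ⊓
      ((B.selfAdjointSubmodule).comap (glCentraliser e).subtype).dualAnnihilator).map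
    (Submodule.inclusion (inf_le_right : centraliser B e ≤ glCentraliser e)).dualMap

end

end NullCone

/-!
Write `Δ_l` for the coefficient of `t ^ (n - l)` in the characteristic polynomial, so that the `F_i`
are the `Δ_l` with `l = 2 i`, and let `r = n / 2`. The proof has four ingredients.

*Leading coefficients.* Along a line `e + T Y` the characteristic polynomial is `det (t - e - T Y)`.
Row and column operations bring `t - e` to Smith normal form, with invariant factors `t ^ (d_i + 1)`
and otherwise ones, so `Δ_l` becomes a sum of minors of the transformed `Y`, and the coefficient of
`T ^ a` vanishes unless `a` blocks of `e` have total size at least `l`. If `l` exceeds the total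
size of the `q` largest blocks, then only the rows and columns of the nontrivial invariant factors
contribute to the coefficient of `T ^ (q + 1)`: it is a sum of coefficients of `(q + 1)`-minors of a
`k × k` matrix of polynomials in `t`, whose relevant coefficients are the traces `tr (Y ξ_i^{j,s})`
(`coeff_charpoly_line_leading`, `IsCyclicSystem.coeff_lineCharpoly_leading`). This gives the degree
of `^eF_i` and a formula for it (`IsAdapted.minComponent_sliceRestriction`). The formula involves
`Y` only through the linear form `tr (Y ·)` on the centraliser of `e`, so `^eF_i` is invariant under
`G_e` (`IsCyclicSystem.coeff_mem_invariants`).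

*The subspace `W`.* Linear forms on the centraliser correspond to `k × k` matrices of polynomials,
skew-adjointness being a symmetry condition. For a form in `W` all the nonzero entries on the `m`-th
antidiagonal come from a single polynomial `x_m`: their coefficients are its values at distinct
points. If `m` is the last antidiagonal in use, the matrix is anti-triangular, and the minor that
gives `^eF_i` for the `m`-th range of degrees is the product of the entries on that antidiagonal.
The order of vanishing of this product at `t = 0` is controlled by the number of roots of `x_m`,
hence by its degree, and the lowest coefficient of the product is, up to a nonzero factor, the value
of one of the `^eF_i`. So `W` meets the common zeros only in the origin
(`IsAdapted.exists_subspaces`).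

*Commutative algebra.* Together with linear equations of `W`, the `^eF_i` are homogeneous and as
many as `dim 𝔤_e`, with the origin as their only common zero. The local ring of the origin is
Cohen–Macaulay, so they form a regular sequence there, and by homogeneity also globally
(`isRegular_of_disjoint_subspace`). Krull's height theorem and the Nullstellensatz give the
codimension of the components (`codim_eq_length_of_isWeaklyRegular`).

*The null-cone.* It coincides with the common zeros of the `^eF_i`
(`IsAdapted.nullCone_eq_nullConeF`). Since these are invariants without constant term, one inclusion
is clear. For the other, the stabiliser in `𝔤_e` of a suitable linear form has dimension at most `r`
(`IsAdapted.finrank_ker_coadjoint_le`); moving an affine complement to the coadjoint orbit by Cayley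
transforms shows that an invariant is determined by its restriction to an affine subspace of
dimension at most `r` (`eq_zero_of_mem_invariants_of_vanishing`). Thus the algebra of invariants
embeds into a polynomial ring in at most `r` variables. As the restrictions of the `^eF_i` to `W`
are `r` algebraically independent functions, restriction to `W` is injective on the invariants, and
since `F[W]` is integral over the restrictions of the `^eF_i`, every invariant is integral over the
`^eF_i` and hence constant on their common zeros (`evalAt_eq_evalAt_zero_of_mem`).

Besides, the rank of `𝔤` is `n / 2`, by comparing a generic element of a torus with a regular
element (`rank_eq_of_basis`); adapted cyclic vectors are split off one block at a time
(`exists_isAdapted_of_finrank_range_pow`); and the trace form pairs `𝔤_f` and `𝔤_e` perfectly,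
because in a representation of `𝔰𝔩₂` the kernel of `f` meets the image of `e` trivially
(`slicePairing_bijective`).
-/

namespace NullCone

open Polynomial

/-! ### The characteristic polynomial along a line through a nilpotent endomorphism -/

section Minors

variable {n R : Type*} [Fintype n] [DecidableEq n] [CommRing R]

/-- Expansion of `det (D + M)`, for diagonal `D`, into principal minors of `M`. -/
theorem det_diagonal_add_eq_sum_minors (D : n → R) (M : Matrix n n R) :
    (Matrix.diagonal D + M).det = ∑ s : Finset n, (∏ x ∈ sᶜ, D x) *
      (M.submatrix (Subtype.val : s → n) (Subtype.val : s → n)).det := by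
  have h : (Matrix.diagonal D + M).det =
      (Matrix.detRowAlternating : (n → R) [⋀^n]→ₗ[R] R) ((fun i => M i) +
        fun i => Matrix.diagonal D i) := by
    rw [add_comm]; rfl
  rw [h, AlternatingMap.map_add_univ]
  refine Finset.sum_congr rfl fun s _ => ?_
  have h1 : (s.piecewise (fun i => M i) (fun i => Matrix.diagonal D i) : n → n → R) =
      fun i => (if i ∈ sᶜ then D i else 1) • (s.piecewise M.row (1 : Matrix n n R).row) i := by
    funext i j
    by_cases hi : i ∈ s
    · simp [Finset.piecewise, hi, Matrix.row]
    · simp [Finset.piecewise, hi, Matrix.row, Matrix.diagonal_apply, Matrix.one_apply]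
  rw [h1, AlternatingMap.map_smul_univ, ← Matrix.det_piecewise_one_eq_submatrix_det M s]
  simp only [Finset.prod_ite_mem, Finset.univ_inter, smul_eq_mul]
  rfl

/-- If `L (t - E) U` is diagonal with the same determinant as `t - E`, then the coefficients of the
characteristic polynomial of `E + T Y` are sums of minors of `L Y U`: only the diagonal entries
outside the minor enter. -/
theorem coeff_charpoly_line [IsDomain R] (E Y : Matrix n n R) (L U : Matrix n n R[X])
    (D : n → R[X]) (hLU : L * E.charmatrix * U = Matrix.diagonal D)
    (hD : ∏ x, D x = E.charpoly) (a c : ℕ) :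
    (((E.map C + (X : R[X]) • Y.map C).charpoly).coeff c).coeff a =
      (-1) ^ a * ∑ s ∈ Finset.univ.powersetCard a, ((∏ x ∈ sᶜ, D x) *
        ((L * Y.map C * U).submatrix (Subtype.val : s → n) (Subtype.val : s → n)).det).coeff c := by
  -- by comparing determinants, `L` and `U` are unimodular
  have hdet : L.det * U.det = 1 := by
    have h := congrArg Matrix.det hLU
    rw [Matrix.det_mul, Matrix.det_mul, Matrix.det_diagonal, hD] at h
    have h0 : E.charpoly ≠ 0 := E.charpoly_monic.ne_zero
    rw [Matrix.charpoly] at h h0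
    exact mul_right_cancel₀ h0 (by rw [one_mul]; linear_combination h)
  let j : R[X] →+* R[X][X] := mapRingHom C
  have hj : ∀ M : Matrix n n R[X], (M.map j).det = j M.det := fun M =>
    (RingHom.map_det j M).symm
  have hchar : (E.map C + (X : R[X]) • Y.map C).charmatrix =
      E.charmatrix.map j - (C X : R[X][X]) • (Y.map C).map j := by
    ext1 x y
    simp only [Matrix.charmatrix_apply, Matrix.sub_apply, Matrix.map_apply, Matrix.add_apply,
      Matrix.smul_apply, smul_eq_mul, map_add, map_mul, j, coe_mapRingHom,
      Polynomial.map_C, Matrix.diagonal_apply]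
    split_ifs <;> simp <;> ring
  have hprod : L.map j * (E.map C + (X : R[X]) • Y.map C).charmatrix * U.map j =
      Matrix.diagonal (fun x => j (D x)) + (-(C X : R[X][X])) • (L * Y.map C * U).map j := by
    have h1 : (L * E.charmatrix * U).map j = Matrix.diagonal (fun x => j (D x)) := by
      rw [hLU]; exact Matrix.diagonal_map (map_zero j)
    rw [hchar, ← h1]
    rw [Matrix.mul_sub, Matrix.sub_mul]
    simp only [Matrix.map_mul, Matrix.mul_smul, Matrix.smul_mul, sub_eq_add_neg]
    congr 1
    ext1 x y
    simp
    ring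
  have hcp : (E.map C + (X : R[X]) • Y.map C).charpoly =
      ∑ s : Finset n, j ((∏ x ∈ sᶜ, D x) *
        ((L * Y.map C * U).submatrix (Subtype.val : s → n) (Subtype.val : s → n)).det) *
          C ((-1) ^ s.card * X ^ s.card) := by
    have h1 : (E.map C + (X : R[X]) • Y.map C).charpoly =
        (L.map j * (E.map C + (X : R[X]) • Y.map C).charmatrix * U.map j).det := by
      rw [Matrix.det_mul, Matrix.det_mul, hj, hj, Matrix.charpoly, mul_right_comm, ← map_mul, hdet,
        map_one, one_mul]
    rw [h1, hprod, det_diagonal_add_eq_sum_minors]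
    refine Finset.sum_congr rfl fun s _ => ?_
    rw [Matrix.submatrix_smul, Pi.smul_apply, Pi.smul_apply, Matrix.det_smul, Fintype.card_coe,
      Matrix.submatrix_map,
      ← RingHom.mapMatrix_apply, ← RingHom.map_det, map_mul, map_prod]
    rw [← neg_one_mul, mul_pow]
    simp only [map_mul, map_pow, map_neg, map_one]
    ring
  rw [hcp, Polynomial.finsetSum_coeff, Polynomial.finsetSum_coeff]
  have h2 : ∀ (p : R[X]) (m : ℕ), ((j p * C ((-1) ^ m * X ^ m)).coeff c).coeff a =
      if m = a then (-1) ^ a * p.coeff c else 0 := by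
    intro p m
    rw [coeff_mul_C, coe_mapRingHom, coeff_map, coeff_C_mul]
    have : ((-1) ^ m * X ^ m : R[X]) = C ((-1) ^ m) * X ^ m := by simp
    rw [this, coeff_C_mul, coeff_X_pow]
    by_cases h : m = a
    · subst h; simp; ring
    · simp [h, Ne.symm h]
  simp_rw [h2]
  rw [← Finset.sum_filter, Finset.mul_sum]
  refine Finset.sum_congr ?_ fun _ _ => rfl
  ext s; simp [Finset.mem_powersetCard]

end Minors

section JordanBlock

variable (F : Type*) [Field F]

/-- The nilpotent Jordan block of size `d + 1`. -/
noncomputable def jordanBlock (d : ℕ) : Matrix (Fin (d + 1)) (Fin (d + 1)) F :=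
  Matrix.of fun a b => if (a : ℕ) = b + 1 then 1 else 0

/-- The row operations bringing `t - e` to Smith normal form, for a Jordan block `e`. -/
noncomputable def smithLeft (d : ℕ) : Matrix (Fin (d + 1)) (Fin (d + 1)) F[X] :=
  Matrix.of fun x c => if x = Fin.last d then X ^ (c : ℕ)
    else if (x : ℕ) < c then - X ^ ((c : ℕ) - 1 - x) else 0

/-- The column operations bringing `t - e` to Smith normal form, for a Jordan block `e`. -/
noncomputable def smithRight (d : ℕ) : Matrix (Fin (d + 1)) (Fin (d + 1)) F[X] :=
  Matrix.of fun b c => if c = Fin.last d then X ^ (d - (b : ℕ)) else if b = c then 1 else 0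

/-- The diagonal of the Smith normal form of `t - e`, for a Jordan block `e`. -/
noncomputable def smithDiag (d : ℕ) (x : Fin (d + 1)) : F[X] :=
  if x = Fin.last d then X ^ (d + 1) else 1

theorem smithLeft_mul_charmatrix (d : ℕ) (x c : Fin (d + 1)) :
    (smithLeft F d * (jordanBlock F d).charmatrix) x c =
      if x = Fin.last d then (if c = Fin.last d then X ^ (d + 1) else 0)
      else if c = Fin.last d then - X ^ (d - (x : ℕ)) else if x = c then 1 else 0 := by
  have h1 : (smithLeft F d * (jordanBlock F d).charmatrix) x c =
      smithLeft F d x c * X - ∑ y : Fin (d + 1), smithLeft F d x y *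
        (if (y : ℕ) = c + 1 then 1 else 0) := by
    rw [Matrix.charmatrix, Matrix.mul_sub, Matrix.sub_apply, Matrix.scalar_apply,
      Matrix.mul_diagonal, Matrix.mul_apply]
    congr 1
    refine Finset.sum_congr rfl fun y _ => ?_
    by_cases h : (y : ℕ) = c + 1 <;> simp [jordanBlock, h]
  rw [h1]
  by_cases hc : c = Fin.last d
  · have h2 : ∀ y : Fin (d + 1), ¬ ((y : ℕ) = c + 1) := by
      intro y; subst hc; simp only [Fin.val_last]; omega
    simp only [h2, if_false, mul_zero, Finset.sum_const_zero, sub_zero]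
    subst hc
    by_cases hx : x = Fin.last d
    · simp [smithLeft, hx, pow_succ]
    · have hx' : (x : ℕ) < d := by
        have := x.2; have : (x : ℕ) ≠ d := fun h => hx (Fin.ext h); omega
      simp only [smithLeft, Matrix.of_apply, hx, if_false, Fin.val_last, hx', if_true]
      rw [neg_mul, ← pow_succ]
      congr 2; omega
  · have hc' : (c : ℕ) + 1 < d + 1 := by
      have := c.2; have : (c : ℕ) ≠ d := fun h => hc (Fin.ext h); omega
    rw [Finset.sum_eq_single (⟨c + 1, hc'⟩ : Fin (d + 1))]
    rotate_left
    · intro y _ hy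
      have : ¬ ((y : ℕ) = c + 1) := fun h => hy (Fin.ext h)
      simp [this]
    · simp
    simp only [if_true, mul_one]
    by_cases hx : x = Fin.last d
    · simp [smithLeft, hx, hc, pow_succ]
    · simp only [smithLeft, Matrix.of_apply, hx, hc, if_false]
      rcases lt_trichotomy (x : ℕ) c with h | h | h
      · have h3 : x ≠ c := fun h' => by rw [h'] at h; exact lt_irrefl _ h
        have h4 : (x : ℕ) < c + 1 := by omega
        simp only [h, h4, h3, if_true, if_false]
        rw [neg_mul, ← pow_succ, sub_neg_eq_add]
        have : (c : ℕ) - 1 - x + 1 = c + 1 - 1 - x := by omega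
        rw [this]; ring
      · have h3 : x = c := Fin.ext h
        subst h3
        simp
      · have h3 : x ≠ c := fun h' => by rw [h'] at h; exact lt_irrefl _ h
        have h4 : ¬ (x : ℕ) < c := by omega
        have h5 : ¬ (x : ℕ) < c + 1 := by omega
        simp [h3, h4, h5]

/-- The Smith normal form of `t - e`, for a Jordan block `e`. -/
theorem smithLeft_mul_charmatrix_mul_smithRight (d : ℕ) :
    smithLeft F d * (jordanBlock F d).charmatrix * smithRight F d =
      Matrix.diagonal (smithDiag F d) := by
  ext1 x c
  rw [Matrix.mul_apply]
  simp_rw [smithLeft_mul_charmatrix]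
  by_cases hx : x = Fin.last d
  · rw [Finset.sum_eq_single (Fin.last d)]
    · subst hx
      by_cases hc : c = Fin.last d
      · subst hc
        simp [smithRight, smithDiag]
      · simp [smithRight, hc, Ne.symm hc]
    · intro y _ hy; simp [hx, hy]
    · simp
  · rw [Fin.sum_univ_castSucc]
    have hx' : (x : ℕ) < d := by
      have := x.2; have : (x : ℕ) ≠ d := fun h => hx (Fin.ext h); omega
    have hne : ∀ y : Fin d, y.castSucc ≠ Fin.last d := fun y => (Fin.castSucc_lt_last y).ne
    simp only [hx, hne, if_false, if_true]
    rw [Finset.sum_eq_single (⟨x, hx'⟩ : Fin d)]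
    · have h1 : (⟨x, hx'⟩ : Fin d).castSucc = x := rfl
      rw [h1]
      by_cases hc : c = Fin.last d
      · subst hc
        simp [smithRight, hx]
      · by_cases hxc : x = c
        · subst hxc; simp [smithRight, smithDiag, hc, Ne.symm hc]
        · simp [smithRight, hc, hxc, Ne.symm hc]
    · intro y _ hy
      have : x ≠ y.castSucc := fun h => hy (Fin.ext (congrArg Fin.val h).symm)
      simp [this]
    · simp

theorem prod_smithDiag (d : ℕ) : ∏ x, smithDiag F d x = X ^ (d + 1) := by
  simp [smithDiag, Finset.prod_ite_eq']

end JordanBlock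

section JordanMatrix

variable (F : Type*) [Field F] {k : ℕ} (d : Fin k → ℕ)

/-- The index set `{(i, a) | 0 ≤ a ≤ d_i}` of the Jordan basis `e ^ a w_i`. -/
abbrev JordanIndex {k : ℕ} (d : Fin k → ℕ) : Type := Σ i : Fin k, Fin (d i + 1)

/-- The nilpotent matrix with Jordan blocks of sizes `d_i + 1`. -/
noncomputable def jordanMatrix : Matrix (JordanIndex d) (JordanIndex d) F :=
  Matrix.blockDiagonal' fun i => jordanBlock F (d i)

theorem charmatrix_jordanMatrix : (jordanMatrix F d).charmatrix =
    Matrix.blockDiagonal' fun i => (jordanBlock F (d i)).charmatrix := by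
  ext1 ⟨i, a⟩ ⟨j, b⟩
  by_cases h : i = j
  · subst h
    simp [Matrix.charmatrix_apply, jordanMatrix, Matrix.diagonal_apply, Matrix.blockDiagonal'_apply]
  · have h' : (⟨i, a⟩ : JordanIndex d) ≠ ⟨j, b⟩ := fun h' => h (congrArg Sigma.fst h')
    simp [jordanMatrix, h', h,
      Matrix.blockDiagonal'_apply]

theorem smith_jordanMatrix :
    (Matrix.blockDiagonal' fun i => smithLeft F (d i)) * (jordanMatrix F d).charmatrix *
      (Matrix.blockDiagonal' fun i => smithRight F (d i)) =
      Matrix.diagonal fun x : JordanIndex d => smithDiag F (d x.1) x.2 := by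
  rw [charmatrix_jordanMatrix, ← Matrix.blockDiagonal'_mul, ← Matrix.blockDiagonal'_mul]
  simp_rw [smithLeft_mul_charmatrix_mul_smithRight]
  exact Matrix.blockDiagonal'_diagonal _

/-- The polynomial `∑ Y_{(i,a),(j,b)} t ^ (a + d_j - b)`, which collects the traces of the products
of `Y` with the elements `ξ_i^{j,s}` of the centraliser of `e`. -/
noncomputable def blockPoly {F : Type*} [Field F] {k : ℕ} {d : Fin k → ℕ}
    (Y : Matrix (JordanIndex d) (JordanIndex d) F) (i j : Fin k) : F[X] :=
  ∑ a : Fin (d i + 1), ∑ b : Fin (d j + 1), C (Y ⟨i, a⟩ ⟨j, b⟩) * X ^ ((a : ℕ) + (d j - b))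

/-- In the rows and columns of the non-trivial invariant factors, the transformed matrix has the
entries `blockPoly Y i j`. -/
theorem smith_mul_last (Y : Matrix (JordanIndex d) (JordanIndex d) F) (i j : Fin k) :
    ((Matrix.blockDiagonal' fun i => smithLeft F (d i)) * Y.map C *
      (Matrix.blockDiagonal' fun i => smithRight F (d i))) ⟨i, Fin.last _⟩ ⟨j, Fin.last _⟩ =
      blockPoly Y i j := by
  rw [Matrix.mul_apply, Fintype.sum_sigma, Finset.sum_eq_single j, blockPoly, Finset.sum_comm]
  · refine Finset.sum_congr rfl fun b _ => ?_
    rw [Matrix.mul_apply, Fintype.sum_sigma, Finset.sum_eq_single i, Finset.sum_mul]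
    · refine Finset.sum_congr rfl fun a _ => ?_
      simp only [Matrix.blockDiagonal'_apply, smithLeft, smithRight, Matrix.of_apply, if_true,
        Matrix.map_apply, dite_true, cast_eq, pow_add]
      ring
    · intro i' _ hi'
      simp [Matrix.blockDiagonal'_apply, Ne.symm hi']
    · simp
  · intro j' _ hj'
    simp [Matrix.blockDiagonal'_apply, hj']
  · simp

theorem charpoly_jordanMatrix : ∏ x : JordanIndex d, smithDiag F (d x.1) x.2 =
    (jordanMatrix F d).charpoly := by
  have h1 : ∏ x : JordanIndex d, smithDiag F (d x.1) x.2 = X ^ Fintype.card (JordanIndex d) := by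
    rw [Fintype.prod_sigma]
    simp [prod_smithDiag, Finset.prod_pow_eq_pow_sum]
  have h2 := congrArg Matrix.det (smith_jordanMatrix F d)
  rw [Matrix.det_mul, Matrix.det_mul, Matrix.det_diagonal] at h2
  rw [h1] at h2 ⊢
  refine Polynomial.eq_of_monic_of_dvd_of_natDegree_le (Matrix.charpoly_monic _)
    (monic_X_pow _) ⟨(Matrix.blockDiagonal' fun i => smithLeft F (d i)).det *
      (Matrix.blockDiagonal' fun i => smithRight F (d i)).det, ?_⟩ ?_
  · rw [← h2, Matrix.charpoly]; ring
  · rw [natDegree_X_pow, Matrix.charpoly_natDegree_eq_dim]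

end JordanMatrix

/-- The sum of the sizes of the first `a` Jordan blocks. -/
def blockSum {k : ℕ} (d : Fin k → ℕ) (a : ℕ) : ℕ :=
  ∑ i ∈ Finset.univ.filter fun i : Fin k => (i : ℕ) < a, (d i + 1)

section BlockSum

variable {k : ℕ} {d : Fin k → ℕ}

theorem blockSum_mono : Monotone (blockSum d) := fun a b hab =>
  Finset.sum_le_sum_of_subset fun i hi => by
    simp only [Finset.mem_filter, Finset.mem_univ, true_and] at hi ⊢; omega

theorem blockSum_zero : blockSum d 0 = 0 := by simp [blockSum]

theorem blockSum_succ (m : Fin k) : blockSum d (m + 1) = blockSum d m + (d m + 1) := by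
  have h : (Finset.univ.filter fun i : Fin k => (i : ℕ) < m + 1) =
      insert m (Finset.univ.filter fun i : Fin k => (i : ℕ) < m) := by
    ext i
    simp only [Finset.mem_filter, Finset.mem_univ, true_and, Finset.mem_insert, Fin.ext_iff]
    omega
  rw [blockSum, blockSum, h, Finset.sum_insert (by simp), add_comm]

theorem blockSum_of_le {a : ℕ} (ha : k ≤ a) : blockSum d a = ∑ i, (d i + 1) := by
  rw [blockSum, Finset.filter_true_of_mem fun i _ => i.2.trans_le ha]

/-- As the block sizes decrease, any `a` blocks together have at most the size of the
first `a`. -/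
theorem sum_le_blockSum (hd : Antitone d) (I : Finset (Fin k)) :
    ∑ i ∈ I, (d i + 1) ≤ blockSum d I.card := by
  have hk : I.card ≤ k := by simpa using I.card_le_univ
  have h1 : ∑ i ∈ I, (d i + 1) = ∑ j : Fin I.card, (d (I.orderEmbOfFin rfl j) + 1) := by
    conv_lhs => rw [← Finset.image_orderEmbOfFin_univ I rfl]
    rw [Finset.sum_image fun _ _ _ _ h => (I.orderEmbOfFin rfl).injective h]
  have h2 : blockSum d I.card = ∑ j : Fin I.card, (d (Fin.castLE hk j) + 1) := by
    rw [blockSum]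
    symm
    refine Finset.sum_of_injOn (Fin.castLE hk) (fun _ _ _ _ h => Fin.castLE_injective hk h) ?_ ?_ ?_
    · intro j _; simp
    · intro i hi hi'
      simp only [Finset.mem_filter, Finset.mem_univ, true_and] at hi
      exact absurd ⟨⟨i, hi⟩, by simp, rfl⟩ hi'
    · intro _ _; rfl
  rw [h1, h2]
  refine Finset.sum_le_sum fun j _ => Nat.succ_le_succ (hd ?_)
  have h3 : ∀ (m : ℕ) (hm : m < I.card), m ≤ (I.orderEmbOfFin rfl ⟨m, hm⟩ : ℕ) := by
    intro m
    induction m with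
    | zero => intro _; exact Nat.zero_le _
    | succ m ih =>
      intro hm
      have h4 : I.orderEmbOfFin rfl ⟨m, by omega⟩ < I.orderEmbOfFin rfl ⟨m + 1, hm⟩ :=
        (I.orderEmbOfFin rfl).strictMono (by simp [Fin.lt_def])
      have := ih (by omega)
      rw [Fin.lt_def] at h4
      omega
  exact h3 j j.2

/-- The blocks of a family that is one too large for the first `q` blocks exceed it by at most
one block. -/
theorem sum_sub_le (hd : Antitone d) {I : Finset (Fin k)} {q l : ℕ} (hI : I.card = q + 1)
    (hl : blockSum d q < l) {i : Fin k} (hi : i ∈ I) : ∑ j ∈ I, (d j + 1) - l ≤ d i := by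
  have h1 := sum_le_blockSum hd (I.erase i)
  rw [Finset.card_erase_of_mem hi, hI, Nat.add_sub_cancel] at h1
  have h2 := Finset.add_sum_erase I (fun j => d j + 1) hi
  omega

end BlockSum

section Leading

variable {F : Type*} [Field F] {k : ℕ} {d : Fin k → ℕ}

/-- The embedding of the set of Jordan blocks that sends `i` to the index of `e ^ d_i w_i`. -/
def lastEmb (d : Fin k → ℕ) : Fin k ↪ JordanIndex d :=
  ⟨fun i => ⟨i, Fin.last _⟩, fun _ _ h => congrArg Sigma.fst h⟩

/-- A minor that contains the last rows of the blocks in a set `I` picks up the coefficient in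
degree `∑ i ∈ I, (d i + 1) - l`: the diagonal entries outside it contribute the factors
`X ^ (d i + 1)` with `i ∉ I`. -/
theorem coeff_minor (s : Finset (JordanIndex d))
    (l : ℕ) (hl : l ≤ ∑ i, (d i + 1)) (p : F[X]) :
    ((∏ x ∈ sᶜ, smithDiag F (d x.1) x.2) * p).coeff (∑ i, (d i + 1) - l) =
      if l ≤ ∑ i with lastEmb d i ∈ s, (d i + 1) then
        p.coeff (∑ i with lastEmb d i ∈ s, (d i + 1) - l) else 0 := by
  have h0 : ∀ x : JordanIndex d, smithDiag F (d x.1) x.2 =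
      X ^ (if x.2 = Fin.last _ then d x.1 + 1 else 0) := by
    intro x; rw [smithDiag]; split_ifs <;> simp
  have h1 : ∀ t : Finset (JordanIndex d),
      ∑ x ∈ t, (if x.2 = Fin.last _ then d x.1 + 1 else 0) =
        ∑ i with lastEmb d i ∈ t, (d i + 1) := by
    intro t
    rw [← Finset.sum_filter]
    symm
    refine Finset.sum_of_injOn (lastEmb d) (lastEmb d).injective.injOn ?_ ?_ ?_
    · intro i hi
      have hi' : lastEmb d i ∈ t := by simpa using hi
      simp only [Finset.coe_filter, Set.mem_ofPred_eq]
      exact ⟨hi', rfl⟩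
    · rintro ⟨i, a⟩ hx hx'
      simp only [Finset.mem_filter] at hx
      obtain ⟨hx1, rfl⟩ := hx
      exact absurd ⟨i, by simpa using! hx1, rfl⟩ hx'
    · intro _ _; rfl
  have h2 : ∑ i with lastEmb d i ∈ sᶜ, (d i + 1) + ∑ i with lastEmb d i ∈ s, (d i + 1) =
      ∑ i, (d i + 1) := by
    have := Finset.sum_filter_add_sum_filter_not Finset.univ
      (fun i => lastEmb d i ∈ s) (fun i => d i + 1)
    simp only [Finset.mem_compl]
    omega
  simp_rw [h0]
  rw [Finset.prod_pow_eq_pow_sum, h1, coeff_X_pow_mul']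
  by_cases h : l ≤ ∑ i with lastEmb d i ∈ s, (d i + 1)
  · rw [if_pos h, if_pos (by omega)]
    congr 1; omega
  · rw [if_neg h, if_neg (by omega)]

theorem card_filter_lastEmb_le (s : Finset (JordanIndex d)) :
    (Finset.univ.filter fun i => lastEmb d i ∈ s).card ≤ s.card := by
  rw [← Finset.card_map (lastEmb d)]
  refine Finset.card_le_card fun x hx => ?_
  simp only [Finset.mem_map, Finset.mem_filter, Finset.mem_univ, true_and] at hx
  obtain ⟨i, hi, rfl⟩ := hx
  exact hi

/-- The coefficient of `T ^ a t ^ (n - l)` in the characteristic polynomial of `e + T Y` vanishes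
if `a` Jordan blocks of `e` do not have total size at least `l`. -/
theorem coeff_charpoly_line_eq_zero (hd : Antitone d)
    (Y : Matrix (JordanIndex d) (JordanIndex d) F) {a l : ℕ} (hl : l ≤ ∑ i, (d i + 1))
    (ha : blockSum d a < l) :
    ((((jordanMatrix F d).map C + (X : F[X]) • Y.map C).charpoly).coeff
      (∑ i, (d i + 1) - l)).coeff a = 0 := by
  rw [coeff_charpoly_line _ _ _ _ _ (smith_jordanMatrix F d) (charpoly_jordanMatrix F d),
    Finset.sum_eq_zero, mul_zero]
  intro s hs
  rw [coeff_minor s l hl, if_neg]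
  rw [not_le]
  refine ((sum_le_blockSum hd _).trans (blockSum_mono (card_filter_lastEmb_le s))).trans_lt ?_
  rwa [(Finset.mem_powersetCard.1 hs).2]

/-- The leading coefficient formula: if `l` exceeds the total size of the `q` largest Jordan blocks
of `e`, then the coefficient of `T ^ (q + 1) t ^ (n - l)` in the characteristic polynomial
of `e + T Y` is a sum of coefficients of `(q + 1) × (q + 1)` minors of the matrix `blockPoly Y`. -/
theorem coeff_charpoly_line_leading (hd : Antitone d)
    (Y : Matrix (JordanIndex d) (JordanIndex d) F) {q l : ℕ} (hl : l ≤ ∑ i, (d i + 1))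
    (hq : blockSum d q < l) :
    ((((jordanMatrix F d).map C + (X : F[X]) • Y.map C).charpoly).coeff
      (∑ i, (d i + 1) - l)).coeff (q + 1) =
      (-1) ^ (q + 1) * ∑ I ∈ (Finset.univ : Finset (Fin k)).powersetCard (q + 1),
        if l ≤ ∑ i ∈ I, (d i + 1) then
          ((Matrix.of (blockPoly Y)).submatrix (Subtype.val : I → Fin k)
            (Subtype.val : I → Fin k)).det.coeff (∑ i ∈ I, (d i + 1) - l) else 0 := by
  rw [coeff_charpoly_line _ _ _ _ _ (smith_jordanMatrix F d) (charpoly_jordanMatrix F d)]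
  congr 1
  have key : ∀ I : Finset (Fin k), (Finset.univ.filter fun i => lastEmb d i ∈ I.map (lastEmb d)) =
      I := by
    intro I; ext i; simp
  symm
  refine Finset.sum_of_injOn (fun I => I.map (lastEmb d))
    (fun _ _ _ _ h => Finset.map_injective _ h) ?_ ?_ ?_
  · intro I hI
    simpa [Finset.mem_powersetCard] using hI
  · intro s hs hs'
    -- any other minor contains the last rows of at most `q` blocks, which are too small together
    rw [coeff_minor s l hl, if_neg]
    rw [not_le]
    refine ((sum_le_blockSum hd _).trans (blockSum_mono ?_)).trans_lt hq
    rw [Finset.mem_powersetCard] at hs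
    refine Nat.le_of_lt_succ (lt_of_le_of_ne ((card_filter_lastEmb_le s).trans_eq hs.2) fun h => ?_)
    refine hs' ⟨Finset.univ.filter fun i => lastEmb d i ∈ s, ?_, ?_⟩
    · simpa [Finset.mem_powersetCard] using h
    · refine Finset.eq_of_subset_of_card_le ?_ ?_
      · intro x hx
        simp only [Finset.mem_map, Finset.mem_filter, Finset.mem_univ, true_and] at hx
        obtain ⟨i, hi, rfl⟩ := hx
        exact hi
      · rw [Finset.card_map, h, hs.2]
  · intro I _
    rw [coeff_minor _ l hl, key]
    split_ifs
    · congr 1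
      rw [← Matrix.det_submatrix_equiv_self (I.equivMap (lastEmb d))]
      congr 1
      ext1 x y
      simp only [Matrix.submatrix_apply, Matrix.of_apply, Finset.equivMap_apply_coe]
      exact (smith_mul_last F d Y x.1 y.1).symm
    · rfl

/-- Determinants of polynomial matrices whose entries have the same coefficients up to degree `b`
have the same coefficients up to degree `b`. -/
theorem coeff_det_congr {n : Type*} [Fintype n] [DecidableEq n] (M N : Matrix n n F[X]) (b : ℕ)
    (h : ∀ i j, ∀ c ≤ b, (M i j).coeff c = (N i j).coeff c) : M.det.coeff b = N.det.coeff b := by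
  let π := Ideal.Quotient.mk (Ideal.span {(X : F[X]) ^ (b + 1)})
  have h1 : ∀ p q : F[X], (∀ c ≤ b, p.coeff c = q.coeff c) ↔ π p = π q := by
    intro p q
    rw [Ideal.Quotient.eq, Ideal.mem_span_singleton, X_pow_dvd_iff]
    simp only [coeff_sub, sub_eq_zero, Nat.lt_succ_iff]
  refine (h1 _ _).2 ?_ b le_rfl
  rw [RingHom.map_det, RingHom.map_det]
  congr 1
  ext1 i j
  exact (h1 _ _).1 (h i j)

end Leading

section Cyclic

variable {F : Type*} [Field F] {V : Type*} [AddCommGroup V] [Module F V]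
  {e : Module.End F V} {k : ℕ} {d : Fin k → ℕ} {w : Fin k → V}

/-- The Jordan basis `e ^ a w_i` attached to a system of cyclic vectors. -/
noncomputable def IsCyclicSystem.basis (hw : IsCyclicSystem e d w) :
    Module.Basis (JordanIndex d) F V :=
  Module.Basis.mk hw.2.1 hw.2.2.ge

theorem IsCyclicSystem.basis_apply (hw : IsCyclicSystem e d w) (x : JordanIndex d) :
    hw.basis x = (e ^ (x.2 : ℕ)) (w x.1) := by
  simp [IsCyclicSystem.basis]

theorem pow_apply_eq_zero_of_le {u : V} {m n : ℕ} (h : (e ^ m) u = 0) (hmn : m ≤ n) :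
    (e ^ n) u = 0 := by
  obtain ⟨c, rfl⟩ := Nat.exists_eq_add_of_le' hmn
  rw [pow_add, Module.End.mul_apply, h, map_zero]

theorem IsCyclicSystem.pow_eq_zero (hw : IsCyclicSystem e d w) {i : Fin k} {m : ℕ}
    (h : d i < m) : (e ^ m) (w i) = 0 :=
  pow_apply_eq_zero_of_le (hw.1 i) h

theorem IsCyclicSystem.repr_pow (hw : IsCyclicSystem e d w) (j : Fin k) (m : ℕ)
    (x : JordanIndex d) :
    hw.basis.repr ((e ^ m) (w j)) x = if x.1 = j ∧ (x.2 : ℕ) = m then 1 else 0 := by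
  by_cases hm : m ≤ d j
  · have h1 : (e ^ m) (w j) = hw.basis ⟨j, ⟨m, Nat.lt_succ_of_le hm⟩⟩ := by
      rw [hw.basis_apply]
    rw [h1, Module.Basis.repr_self, Finsupp.single_apply]
    congr 1
    apply propext
    constructor
    · rintro rfl; exact ⟨rfl, rfl⟩
    · obtain ⟨i, a⟩ := x
      rintro ⟨h2, h3⟩
      simp only at h2 h3
      subst h2
      congr 1
      exact Fin.ext h3.symm
  · rw [hw.pow_eq_zero (not_le.1 hm), map_zero, Finsupp.zero_apply, if_neg]
    rintro ⟨rfl, h⟩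
    have := x.2.2
    omega

theorem IsCyclicSystem.toMatrix (hw : IsCyclicSystem e d w) :
    LinearMap.toMatrix hw.basis hw.basis e = jordanMatrix F d := by
  ext1 ⟨i, a⟩ ⟨j, b⟩
  have h1 : e (hw.basis ⟨j, b⟩) = (e ^ ((b : ℕ) + 1)) (w j) := by
    rw [hw.basis_apply, pow_succ', Module.End.mul_apply]
  rw [LinearMap.toMatrix_apply, h1, hw.repr_pow, jordanMatrix, Matrix.blockDiagonal'_apply]
  by_cases hij : i = j
  · subst hij; simp [jordanBlock]
  · simp [hij]

theorem mem_glCentraliser {x : Module.End F V} : x ∈ glCentraliser e ↔ e * x = x * e := by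
  rw [glCentraliser, LinearMap.mem_ker, LinearMap.sub_apply, LinearMap.mulLeft_apply,
    LinearMap.mulRight_apply, sub_eq_zero]

theorem pow_comm_of_mem {x : Module.End F V} (hx : x ∈ glCentraliser e) (a : ℕ) (u : V) :
    x ((e ^ a) u) = (e ^ a) (x u) := by
  have h : Commute e x := mem_glCentraliser.1 hx
  exact (LinearMap.congr_fun (h.pow_left a).eq u).symm

theorem IsCyclicSystem.ext (hw : IsCyclicSystem e d w) {x y : Module.End F V}
    (hx : x ∈ glCentraliser e) (hy : y ∈ glCentraliser e) (h : ∀ i, x (w i) = y (w i)) : x = y := by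
  refine hw.basis.ext fun p => ?_
  rw [hw.basis_apply, pow_comm_of_mem hx, pow_comm_of_mem hy, h]

/-- The centraliser of `e` consists of the maps given by arbitrary vectors `u_i = x w_i` with
`e ^ (d_i + 1) u_i = 0`. -/
noncomputable def IsCyclicSystem.cent (hw : IsCyclicSystem e d w) (u : Fin k → V) :
    Module.End F V :=
  hw.basis.constr F fun x => (e ^ (x.2 : ℕ)) (u x.1)

theorem IsCyclicSystem.cent_pow (hw : IsCyclicSystem e d w) {u : Fin k → V}
    (hu : ∀ i, (e ^ (d i + 1)) (u i) = 0) (i : Fin k) (a : ℕ) :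
    hw.cent u ((e ^ a) (w i)) = (e ^ a) (u i) := by
  by_cases ha : a ≤ d i
  · have h1 : (e ^ a) (w i) = hw.basis ⟨i, ⟨a, Nat.lt_succ_of_le ha⟩⟩ := by rw [hw.basis_apply]
    rw [h1, IsCyclicSystem.cent, Module.Basis.constr_basis]
  · rw [hw.pow_eq_zero (not_le.1 ha), map_zero, pow_apply_eq_zero_of_le (hu i) (not_le.1 ha)]

theorem IsCyclicSystem.cent_mem (hw : IsCyclicSystem e d w) {u : Fin k → V}
    (hu : ∀ i, (e ^ (d i + 1)) (u i) = 0) : hw.cent u ∈ glCentraliser e := by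
  rw [mem_glCentraliser]
  refine hw.basis.ext fun p => ?_
  rw [hw.basis_apply, Module.End.mul_apply, Module.End.mul_apply, hw.cent_pow hu,
    ← Module.End.mul_apply e (e ^ _), ← Module.End.mul_apply e (e ^ _), ← pow_succ', hw.cent_pow hu]

/-- The element `ξ_i^{j,s}` of the centraliser of `e` in `𝔤𝔩(V)`. -/
noncomputable def IsCyclicSystem.xi (hw : IsCyclicSystem e d w) (i j : Fin k) (s : ℕ) :
    Module.End F V :=
  hw.cent (Pi.single i ((e ^ s) (w j)))

theorem IsCyclicSystem.xi_aux (hw : IsCyclicSystem e d w) {i j : Fin k} {s : ℕ}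
    (h : d j ≤ s + d i) (t : Fin k) :
    (e ^ (d t + 1)) ((Pi.single i ((e ^ s) (w j)) : Fin k → V) t) = 0 := by
  by_cases ht : t = i
  · subst ht
    rw [Pi.single_eq_same, ← Module.End.mul_apply, ← pow_add]
    exact hw.pow_eq_zero (by omega)
  · rw [Pi.single_eq_of_ne ht, map_zero]

theorem IsCyclicSystem.xi_mem (hw : IsCyclicSystem e d w) {i j : Fin k} {s : ℕ}
    (h : d j ≤ s + d i) : hw.xi i j s ∈ glCentraliser e :=
  hw.cent_mem (hw.xi_aux h)

theorem IsCyclicSystem.xi_pow_same (hw : IsCyclicSystem e d w) {i j : Fin k} {s : ℕ}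
    (h : d j ≤ s + d i) (a : ℕ) : hw.xi i j s ((e ^ a) (w i)) = (e ^ (a + s)) (w j) := by
  rw [IsCyclicSystem.xi, hw.cent_pow (hw.xi_aux h), Pi.single_eq_same, pow_add,
    Module.End.mul_apply]

theorem IsCyclicSystem.xi_pow_of_ne (hw : IsCyclicSystem e d w) {i j : Fin k} {s : ℕ}
    (h : d j ≤ s + d i) (a : ℕ) {t : Fin k} (ht : t ≠ i) : hw.xi i j s ((e ^ a) (w t)) = 0 := by
  rw [IsCyclicSystem.xi, hw.cent_pow (hw.xi_aux h), Pi.single_eq_of_ne ht, map_zero]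

/-- The coefficients of `blockPoly Y` in small degrees are the values at the elements `ξ_i^{j,s}`
of the linear form `x ↦ tr (Y x)`. -/
theorem IsCyclicSystem.coeff_blockPoly (hw : IsCyclicSystem e d w)
    (Y : Module.End F V) (i j : Fin k) {c : ℕ} (hi : c ≤ d i) (hj : c ≤ d j) :
    (blockPoly (LinearMap.toMatrix hw.basis hw.basis Y) i j).coeff c =
      LinearMap.trace F V (Y * hw.xi i j (d j - c)) := by
  have hs : d j ≤ d j - c + d i := by omega
  rw [LinearMap.trace_eq_matrix_trace F hw.basis, Matrix.trace, Fintype.sum_sigma,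
    Finset.sum_eq_single i, blockPoly, Polynomial.finsetSum_coeff]
  · refine Finset.sum_congr rfl fun a _ => ?_
    rw [Polynomial.finsetSum_coeff]
    simp only [Matrix.diag_apply, LinearMap.toMatrix_apply, coeff_C_mul, coeff_X_pow,
      Module.End.mul_apply]
    rw [hw.basis_apply ⟨i, a⟩, hw.xi_pow_same hs]
    by_cases ha : (a : ℕ) ≤ c
    · rw [Finset.sum_eq_single (⟨a + (d j - c), by omega⟩ : Fin (d j + 1))]
      · rw [hw.basis_apply, if_pos, mul_one]
        simp only; omega
      · intro b _ hb
        rw [if_neg, mul_zero]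
        intro h
        refine hb (Fin.ext ?_)
        have := b.2
        simp only; omega
      · simp
    · rw [hw.pow_eq_zero (show d j < (a : ℕ) + (d j - c) by omega), map_zero, map_zero, Finsupp.zero_apply]
      refine Finset.sum_eq_zero fun b _ => ?_
      rw [if_neg (by omega), mul_zero]
  · intro i' _ hi'
    refine Finset.sum_eq_zero fun a _ => ?_
    rw [Matrix.diag_apply, LinearMap.toMatrix_apply, Module.End.mul_apply, hw.basis_apply,
      hw.xi_pow_of_ne hs _ hi', map_zero, map_zero, Finsupp.zero_apply]
  · simp

theorem IsCyclicSystem.finrank (hw : IsCyclicSystem e d w) :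
    Module.finrank F V = ∑ i, (d i + 1) := by
  rw [Module.finrank_eq_card_basis hw.basis]; simp

end Cyclic

section Line

variable {F : Type*} [Field F] {V : Type*} [AddCommGroup V] [Module F V] [FiniteDimensional F V]

/-- The characteristic polynomial of `e + T Y`, as a polynomial in `t` over `F[T]`. -/
noncomputable def lineCharpoly (e Y : Module.End F V) : F[X][X] :=
  (e.baseChange F[X] + (X : F[X]) • Y.baseChange F[X]).charpoly

theorem lineCharpoly_eq {ι : Type*} [Fintype ι] [DecidableEq ι] (v : Module.Basis ι F V)
    (e Y : Module.End F V) : lineCharpoly e Y =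
      ((LinearMap.toMatrix v v e).map C + (X : F[X]) • (LinearMap.toMatrix v v Y).map C).charpoly := by
  rw [lineCharpoly, ← LinearMap.charpoly_toMatrix _ (Algebra.TensorProduct.basis F[X] v),
    map_add, map_smul,
    LinearMap.toMatrix_baseChange, LinearMap.toMatrix_baseChange]
  rfl

theorem lineCharpoly_conj (e Y : Module.End F V) (g : V ≃ₗ[F] V) :
    lineCharpoly (g.conj e) (g.conj Y) = lineCharpoly e Y := by
  let G := LinearEquiv.baseChange F F[X] V V g
  have h : ∀ x : Module.End F V, (g.conj x).baseChange F[X] = G.conj (x.baseChange F[X]) := by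
    intro x
    refine TensorProduct.AlgebraTensorModule.curry_injective ?_
    ext u
    simp [G, LinearEquiv.conj_apply, LinearEquiv.baseChange]
  rw [lineCharpoly, lineCharpoly, h, h, ← map_smul, ← map_add, LinearEquiv.charpoly_conj]

variable {e : Module.End F V} {k : ℕ} {d : Fin k → ℕ} {w : Fin k → V}

theorem IsCyclicSystem.coeff_lineCharpoly_eq_zero (hw : IsCyclicSystem e d w) (hd : Antitone d)
    (Y : Module.End F V) {a l : ℕ} (hl : l ≤ Module.finrank F V) (ha : blockSum d a < l) :
    ((lineCharpoly e Y).coeff (Module.finrank F V - l)).coeff a = 0 := by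
  rw [lineCharpoly_eq hw.basis, hw.toMatrix]
  rw [hw.finrank] at hl ⊢
  exact coeff_charpoly_line_eq_zero hd _ hl ha

/-- The leading coefficient formula, in terms of any polynomials `P_ij` whose coefficients in
degrees `c ≤ min (d_i, d_j)` are `tr (Y ξ_i^{j, d_j - c})`. -/
theorem IsCyclicSystem.coeff_lineCharpoly_leading (hw : IsCyclicSystem e d w) (hd : Antitone d)
    (Y : Module.End F V) {q l : ℕ} (hl : l ≤ Module.finrank F V) (hq : blockSum d q < l)
    (P : Fin k → Fin k → F[X])
    (hP : ∀ i j, ∀ c ≤ d i, c ≤ d j →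
      (P i j).coeff c = LinearMap.trace F V (Y * hw.xi i j (d j - c))) :
    ((lineCharpoly e Y).coeff (Module.finrank F V - l)).coeff (q + 1) =
      (-1) ^ (q + 1) * ∑ I ∈ (Finset.univ : Finset (Fin k)).powersetCard (q + 1),
        if l ≤ ∑ i ∈ I, (d i + 1) then
          ((Matrix.of P).submatrix (Subtype.val : I → Fin k)
            (Subtype.val : I → Fin k)).det.coeff (∑ i ∈ I, (d i + 1) - l) else 0 := by
  rw [lineCharpoly_eq hw.basis, hw.toMatrix]
  rw [hw.finrank] at hl ⊢
  rw [coeff_charpoly_line_leading hd _ hl hq]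
  congr 1
  refine Finset.sum_congr rfl fun I hI => ?_
  split_ifs with h
  -- the coefficient in question has degree `∑ i ∈ I, (d i + 1) - l ≤ d i` for all `i ∈ I`, so only
  -- the coefficients of the entries covered by `hP` matter
  · refine coeff_det_congr _ _ _ fun i j c hc => ?_
    have hI' := (Finset.mem_powersetCard.1 hI).2
    have hi := hc.trans (sum_sub_le hd hI' hq i.2)
    have hj := hc.trans (sum_sub_le hd hI' hq j.2)
    simp only [Matrix.submatrix_apply, Matrix.of_apply]
    rw [hw.coeff_blockPoly Y _ _ hi hj, hP _ _ _ hi hj]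
  · rfl

/-- The leading coefficient depends only on the linear form `x ↦ tr (Y x)` on the centraliser
of `e`. -/
theorem IsCyclicSystem.coeff_lineCharpoly_congr (hw : IsCyclicSystem e d w) (hd : Antitone d)
    {Y Y' : Module.End F V}
    (h : ∀ x ∈ glCentraliser e, LinearMap.trace F V (Y * x) = LinearMap.trace F V (Y' * x))
    {q l : ℕ} (hl : l ≤ Module.finrank F V) (hq : blockSum d q < l) :
    ((lineCharpoly e Y).coeff (Module.finrank F V - l)).coeff (q + 1) =
      ((lineCharpoly e Y').coeff (Module.finrank F V - l)).coeff (q + 1) := by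
  have h1 := hw.coeff_lineCharpoly_leading hd Y hl hq
    (blockPoly (LinearMap.toMatrix hw.basis hw.basis Y))
    fun i j c hi hj => hw.coeff_blockPoly Y i j hi hj
  have h2 := hw.coeff_lineCharpoly_leading hd Y' hl hq
    (blockPoly (LinearMap.toMatrix hw.basis hw.basis Y))
    fun i j c hi hj => (hw.coeff_blockPoly Y i j hi hj).trans (h _ (hw.xi_mem (by omega)))
  rw [h1, h2]

end Line

/-! ### Slices transverse to the orbit of `e` -/

section SlTwo

variable {F : Type*} [Field F] [CharZero F] {U : Type*} [AddCommGroup U] [Module F U]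
  [FiniteDimensional F U]

/-- For operators satisfying the relations of `𝔰𝔩₂`, an `H`-eigenvector `u` with `G E u = 0` behaves
like a primitive vector for `E`: its eigenvalue is a natural number. -/
theorem exists_nat_of_slTwo {E H G : Module.End F U} (hEG : E * G - G * E = H)
    (hHG : H * G - G * H = (-2 : F) • G) {u : U} (hu : u ≠ 0) (h0 : G (E u) = 0) {μ : F}
    (hμ : H u = μ • u) : ∃ n : ℕ, μ = n := by
  have hEG' : ∀ v, E (G v) = G (E v) + H v := fun v => by
    have := LinearMap.congr_fun hEG v
    simp only [LinearMap.sub_apply, Module.End.mul_apply] at this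
    rw [← this]; abel
  have hHG' : ∀ v, H (G v) = G (H v) + (-2 : F) • G v := fun v => by
    have := LinearMap.congr_fun hHG v
    simp only [LinearMap.sub_apply, Module.End.mul_apply, LinearMap.smul_apply] at this
    rw [← this]; abel
  have hH : ∀ j : ℕ, H ((G ^ j) u) = (μ - 2 * j) • (G ^ j) u := by
    intro j
    induction j with
    | zero => simpa using hμ
    | succ j ih =>
      rw [pow_succ', Module.End.mul_apply, hHG', ih, map_smul, ← add_smul]
      congr 1; push_cast; ring
  have hE : ∀ j : ℕ, E ((G ^ (j + 1)) u) = ((j + 1) * (μ - j)) • (G ^ j) u := by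
    intro j
    induction j with
    | zero => rw [zero_add, pow_one, hEG', h0, hμ]; simp
    | succ j ih =>
      rw [pow_succ', Module.End.mul_apply, hEG', ih, hH, map_smul, ← Module.End.mul_apply,
        ← pow_succ', ← add_smul]
      congr 1; push_cast; ring
  -- otherwise no `G ^ j u` is zero, and these are infinitely many independent eigenvectors
  by_contra hcon
  push Not at hcon
  have hne : ∀ j : ℕ, (G ^ j) u ≠ 0 := by
    intro j
    induction j with
    | zero => simpa using hu
    | succ j ih =>
      intro h
      have h1 := hE j
      rw [h, map_zero, eq_comm, smul_eq_zero_iff_left ih, mul_eq_zero, sub_eq_zero] at h1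
      exact h1.elim (Nat.cast_add_one_ne_zero j) (hcon j)
  have hinj : Function.Injective fun j : ℕ => μ - 2 * (j : F) := by
    intro i j hij
    simpa using hij
  have := Module.End.eigenvectors_linearIndependent' H _ hinj (fun j => (G ^ j) u)
    fun j => ⟨Module.End.mem_eigenspace_iff.2 (hH j), hne j⟩
  exact not_finite_iff_infinite.2 inferInstance this.finite

/-- In a finite-dimensional representation of `𝔰𝔩₂`, the kernel of the lowering operator `G` meets
the image of the raising operator `E` trivially. -/
theorem eq_zero_of_slTwo [IsAlgClosed F] {E H G : Module.End F U} (hEG : E * G - G * E = H)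
    (hHE : H * E - E * H = (2 : F) • E) (hHG : H * G - G * H = (-2 : F) • G) {u : U}
    (hu : G (E u) = 0) : E u = 0 := by
  by_contra hne
  have hHE' : ∀ v, H (E v) = E (H v) + (2 : F) • E v := fun v => by
    have := LinearMap.congr_fun hHE v
    simp only [LinearMap.sub_apply, Module.End.mul_apply, LinearMap.smul_apply] at this
    rw [← this]; abel
  have hHG' : ∀ v, G (H v) = H (G v) + (2 : F) • G v := fun v => by
    have := LinearMap.congr_fun hHG v
    simp only [LinearMap.sub_apply, Module.End.mul_apply, LinearMap.neg_apply,
      LinearMap.smul_apply, neg_smul] at this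
    rw [sub_eq_iff_eq_add] at this
    rw [this]; abel
  -- the intersection is stable under `H`, so it contains an eigenvector of `H`
  let K : Submodule F U := LinearMap.ker G ⊓ LinearMap.range E
  have hK : ∀ v ∈ K, H v ∈ K := by
    rintro v ⟨h1, v', rfl⟩
    refine ⟨?_, ⟨H v' + (2 : F) • v', ?_⟩⟩
    · change G (H _) = 0
      have h1' : G (E v') = 0 := h1
      rw [hHG', h1', map_zero, smul_zero, add_zero]
    · rw [map_add, map_smul, ← hHE']
  have : Nontrivial K := ⟨⟨⟨E u, hu, ⟨u, rfl⟩⟩, 0, fun h => hne (congrArg Subtype.val h)⟩⟩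
  obtain ⟨μ, hμ⟩ := Module.End.exists_eigenvalue (H.restrict hK)
  obtain ⟨⟨y, hy1, u', rfl⟩, hy⟩ := hμ.exists_hasEigenvector
  have hy0 : E u' ≠ 0 := fun h => hy.2 (Subtype.ext h)
  have hyH : H (E u') = μ • E u' := congrArg Subtype.val hy.apply_eq_smul
  have hyG : G (E u') = 0 := hy1
  obtain ⟨n, hn⟩ := exists_nat_of_slTwo (E := G) (H := -H) (G := E) (by rw [← hEG]; abel)
    (by rw [neg_smul, ← hHE]; noncomm_ring) hy0 (by rw [hyG, map_zero]) (μ := -μ)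
    (by rw [LinearMap.neg_apply, hyH, neg_smul])
  rw [neg_eq_iff_eq_neg] at hn
  subst hn
  -- correct `u'` by an element of the kernel of `E` to make it an eigenvector of `H`
  have hno : ∀ v, G (E v) = 0 → H v + ((n : F) + 2) • v = 0 → v = 0 := by
    intro v hv hv'
    by_contra hv0
    obtain ⟨m, hm⟩ := exists_nat_of_slTwo hEG hHG hv0 hv (μ := -((n : F) + 2))
      (by rw [neg_smul]; exact eq_neg_of_add_eq_zero_left hv')
    have : ((n + 2 + m : ℕ) : F) = 0 := by push_cast; rw [← hm]; ring
    rw [Nat.cast_eq_zero] at this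
    omega
  have hT : ∀ v ∈ LinearMap.ker E, (H + ((n : F) + 2) • (1 : Module.End F U)) v ∈
      LinearMap.ker E := by
    intro v hv
    rw [LinearMap.mem_ker] at hv ⊢
    have := hHE' v
    rw [hv, map_zero, smul_zero, add_zero] at this
    simp [← this, hv]
  have hinj : Function.Injective ((H + ((n : F) + 2) • (1 : Module.End F U)).restrict hT) := by
    rw [injective_iff_map_eq_zero]
    rintro ⟨v, hv⟩ h
    have h' := congrArg Subtype.val h
    rw [LinearMap.mem_ker] at hv
    exact Subtype.ext (hno v (by rw [hv, map_zero]) (by simpa using h'))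
  obtain ⟨⟨κ, hκ⟩, hκ'⟩ := LinearMap.injective_iff_surjective.1 hinj
    ⟨H u' + ((n : F) + 2) • u', by
      rw [LinearMap.mem_ker, map_add, map_smul]
      have := hHE' u'
      rw [hyH] at this
      rw [← sub_eq_iff_eq_add] at this
      rw [← this, ← sub_smul, ← add_smul]
      ring_nf
      simp⟩
  have hκ2 : H κ + ((n : F) + 2) • κ = H u' + ((n : F) + 2) • u' := by
    simpa using congrArg Subtype.val hκ'
  rw [LinearMap.mem_ker] at hκ
  have h3 := hno (u' - κ) (by rw [map_sub, hκ, sub_zero, hyG]) (by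
    rw [map_sub, smul_sub, sub_add_sub_comm, hκ2, sub_self])
  rw [sub_eq_zero] at h3
  exact hy0 (h3 ▸ hκ)

end SlTwo

section TraceForm

variable {F : Type*} [Field F]

theorem ext_form {V : Type*} [AddCommGroup V] [Module F V] {B : LinearMap.BilinForm F V}
    (hB : B.Nondegenerate) {x y : Module.End F V}
    (h : ∀ v w, B (x v) w = B (y v) w) : x = y := by
  ext v
  refine sub_eq_zero.1 (hB.1 _ fun w => ?_)
  rw [map_sub, LinearMap.sub_apply, h, sub_self]

variable {V : Type*} [AddCommGroup V] [Module F V] [FiniteDimensional F V]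

theorem eq_zero_of_trace_mul {x : Module.End F V}
    (h : ∀ u : Module.End F V, LinearMap.trace F V (x * u) = 0) : x = 0 := by
  ext v
  rw [LinearMap.zero_apply, ← Module.forall_dual_apply_eq_zero_iff F]
  intro φ
  have h1 := h (φ.smulRight v)
  rwa [show x * φ.smulRight v = φ.smulRight (x v) by ext u; simp, LinearMap.trace_smulRight] at h1

theorem exists_trace_mul (ψ : Module.Dual F (Module.End F V)) :
    ∃ x : Module.End F V, ∀ u, ψ u = LinearMap.trace F V (x * u) := by
  let Φ : Module.End F V →ₗ[F] Module.Dual F (Module.End F V) :=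
    (LinearMap.mul F (Module.End F V)).compr₂ (LinearMap.trace F V)
  have hinj : Function.Injective Φ := by
    rw [injective_iff_map_eq_zero]
    exact fun x hx => eq_zero_of_trace_mul fun u => LinearMap.congr_fun hx u
  obtain ⟨x, hx⟩ := (LinearMap.injective_iff_surjective_of_finrank_eq_finrank
    (Subspace.dual_finrank_eq (K := F)).symm).1 hinj ψ
  exact ⟨x, fun u => by rw [← hx]; rfl⟩

/-- The orthogonal of the centraliser of `e` for the trace form is the image of `ad e`. -/
theorem exists_commutator_eq {e y : Module.End F V}
    (h : ∀ x ∈ glCentraliser e, LinearMap.trace F V (y * x) = 0) :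
    ∃ u, e * u - u * e = y := by
  by_contra hcon
  let E : Module.End F (Module.End F V) := LinearMap.mulLeft F e - LinearMap.mulRight F e
  have hy : y ∉ LinearMap.range E := fun ⟨u, hu⟩ => hcon ⟨u, by simpa [E] using hu⟩
  -- otherwise some `x` is orthogonal to the image of `ad e`, hence centralises `e`, but not to `y`
  obtain ⟨ψ, hψ1, hψ2⟩ := Submodule.exists_le_ker_of_notMem hy
  obtain ⟨x, hx⟩ := exists_trace_mul ψ
  refine hψ1 ?_
  rw [hx, LinearMap.trace_mul_comm]
  refine h x ?_
  rw [mem_glCentraliser]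
  refine (sub_eq_zero.1 (eq_zero_of_trace_mul fun u => ?_)).symm
  have h1 : ψ (e * u - u * e) = 0 := hψ2 ⟨u, by simp [E]⟩
  rw [hx, mul_sub, map_sub] at h1
  rw [sub_mul, map_sub, mul_assoc, mul_assoc, LinearMap.trace_mul_comm F e (x * u), mul_assoc]
  exact h1

variable {B : LinearMap.BilinForm F V}

/-- The adjoint of an endomorphism with respect to a non-degenerate bilinear form. -/
noncomputable def adj (hB : B.Nondegenerate) (x : Module.End F V) : Module.End F V :=
  (B.toDual hB).symm.conj (Module.Dual.transpose x)

theorem adj_apply (hB : B.Nondegenerate) (x : Module.End F V) (v w : V) :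
    B (adj hB x v) w = B v (x w) := by
  rw [adj, LinearEquiv.conj_apply_apply, LinearMap.BilinForm.apply_toDual_symm_apply]
  rfl

theorem trace_adj (hB : B.Nondegenerate) (x : Module.End F V) :
    LinearMap.trace F V (adj hB x) = LinearMap.trace F V x := by
  rw [adj, LinearMap.trace_conj', LinearMap.trace_transpose']

theorem adj_mul (hB : B.Nondegenerate) (x y : Module.End F V) :
    adj hB (x * y) = adj hB y * adj hB x :=
  ext_form hB fun v w => by
    rw [adj_apply, Module.End.mul_apply, Module.End.mul_apply, adj_apply, adj_apply]

theorem adj_eq_neg (hB : B.Nondegenerate) {x : Module.End F V}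
    (hx : ∀ v w, B (x v) w = -B v (x w)) : adj hB x = -x :=
  ext_form hB fun v w => by
    rw [adj_apply, LinearMap.neg_apply, map_neg, LinearMap.neg_apply, hx, neg_neg]

/-- A linear form on the centraliser of `e` in `𝔤𝔩(V)` that vanishes on `𝔤_e` and on the
self-adjoint elements is zero. -/
theorem eq_on_glCentraliser [CharZero F] (hB : B.Nondegenerate) {τ : F}
    (hBτ : ∀ v w, B v w = τ * B w v) {e : Module.End F V} (he : ∀ v w, B (e v) w = -B v (e w))
    {φ ψ : Module.End F V →ₗ[F] F}
    (h1 : ∀ x ∈ centraliser B e, φ x = ψ x)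
    (h2 : ∀ x ∈ glCentraliser e, (∀ v w, B (x v) w = B v (x w)) → φ x = ψ x) :
    ∀ x ∈ glCentraliser e, φ x = ψ x := by
  intro x hx
  have hadj : ∀ v w, B (x v) w = B v (adj hB x w) := by
    intro v w
    rw [hBτ v, adj_apply, ← hBτ]
  have hmem : adj hB x ∈ glCentraliser e := by
    rw [mem_glCentraliser] at hx ⊢
    have := congrArg (adj hB) hx
    rw [adj_mul, adj_mul, adj_eq_neg hB he] at this
    simpa [eq_comm] using this
  have e1 := h1 (x - adj hB x) (mem_centraliser.2 ⟨fun v w => by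
      simp only [LinearMap.sub_apply, map_sub]
      rw [adj_apply, hadj]; ring, mem_glCentraliser.1 (Submodule.sub_mem _ hx hmem)⟩)
  have e2 := h2 (x + adj hB x) (Submodule.add_mem _ hx hmem) fun v w => by
      simp only [LinearMap.add_apply, map_add]
      rw [adj_apply, hadj]; ring
  rw [map_sub, map_sub] at e1
  rw [map_add, map_add] at e2
  have h3 : (2 : F) * φ x = 2 * ψ x := by linear_combination e1 + e2
  exact mul_left_cancel₀ two_ne_zero h3

/-- Skew-adjoint and self-adjoint endomorphisms are orthogonal for the trace form. -/
theorem trace_mul_selfAdjoint [CharZero F] (hB : B.Nondegenerate) {x y : Module.End F V}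
    (hy : ∀ v w, B (y v) w = -B v (y w)) (hx : ∀ v w, B (x v) w = B v (x w)) :
    LinearMap.trace F V (y * x) = 0 := by
  have h1 : adj hB x = x := ext_form hB fun v w => by rw [adj_apply, hx]
  have h2 := trace_adj hB (y * x)
  rw [adj_mul, h1, adj_eq_neg hB hy, mul_neg, map_neg, LinearMap.trace_mul_comm] at h2
  exact self_eq_neg.1 h2.symm

end TraceForm

section Slice

variable {F : Type*} [Field F] {V : Type*} [AddCommGroup V] [Module F V]
  {B : LinearMap.BilinForm F V}

theorem mem_skew_iff {x : Module.End F V} :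
    x ∈ skewAdjointLieSubalgebra B ↔ ∀ v w, B (x v) w = -B v (x w) := by
  change x ∈ B.skewAdjointSubmodule ↔ _
  rw [LinearMap.mem_skewAdjointSubmodule]
  simp [LinearMap.IsSkewAdjoint, LinearMap.IsAdjointPair]

/-- The operator `ad a` on `𝔤𝔩(V)`. -/
def adOp (a : Module.End F V) : Module.End F (Module.End F V) :=
  LinearMap.mulLeft F a - LinearMap.mulRight F a

theorem adOp_apply (a x : Module.End F V) : adOp a x = a * x - x * a := rfl

theorem adOp_commutator (a b : Module.End F V) :
    adOp a * adOp b - adOp b * adOp a = adOp (a * b - b * a) :=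
  LinearMap.ext fun x => by
    simp only [LinearMap.sub_apply, Module.End.mul_apply, adOp_apply]
    noncomm_ring

theorem adOp_smul (c : F) (a : Module.End F V) : adOp (c • a) = c • adOp a :=
  LinearMap.ext fun x => by
    rw [LinearMap.smul_apply, adOp_apply, adOp_apply, smul_mul_assoc, mul_smul_comm, smul_sub]

theorem slicePairing_apply (e f : Module.End F V) (y : centraliser B f) (x : centraliser B e) :
    slicePairing B e f y x = LinearMap.trace F V (y.1 * x.1) := rfl

theorem sliceMap_eq {e f : Module.End F V} (hb : Function.Bijective (slicePairing B e f))
    (γ : Module.Dual F (centraliser B e)) :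
    ∃ y : centraliser B f, sliceMap B e f γ = y.1 ∧ slicePairing B e f y = γ :=
  ⟨(LinearEquiv.ofBijective _ hb).symm γ, by rw [sliceMap, dif_pos hb]; rfl,
    (LinearEquiv.ofBijective _ hb).apply_symm_apply γ⟩

theorem trace_sliceMap_mul {e f : Module.End F V}
    (hb : Function.Bijective (slicePairing B e f))
    (γ : Module.Dual F (centraliser B e)) (x : centraliser B e) :
    LinearMap.trace F V (sliceMap B e f γ * x.1) = γ x := by
  obtain ⟨y, h1, h2⟩ := sliceMap_eq hb γ
  rw [h1, ← slicePairing_apply, h2]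

theorem sliceMap_skew {e f : Module.End F V} (hb : Function.Bijective (slicePairing B e f))
    (γ : Module.Dual F (centraliser B e)) (v w : V) :
    B (sliceMap B e f γ v) w = -B v (sliceMap B e f γ w) := by
  obtain ⟨y, h1, -⟩ := sliceMap_eq hb γ
  rw [h1]
  exact (mem_centraliser.1 y.2).1 v w

variable [FiniteDimensional F V] [CharZero F]

/-- If skew-adjoint `y` and `y'` define the same trace form on `𝔤_e`, then they also do
on `𝔤𝔩(V)_e`. -/
theorem trace_eq_on_glCentraliser (hB : B.Nondegenerate) {τ : F}
    (hBτ : ∀ v w, B v w = τ * B w v) {e : Module.End F V} (he : ∀ v w, B (e v) w = -B v (e w))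
    {y y' : Module.End F V} (hy : ∀ v w, B (y v) w = -B v (y w))
    (hy' : ∀ v w, B (y' v) w = -B v (y' w))
    (h : ∀ x ∈ centraliser B e, LinearMap.trace F V (y * x) = LinearMap.trace F V (y' * x)) :
    ∀ x ∈ glCentraliser e, LinearMap.trace F V (y * x) = LinearMap.trace F V (y' * x) :=
  eq_on_glCentraliser hB hBτ he (φ := LinearMap.trace F V ∘ₗ LinearMap.mulLeft F y)
    (ψ := LinearMap.trace F V ∘ₗ LinearMap.mulLeft F y') h fun x _ hx => by
      simp only [LinearMap.comp_apply, LinearMap.mulLeft_apply]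
      rw [trace_mul_selfAdjoint hB hy hx, trace_mul_selfAdjoint hB hy' hx]

variable [IsAlgClosed F]

/-- An element of `𝔤_f` orthogonal to `𝔤_e` lies in the image of `ad e` as well as in the kernel of
`ad f`, so it is zero. -/
theorem slicePairing_injective (hB : B.Nondegenerate) {τ : F}
    (hBτ : ∀ v w, B v w = τ * B w v) {e h f : Module.End F V}
    (he : ∀ v w, B (e v) w = -B v (e w))
    (hhe : h * e - e * h = (2 : F) • e) (hhf : h * f - f * h = (-2 : F) • f)
    (hef : e * f - f * e = h) : Function.Injective (slicePairing B e f) := by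
  rw [injective_iff_map_eq_zero]
  rintro ⟨y, hy⟩ hy0
  obtain ⟨hy1, hy2⟩ := mem_centraliser.1 hy
  obtain ⟨u, hu⟩ := exists_commutator_eq (e := e) (y := y) (by
    have := trace_eq_on_glCentraliser (y' := 0) hB hBτ he hy1 (by simp) fun x hx => by
      have := LinearMap.congr_fun hy0 ⟨x, hx⟩
      rw [slicePairing_apply] at this
      rw [this]; simp
    simpa using this)
  refine Subtype.ext ?_
  change y = 0
  have h1 := eq_zero_of_slTwo (E := adOp e) (H := adOp h) (G := adOp f) (u := u)
    (by rw [adOp_commutator, hef]) (by rw [adOp_commutator, hhe, adOp_smul])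
    (by rw [adOp_commutator, hhf, adOp_smul]) (by
      rw [adOp_apply e, hu, adOp_apply, hy2, sub_self])
  rw [← hu, ← adOp_apply, h1]

theorem slicePairing_bijective (hB : B.Nondegenerate) {τ : F}
    (hBτ : ∀ v w, B v w = τ * B w v) {e h f : Module.End F V}
    (he : e ∈ skewAdjointLieSubalgebra B) (ht : IsTriple B e h f) :
    Function.Bijective (slicePairing B e f) := by
  obtain ⟨-, hf, h1, h2, h3⟩ := ht
  rw [mem_skew_iff] at he hf
  have i1 := slicePairing_injective hB hBτ he h1 h2 h3
  -- the triple `(f, -h, e)` gives the opposite inequality of dimensions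
  have i2 := slicePairing_injective hB hBτ (e := f) (h := -h) (f := e) hf
    (by rw [neg_mul, mul_neg, sub_neg_eq_add, neg_add_eq_sub, ← neg_sub, h2, neg_smul, neg_neg])
    (by rw [neg_mul, mul_neg, sub_neg_eq_add, neg_add_eq_sub, ← neg_sub, h1, neg_smul])
    (by rw [← h3, neg_sub])
  refine ⟨i1, (LinearMap.injective_iff_surjective_of_finrank_eq_finrank ?_).1 i1⟩
  have j1 := LinearMap.finrank_le_finrank_of_injective i1
  have j2 := LinearMap.finrank_le_finrank_of_injective i2
  rw [Subspace.dual_finrank_eq] at j1 j2 ⊢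
  exact le_antisymm j1 j2

end Slice

/-! ### Polynomial functions on a dual space along lines through the origin -/

section Dictionary

variable {F : Type*} [Field F] {M : Type*} [AddCommGroup M] [Module F M]

@[simp] theorem evalAt_ι (γ : Module.Dual F M) (m : M) :
    evalAt γ (SymmetricAlgebra.ι F M m) = γ m :=
  SymmetricAlgebra.lift_ι_apply ..

/-- The polynomial `s ↦ P(sγ)`. -/
noncomputable def lineHom (γ : Module.Dual F M) : SymmetricAlgebra F M →ₐ[F] F[X] :=
  SymmetricAlgebra.lift ((LinearMap.toSpanSingleton F F[X] X) ∘ₗ γ)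

@[simp] theorem lineHom_ι (γ : Module.Dual F M) (m : M) :
    lineHom γ (SymmetricAlgebra.ι F M m) = C (γ m) * X := by
  rw [lineHom, SymmetricAlgebra.lift_ι_apply, LinearMap.comp_apply,
    LinearMap.toSpanSingleton_apply, smul_eq_C_mul]

theorem map_evalAt_gradeHom (γ : Module.Dual F M) (P : SymmetricAlgebra F M) :
    (gradeHom P).map (evalAt γ : SymmetricAlgebra F M →+* F) = lineHom γ P := by
  have : (mapAlgHom (evalAt γ)).comp gradeHom = lineHom γ := by
    refine SymmetricAlgebra.algHom_ext (LinearMap.ext fun m => ?_)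
    simp [gradeHom, C_mul_X_eq_monomial]
  exact DFunLike.congr_fun this P

theorem evalAt_coeff_gradeHom (γ : Module.Dual F M) (P : SymmetricAlgebra F M) (m : ℕ) :
    evalAt γ ((gradeHom P).coeff m) = (lineHom γ P).coeff m := by
  rw [← map_evalAt_gradeHom, coeff_map]; rfl

theorem eval_lineHom (γ : Module.Dual F M) (s : F) (P : SymmetricAlgebra F M) :
    (lineHom γ P).eval s = evalAt (s • γ) P := by
  have : (aeval s).comp (lineHom γ) = evalAt (s • γ) := by
    refine SymmetricAlgebra.algHom_ext (LinearMap.ext fun m => ?_)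
    change aeval s (lineHom γ (SymmetricAlgebra.ι F M m)) =
      evalAt (s • γ) (SymmetricAlgebra.ι F M m)
    rw [lineHom_ι, evalAt_ι, map_mul, aeval_C, aeval_X, LinearMap.smul_apply, smul_eq_mul,
      mul_comm]
    rfl
  simpa [coe_aeval_eq_eval] using DFunLike.congr_fun this P

theorem lineHom_smul (γ : Module.Dual F M) (s : F) (P : SymmetricAlgebra F M) :
    lineHom (s • γ) P = (lineHom γ P).comp (C s * X) := by
  have : (aeval (C s * X : F[X])).comp (lineHom γ) = lineHom (s • γ) := by
    refine SymmetricAlgebra.algHom_ext (LinearMap.ext fun m => ?_)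
    change aeval (C s * X : F[X]) (lineHom γ (SymmetricAlgebra.ι F M m)) =
      lineHom (s • γ) (SymmetricAlgebra.ι F M m)
    rw [lineHom_ι, lineHom_ι, map_mul, aeval_C, aeval_X, LinearMap.smul_apply, smul_eq_mul, C_mul,
      algebraMap_eq]
    ring
  rw [← this]; rfl

/-- The homogeneous components of `P` are homogeneous functions. -/
theorem evalAt_smul_coeff_gradeHom (γ : Module.Dual F M) (s : F) (P : SymmetricAlgebra F M)
    (m : ℕ) : evalAt (s • γ) ((gradeHom P).coeff m) = s ^ m * evalAt γ ((gradeHom P).coeff m) := by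
  rw [evalAt_coeff_gradeHom, evalAt_coeff_gradeHom, lineHom_smul, comp_C_mul_X_coeff, mul_comm]

/-- Over an infinite field a polynomial is determined by its values. -/
theorem eq_of_evalAt_eq [Infinite F] [FiniteDimensional F M] {P Q : SymmetricAlgebra F M}
    (h : ∀ γ : Module.Dual F M, evalAt γ P = evalAt γ Q) : P = Q := by
  let b := Module.finBasis F M
  let φ := SymmetricAlgebra.equivMvPolynomial b
  refine φ.injective (MvPolynomial.funext fun x => ?_)
  have key : ∀ R, MvPolynomial.eval x (φ R) = evalAt (b.constr F x) R := by
    have : (MvPolynomial.aeval x).comp (φ : SymmetricAlgebra F M →ₐ[F] _) =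
        evalAt (b.constr F x) := by
      refine SymmetricAlgebra.algHom_ext (b.ext fun i => ?_)
      simp [φ]
    exact fun R => by simpa [MvPolynomial.coe_aeval_eq_eval] using DFunLike.congr_fun this R
  rw [key, key, h]

/-- The component of minimal degree is recognised by the values of the components. -/
theorem minComponent_eq_coeff {P : SymmetricAlgebra F M} [Infinite F] [FiniteDimensional F M]
    {q : ℕ} (h0 : ∀ γ : Module.Dual F M, ∀ a < q, (lineHom γ P).coeff a = 0)
    (h1 : ∃ γ : Module.Dual F M, (lineHom γ P).coeff q ≠ 0) :
    minComponent P = (gradeHom P).coeff q := by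
  have h2 : (gradeHom P).natTrailingDegree = q := by
    refine le_antisymm (natTrailingDegree_le_of_ne_zero fun h => ?_)
      (le_natTrailingDegree (fun h => ?_) fun a ha => eq_of_evalAt_eq fun γ => ?_)
    · obtain ⟨γ, hγ⟩ := h1
      rw [← evalAt_coeff_gradeHom, h, map_zero] at hγ
      exact hγ rfl
    · obtain ⟨γ, hγ⟩ := h1
      rw [← evalAt_coeff_gradeHom, h, coeff_zero, map_zero] at hγ
      exact hγ rfl
    · rw [evalAt_coeff_gradeHom, h0 γ a ha, map_zero]
  rw [minComponent, trailingCoeff, h2]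

end Dictionary

section GenericPoint

variable {F : Type*} [Field F] {V : Type*} [AddCommGroup V] [Module F V] [FiniteDimensional F V]

theorem charpoly_baseChange_add_sum {n m : Type*} [Fintype n] [DecidableEq n] [Fintype m]
    {S : Type*} [CommRing S] [Algebra F S] (v : Module.Basis n F V) (e : Module.End F V)
    (c : m → S) (y : m → Module.End F V) :
    (e.baseChange S + ∑ j, c j • (y j).baseChange S).charpoly =
      ((LinearMap.toMatrix v v e).map (algebraMap F S) +
        ∑ j, c j • (LinearMap.toMatrix v v (y j)).map (algebraMap F S)).charpoly := by
  rw [← LinearMap.charpoly_toMatrix _ (Algebra.TensorProduct.basis S v), map_add, map_sum]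
  simp only [map_smul, LinearMap.toMatrix_baseChange]

/-- On the line `s ↦ s γ` the restriction of `Δ_l` to the slice is the coefficient of `t ^ (n - l)`
in the characteristic polynomial of `e + s y`, where `y` represents `γ`. -/
theorem lineHom_sliceRestriction (B : LinearMap.BilinForm F V) (e f : Module.End F V)
    (γ : Module.Dual F (centraliser B e)) (l : ℕ) :
    lineHom γ (sliceRestriction B e f l) =
      (lineCharpoly e (sliceMap B e f γ)).coeff (Module.finrank F V - l) := by
  classical
  set S := SymmetricAlgebra F (centraliser B e)
  let v := Module.finBasis F V
  let u := Module.finBasis F (centraliser B e)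
  have h1 : (genericPoint B e f).charpoly =
      ((LinearMap.toMatrix v v e).map (algebraMap F S) +
        ∑ j, SymmetricAlgebra.ι F (centraliser B e) (u j) •
          (LinearMap.toMatrix v v (sliceMap B e f (u.coord j))).map (algebraMap F S)).charpoly := by
    exact charpoly_baseChange_add_sum v e _ _
  have hγ : sliceMap B e f γ = ∑ j, γ (u j) • sliceMap B e f (u.coord j) := by
    conv_lhs => rw [← Module.Basis.sum_dual_apply_smul_coord u γ, map_sum]
    simp only [map_smul]
  rw [sliceRestriction, h1, lineCharpoly_eq v]
  change (lineHom γ : S →+* F[X]) (Polynomial.coeff _ _) = _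
  rw [← coeff_map, ← Matrix.charpoly_map]
  congr 2
  ext1 a b
  simp only [Matrix.map_apply, Matrix.add_apply, Matrix.sum_apply, Matrix.smul_apply, map_add,
    map_sum, smul_eq_mul, map_mul, RingHom.coe_coe, AlgHom.commutes, hγ]
  simp only [algebraMap_eq, map_smul, Matrix.smul_apply, smul_eq_mul, map_mul, Finset.mul_sum]
  congr 1
  refine Finset.sum_congr rfl fun j _ => ?_
  refine (congrArg (· * C _) (lineHom_ι γ (u j))).trans ?_
  ring

end GenericPoint

/-! ### Linear forms on the centraliser given by matrices of polynomials -/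

section Forms

variable {F : Type*} [Field F] {V : Type*} [AddCommGroup V] [Module F V]
  {B : LinearMap.BilinForm F V} {e : Module.End F V} {k : ℕ} {d : Fin k → ℕ} {w : Fin k → V}

theorem form_pow_left (he : ∀ v w, B (e v) w = -B v (e w)) (a : ℕ) (v w : V) :
    B ((e ^ a) v) w = (-1) ^ a * B v ((e ^ a) w) := by
  induction a generalizing v with
  | zero => simp
  | succ a ih =>
    rw [pow_succ, Module.End.mul_apply, ih, he, ← Module.End.mul_apply, ← pow_succ', pow_succ]
    ring

theorem form_aeval_left (he : ∀ v w, B (e v) w = -B v (e w)) (P : F[X]) (v w : V) :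
    B (aeval e P v) w = B v (aeval e (P.comp (-X)) w) := by
  induction P using Polynomial.induction_on' with
  | add P Q hP hQ => simp [hP, hQ]
  | monomial a c =>
    have h1 : (monomial a c).comp (-X) = C (c * (-1) ^ a) * X ^ a := by
      rw [monomial_comp, neg_pow]
      simp [mul_assoc]
    rw [h1, C_mul_X_pow_eq_monomial, aeval_monomial, aeval_monomial, Module.End.mul_apply,
      Module.End.mul_apply, Module.algebraMap_end_apply, Module.algebraMap_end_apply, map_smul,
      map_smul, LinearMap.smul_apply, form_pow_left he, smul_eq_mul, smul_eq_mul, mul_assoc]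

theorem IsAdapted.form_pow (hw : IsAdapted B e d w) (he : ∀ v w, B (e v) w = -B v (e w))
    (i j : Fin k) (a b : ℕ) :
    B ((e ^ a) (w i)) ((e ^ b) (w j)) = if i = j ∧ a + b = d i then (-1) ^ a else 0 := by
  by_cases hij : i = j
  · subst hij
    rw [form_pow_left he, ← Module.End.mul_apply, ← pow_add]
    rcases lt_trichotomy (a + b) (d i) with h | h | h
    · rw [hw.2.2.1 i _ h, if_neg (by omega), mul_zero]
    · rw [h, hw.2.2.2, if_pos ⟨rfl, rfl⟩, mul_one]
    · rw [hw.1.pow_eq_zero h, map_zero, if_neg (by omega), mul_zero]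
  · rw [hw.2.1 i j hij, if_neg fun h => hij h.1]

/-- The linear form `y ↦ ∑ (P_ij(e) y w_i, w_j)` on `𝔤𝔩(V)`. -/
noncomputable def formOf (B : LinearMap.BilinForm F V) (e : Module.End F V) (w : Fin k → V)
    (P : Fin k → Fin k → F[X]) : Module.End F V →ₗ[F] F :=
  ∑ i, ∑ j, (B.flip (w j)) ∘ₗ (aeval e (P i j)) ∘ₗ (LinearMap.applyₗ (w i))

theorem formOf_apply (P : Fin k → Fin k → F[X]) (y : Module.End F V) :
    formOf B e w P y = ∑ i, ∑ j, B (aeval e (P i j) (y (w i))) (w j) := by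
  simp [formOf]

theorem formOf_add (P Q : Fin k → Fin k → F[X]) :
    formOf B e w (P + Q) = formOf B e w P + formOf B e w Q := by
  ext y
  simp [formOf_apply, Finset.sum_add_distrib]

theorem formOf_smul (c : F) (P : Fin k → Fin k → F[X]) :
    formOf B e w (c • P) = c • formOf B e w P := by
  ext y
  simp [formOf_apply, Finset.mul_sum]

theorem aeval_comm_of_mem {x : Module.End F V} (hx : x ∈ glCentraliser e) (P : F[X]) (v : V) :
    x (aeval e P v) = aeval e P (x v) := by
  have h : Commute e x := mem_glCentraliser.1 hx
  have h1 : Commute (aeval e P) x := by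
    induction P using Polynomial.induction_on' with
    | add P Q hP hQ => rw [map_add]; exact hP.add_left hQ
    | monomial a c =>
      rw [aeval_monomial]
      exact (Algebra.commute_algebraMap_left c x).mul_left (h.pow_left a)
  exact (LinearMap.congr_fun h1.eq v).symm

/-- If `P_ji(t) = -τ P_ij(-t)` then the form attached to `P` kills self-adjoint elements. -/
theorem formOf_selfAdjoint [CharZero F] {τ : F} (hBτ : ∀ v w, B v w = τ * B w v)
    (he : ∀ v w, B (e v) w = -B v (e w)) {P : Fin k → Fin k → F[X]}
    (hP : ∀ i j, τ • (P j i).comp (-X) = - P i j) {x : Module.End F V}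
    (hx : x ∈ glCentraliser e) (hsa : ∀ v w, B (x v) w = B v (x w)) :
    formOf B e w P x = 0 := by
  refine self_eq_neg.1 ?_
  rw [formOf_apply]
  conv_lhs => rw [Finset.sum_comm]
  rw [← Finset.sum_neg_distrib]
  refine Finset.sum_congr rfl fun j _ => ?_
  rw [← Finset.sum_neg_distrib]
  refine Finset.sum_congr rfl fun i _ => ?_
  have h1 := congrArg (fun p => B (aeval e p (x (w j))) (w i)) (hP j i)
  simp only [map_neg, map_smul, LinearMap.neg_apply, LinearMap.smul_apply, smul_eq_mul] at h1
  rw [← aeval_comm_of_mem hx, hsa, form_aeval_left he, hBτ, h1]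

theorem IsAdapted.form_aeval (hw : IsAdapted B e d w) (he : ∀ v w, B (e v) w = -B v (e w))
    (P : F[X]) (i j : Fin k) (s : ℕ) :
    B (aeval e P ((e ^ s) (w i))) (w j) =
      if i = j ∧ s ≤ d i then (-1) ^ (d i) * P.coeff (d i - s) else 0 := by
  have h := fun t => hw.form_pow he i j (t + s) 0
  simp only [pow_zero, Module.End.one_apply, add_zero] at h
  rw [aeval_eq_sum_range]
  simp only [LinearMap.sum_apply, map_sum, LinearMap.smul_apply, map_smul, smul_eq_mul,
    ← Module.End.mul_apply, ← pow_add]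
  simp only [h]
  split_ifs with hc
  · obtain ⟨rfl, hs⟩ := hc
    by_cases hdeg : d i - s ≤ P.natDegree
    · rw [Finset.sum_eq_single_of_mem (d i - s) (Finset.mem_range.2 (by omega))
        fun t _ ht => by rw [if_neg (by omega), mul_zero], if_pos ⟨rfl, by omega⟩,
        Nat.sub_add_cancel hs, mul_comm]
    · rw [coeff_eq_zero_of_natDegree_lt (not_le.1 hdeg), mul_zero]
      refine Finset.sum_eq_zero fun t ht => ?_
      rw [Finset.mem_range] at ht
      rw [if_neg (by omega), mul_zero]
  · refine Finset.sum_eq_zero fun t ht => ?_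
    rw [if_neg (by rintro ⟨rfl, h⟩; exact hc ⟨rfl, by omega⟩), mul_zero]

/-- The coefficients of the polynomials `P_ij` are, up to sign, the values of `formOf P` at the
`ξ_i^{j,s}`. -/
theorem IsAdapted.formOf_xi (hw : IsAdapted B e d w) (he : ∀ v w, B (e v) w = -B v (e w))
    (P : Fin k → Fin k → F[X]) {i j : Fin k} {s : ℕ} {x : Module.End F V}
    (h1 : x (w i) = (e ^ s) (w j)) (h2 : ∀ t, t ≠ i → x (w t) = 0) :
    formOf B e w P x = if s ≤ d j then (-1) ^ (d j) * (P i j).coeff (d j - s) else 0 := by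
  rw [formOf_apply, Finset.sum_eq_single i, Finset.sum_eq_single j]
  · rw [h1, hw.form_aeval he]; simp
  · intro t _ ht
    rw [h1, hw.form_aeval he, if_neg fun h => ht h.1.symm]
  · simp
  · intro t _ ht
    rw [h2 t ht]; simp
  · simp

/-- The element of `𝔤_e*` given by a matrix of polynomials. -/
noncomputable def dualOf (B : LinearMap.BilinForm F V) (e : Module.End F V) (w : Fin k → V)
    (P : Fin k → Fin k → F[X]) : Module.Dual F (centraliser B e) :=
  (formOf B e w P).domRestrict _

/-- A matrix of polynomials with the symmetry of `formOf_selfAdjoint` that is concentrated on the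
antidiagonal `i + j = m` defines an element of `V_{𝔤,m}*`. -/
theorem IsAdapted.dualOf_mem_antidiagDualLie [CharZero F] (hw : IsAdapted B e d w)
    {τ : F} (hBτ : ∀ v w, B v w = τ * B w v)
    (he : ∀ v w, B (e v) w = -B v (e w)) {P : Fin k → Fin k → F[X]}
    (hP : ∀ i j, τ • (P j i).comp (-X) = - P i j) (m : Fin k)
    (hm : ∀ i j : Fin k, (i : ℕ) + j ≠ m → P i j = 0) :
    dualOf B e w P ∈ antidiagDualLie B e w m := by
  refine ⟨(formOf B e w P).domRestrict _, ⟨?_, ?_⟩, rfl⟩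
  · rw [SetLike.mem_coe, antidiagDual, Submodule.mem_dualAnnihilator]
    intro x hx
    refine Submodule.span_induction (p := fun x _ => (formOf B e w P).domRestrict _ x = 0)
      ?_ (map_zero _) (fun x y _ _ hx hy => by rw [map_add, hx, hy, add_zero])
      (fun c x _ hx => by rw [map_smul, hx, smul_zero]) hx
    rintro x ⟨i, j, s, hij, h1, h2⟩
    rw [LinearMap.domRestrict_apply, hw.formOf_xi he P h1 h2, hm i j hij]
    simp
  · rw [SetLike.mem_coe, Submodule.mem_dualAnnihilator]
    intro x hx
    refine formOf_selfAdjoint hBτ he hP x.2 fun v w => ?_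
    have hx' : x.1 ∈ B.selfAdjointSubmodule := hx
    rw [LinearMap.mem_selfAdjointSubmodule] at hx'
    simpa [LinearMap.IsAdjointPair] using hx' v w

/-- The point of the slice over the form given by a matrix of polynomials has the coefficients of
these polynomials as its values at the `ξ_i^{j,s}`. -/
theorem IsAdapted.trace_sliceMap_dualOf [CharZero F] [FiniteDimensional F V]
    (hw : IsAdapted B e d w) (hB : B.Nondegenerate)
    {τ : F} (hBτ : ∀ v w, B v w = τ * B w v)
    (he : ∀ v w, B (e v) w = -B v (e w)) {f : Module.End F V}
    (hb : Function.Bijective (slicePairing B e f)) {P : Fin k → Fin k → F[X]}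
    (hP : ∀ i j, τ • (P j i).comp (-X) = - P i j) (i j : Fin k) {c : ℕ} (hi : c ≤ d i)
    (hj : c ≤ d j) :
    LinearMap.trace F V (sliceMap B e f (dualOf B e w P) * hw.1.xi i j (d j - c)) =
      (-1) ^ (d j) * (P i j).coeff c := by
  have hs : d j ≤ d j - c + d i := by omega
  have h1 := eq_on_glCentraliser hB hBτ he
    (φ := LinearMap.trace F V ∘ₗ LinearMap.mulLeft F (sliceMap B e f (dualOf B e w P)))
    (ψ := formOf B e w P) (fun x hx => trace_sliceMap_mul hb (dualOf B e w P) ⟨x, hx⟩)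
    (fun x hx hsa => by
      rw [formOf_selfAdjoint hBτ he hP hx hsa]
      exact trace_mul_selfAdjoint hB (sliceMap_skew hb _) hsa) _ (hw.1.xi_mem hs)
  refine h1.trans ?_
  rw [hw.formOf_xi he P (i := i) (j := j) (s := d j - c) (by simpa using hw.1.xi_pow_same hs 0)
    fun t ht => by simpa using hw.1.xi_pow_of_ne hs 0 ht, if_pos (Nat.sub_le _ _),
    Nat.sub_sub_self hj]

end Forms

/-! ### Anti-triangular determinants -/

section Antidiagonal

variable {R : Type*} [CommRing R] {k : ℕ}

/-- Reflection of `{0, …, m}`. -/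
def reflect (m : Fin k) (i : Fin k) : Fin k := ⟨m - i, (Nat.sub_le _ _).trans_lt m.2⟩

/-- If `M i j = 0` for `i + j > m`, the only principal minor of size `m + 1` that can be nonzero is
the leading one. -/
theorem det_submatrix_eq_zero (M : Matrix (Fin k) (Fin k) R) (m : Fin k)
    (hM : ∀ i j : Fin k, (m : ℕ) < i + j → M i j = 0) {I : Finset (Fin k)}
    (hI : I.card = m + 1) (hne : I ≠ Finset.Iic m) :
    (M.submatrix (Subtype.val : I → Fin k) (Subtype.val : I → Fin k)).det = 0 := by
  rw [Matrix.det_apply]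
  refine Finset.sum_eq_zero fun σ _ => ?_
  by_cases h : ∃ i : I, M (σ i).1 i.1 = 0
  · obtain ⟨i, hi⟩ := h
    rw [Finset.prod_eq_zero (Finset.mem_univ i) hi, smul_zero]
  · push Not at h
    refine absurd (Finset.eq_of_subset_of_card_le (fun i hi => ?_) (by simp [hI])) hne
    have := mt (hM (σ ⟨i, hi⟩).1 i) (h ⟨i, hi⟩)
    rw [Finset.mem_Iic, Fin.le_def]
    omega

/-- Only the permutation `i ↦ m - i` contributes to the determinant of an anti-triangular matrix. -/
theorem det_submatrix_Iic (M : Matrix (Fin k) (Fin k) R) (m : Fin k)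
    (hM : ∀ i j : Fin k, (m : ℕ) < i + j → M i j = 0) :
    ∃ u : ℤˣ, (M.submatrix (Subtype.val : Finset.Iic m → Fin k)
      (Subtype.val : Finset.Iic m → Fin k)).det = u • ∏ i ∈ Finset.Iic m, M (reflect m i) i := by
  have hmem : ∀ i : Finset.Iic m, (i : ℕ) ≤ m := fun i => by
    have := i.2
    rwa [Finset.mem_Iic, Fin.le_def] at this
  let ρ : Finset.Iic m → Finset.Iic m := fun i => ⟨reflect m i, by
    rw [Finset.mem_Iic, Fin.le_def]; exact Nat.sub_le _ _⟩
  have hρ : Function.Involutive ρ := fun i => by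
    have := hmem i
    apply Subtype.ext
    apply Fin.ext
    change (m : ℕ) - (m - i) = i
    omega
  refine ⟨Equiv.Perm.sign hρ.toPerm, ?_⟩
  rw [Matrix.det_apply, Finset.sum_eq_single hρ.toPerm]
  · congr 1
    exact Finset.prod_coe_sort (Finset.Iic m) fun i => M (reflect m i) i
  · intro σ _ hσ
    by_cases h : ∃ i : Finset.Iic m, M (σ i).1 i.1 = 0
    · obtain ⟨i, hi⟩ := h
      rw [Finset.prod_eq_zero (Finset.mem_univ i) hi, smul_zero]
    · push Not at h
      refine absurd (Equiv.ext fun i => ?_) hσ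
      have h1 : ∀ i ∈ (Finset.univ : Finset (Finset.Iic m)), ((σ i : Fin k) : ℕ) ≤ (ρ i : Fin k) := by
        intro i _
        have := mt (hM (σ i).1 i) (h i)
        change _ ≤ (m : ℕ) - i
        omega
      -- both sides run through `0, …, m`, so the sums agree and each inequality is an equality
      have h2 : ∑ i, ((σ i : Fin k) : ℕ) = ∑ i, ((ρ i : Fin k) : ℕ) :=
        (Equiv.sum_comp σ fun i : Finset.Iic m => ((i : Fin k) : ℕ)).trans
          (Equiv.sum_comp hρ.toPerm fun i : Finset.Iic m => ((i : Fin k) : ℕ)).symm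
      exact Subtype.ext (Fin.ext ((Finset.sum_eq_sum_iff_of_le h1).1 h2 i (Finset.mem_univ i)))
  · simp

end Antidiagonal

/-! ### The polynomials on an antidiagonal -/

section TailPoly

variable {F : Type*} [Field F]

/-- Pairwise distinct interpolation points. -/
def point (F : Type*) [Field F] (i a : ℕ) : F := (Nat.pair i a : ℕ)

theorem point_injective [CharZero F] {i a j b : ℕ} (h : point F i a = point F j b) :
    i = j ∧ a = b := by
  rw [point, point, Nat.cast_inj, Nat.pair_eq_pair] at h
  exact h

/-- The polynomial in position `(i, j)` whose coefficients are, up to sign, the values of `x` at the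
interpolation points belonging to `min (i, j)`. On the diagonal only the powers of the parity
allowed by skew-adjointness occur. -/
noncomputable def tailPoly (p N : ℕ) (x : F[X]) (i j : ℕ) : F[X] :=
  ∑ a ∈ Finset.range N, monomial (if i = j then 2 * a + (1 - p) else a)
    ((if j < i then (-1) ^ (p + 1 + a) else 1) * x.eval (point F (min i j) a))

theorem tailPoly_add (p N : ℕ) (x y : F[X]) (i j : ℕ) :
    tailPoly p N (x + y) i j = tailPoly p N x i j + tailPoly p N y i j := by
  simp [tailPoly, mul_add, Finset.sum_add_distrib]

theorem tailPoly_smul (p N : ℕ) (c : F) (x : F[X]) (i j : ℕ) :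
    tailPoly p N (c • x) i j = c • tailPoly p N x i j := by
  simp [tailPoly, Finset.smul_sum, smul_monomial, mul_left_comm]

theorem tailPoly_zero (p N : ℕ) (i j : ℕ) : tailPoly p N (0 : F[X]) i j = 0 := by
  simp [tailPoly]

/-- The polynomials satisfy the symmetry condition of `formOf_selfAdjoint`. -/
theorem tailPoly_comp_neg {p : ℕ} (hp : p < 2) (N : ℕ) (x : F[X]) (i j : ℕ) :
    ((-1 : F) ^ p) • (tailPoly p N x j i).comp (-X) = - tailPoly p N x i j := by
  have hm : ∀ (a : ℕ) (c : F), (monomial a c).comp (-X) = monomial a ((-1) ^ a * c) := by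
    intro a c
    rw [monomial_comp, neg_pow, ← C_mul_X_pow_eq_monomial, C_mul]
    simp
    ring
  rw [tailPoly, tailPoly, ← coe_compRingHom_apply, map_sum, Finset.smul_sum,
    ← Finset.sum_neg_distrib]
  refine Finset.sum_congr rfl fun a _ => ?_
  rw [coe_compRingHom_apply, hm, smul_monomial, ← monomial_neg, min_comm j i]
  have h1 : (-1 : F) ^ (a * 2) = 1 := by rw [mul_comm, pow_mul]; simp
  have h2 : (-1 : F) ^ (p * 2) = 1 := by rw [mul_comm, pow_mul]; simp
  rcases lt_trichotomy i j with h | rfl | h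
  · simp only [h.ne, h.ne', h, h.not_gt, if_true, if_false, smul_eq_mul]
    congr 1
    ring_nf
    simp [h1, h2]
  · simp only [lt_irrefl, if_true, if_false, smul_eq_mul]
    congr 1
    interval_cases p
    · simp [pow_succ, pow_mul]
    · simp [pow_mul]
  · simp only [h.ne, h.ne', h, h.not_gt, if_true, if_false, smul_eq_mul]
    congr 1
    ring

/-- `o i` is the number of the first interpolation point belonging to `i` which is not a
root of `x`. -/
def IsOrder (x : F[X]) (o : ℕ → ℕ) : Prop :=
  ∀ i, (∀ a < o i, x.eval (point F i a) = 0) ∧ x.eval (point F i (o i)) ≠ 0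

theorem exists_isOrder [CharZero F] {x : F[X]} (hx : x ≠ 0) : ∃ o, IsOrder x o := by
  classical
  have h : ∀ i, ∃ a, x.eval (point F i a) ≠ 0 := by
    intro i
    by_contra hcon
    push Not at hcon
    exact hx (eq_zero_of_infinite_isRoot x ((Set.infinite_range_of_injective
      (f := fun a => point F i a) fun a b hab => (point_injective hab).2).mono (by
        rintro _ ⟨a, rfl⟩; exact hcon a)))
  exact ⟨fun i => Nat.find (h i), fun i => ⟨fun a ha => not_not.1 (Nat.find_min (h i) ha),
    Nat.find_spec (h i)⟩⟩

/-- Different indices have disjoint sets of interpolation points, so `x` has at least `∑ o i` roots.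
-/
theorem IsOrder.sum_le [CharZero F] {x : F[X]} {o : ℕ → ℕ} (ho : IsOrder x o) (hx : x ≠ 0)
    (s : Finset ℕ) : ∑ i ∈ s, o i ≤ x.natDegree := by
  classical
  let T : Finset F := (s.sigma fun i => Finset.range (o i)).image fun q => point F q.1 q.2
  have hT : T.card = ∑ i ∈ s, o i := by
    rw [Finset.card_image_of_injective, Finset.card_sigma]
    · simp
    · rintro ⟨i, a⟩ ⟨j, b⟩ h
      obtain ⟨rfl, rfl⟩ := point_injective h
      rfl
  rw [← hT]
  refine (Finset.card_le_card (t := x.roots.toFinset) fun c hc => ?_).trans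
    ((Multiset.toFinset_card_le _).trans (card_roots' x))
  simp only [T, Finset.mem_image, Finset.mem_sigma, Finset.mem_range] at hc
  obtain ⟨q, ⟨-, hq⟩, rfl⟩ := hc
  rw [Multiset.mem_toFinset, mem_roots hx]
  exact (ho q.1).1 _ hq

theorem natTrailingDegree_sum_monomial {N o : ℕ} (ho : o < N) {g : ℕ → ℕ} (hg : StrictMono g)
    {u : ℕ → F} (h0 : ∀ a < o, u a = 0) (h1 : u o ≠ 0) :
    ∑ a ∈ Finset.range N, monomial (g a) (u a) ≠ 0 ∧
      (∑ a ∈ Finset.range N, monomial (g a) (u a)).natTrailingDegree = g o := by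
  have hc : (∑ a ∈ Finset.range N, monomial (g a) (u a)).coeff (g o) = u o := by
    rw [finsetSum_coeff, Finset.sum_eq_single_of_mem o (Finset.mem_range.2 ho)
      fun b _ hb => by rw [coeff_monomial, if_neg (hg.injective.ne hb)], coeff_monomial,
      if_pos rfl]
  have hne : ∑ a ∈ Finset.range N, monomial (g a) (u a) ≠ 0 := fun h => by
    rw [h, coeff_zero] at hc
    exact h1 hc.symm
  refine ⟨hne, le_antisymm (natTrailingDegree_le_of_ne_zero (hc.trans_ne h1))
    (le_natTrailingDegree hne fun t ht => ?_)⟩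
  rw [finsetSum_coeff]
  refine Finset.sum_eq_zero fun a _ => ?_
  rw [coeff_monomial]
  split_ifs with h
  · exact h0 a (hg.lt_iff_lt.1 (h ▸ ht))
  · rfl

theorem natTrailingDegree_tailPoly {p N : ℕ} {x : F[X]} {o : ℕ → ℕ} (ho : IsOrder x o) {i j : ℕ}
    (hN : o (min i j) < N) :
    tailPoly p N x i j ≠ 0 ∧ (tailPoly p N x i j).natTrailingDegree =
      if i = j then 2 * o (min i j) + (1 - p) else o (min i j) := by
  have hu : ∀ a, (if j < i then (-1 : F) ^ (p + 1 + a) else 1) ≠ 0 := fun a => by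
    split_ifs
    · exact pow_ne_zero _ (neg_ne_zero.2 one_ne_zero)
    · exact one_ne_zero
  refine natTrailingDegree_sum_monomial hN (g := fun a => if i = j then 2 * a + (1 - p) else a)
    (fun a b hab => ?_) (fun a ha => by rw [(ho _).1 a ha, mul_zero])
    (mul_ne_zero (hu _) (ho _).2)
  dsimp only
  split_ifs <;> omega

theorem natTrailingDegree_prod {ι : Type*} (s : Finset ι) (f : ι → F[X]) (h : ∀ i ∈ s, f i ≠ 0) :
    (∏ i ∈ s, f i).natTrailingDegree = ∑ i ∈ s, (f i).natTrailingDegree := by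
  classical
  induction s using Finset.induction_on with
  | empty => simp
  | insert a s ha ih =>
    rw [Finset.prod_insert ha, Finset.sum_insert ha, natTrailingDegree_mul
      (h a (Finset.mem_insert_self _ _)) (Finset.prod_ne_zero_iff.2 fun i hi =>
        h i (Finset.mem_insert_of_mem hi)), ih fun i hi => h i (Finset.mem_insert_of_mem hi)]

/-- The trailing degrees along an antidiagonal: the entries `(m - i, i)` and `(i, m - i)` contribute
`o i` each, and the diagonal entry, which exists for even `m`, contributes `2 o (m / 2) + ε`. -/
theorem sum_reflect_eq (m ε : ℕ) (o : ℕ → ℕ) :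
    ∑ i ∈ Finset.range (m + 1), (if m - i = i then 2 * o (min (m - i) i) + ε
        else o (min (m - i) i)) =
      2 * (∑ i ∈ (Finset.range (m + 1)).filter (fun i => 2 * i ≤ m), o i) +
        if Even m then ε else 0 := by
  have h1 : ∀ i ∈ Finset.range (m + 1), (if m - i = i then 2 * o (min (m - i) i) + ε
      else o (min (m - i) i)) = ((if 2 * i ≤ m then o i else 0) +
        (if 2 * (m - i) ≤ m then o (m - i) else 0)) + if i = m - i then ε else 0 := by
    intro i hi
    rw [Finset.mem_range] at hi
    rcases lt_trichotomy (2 * i) m with h | h | h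
    · rw [if_neg (by omega), if_pos (by omega), if_neg (by omega), if_neg (by omega),
        min_eq_right (by omega)]; rfl
    · have : m - i = i := by omega
      rw [this]
      simp only [h.le, if_true, min_self]; ring
    · rw [if_neg (by omega), if_neg (by omega), if_pos (by omega), if_neg (by omega),
        min_eq_left (by omega)]; simp
  rw [Finset.sum_congr rfl h1, Finset.sum_add_distrib, Finset.sum_add_distrib,
    Finset.sum_filter, two_mul]
  congr 1
  · congr 1
    have := Finset.sum_range_reflect (fun i => if 2 * i ≤ m then o i else 0) (m + 1)
    simpa using this
  · split_ifs with h
    · obtain ⟨c, rfl⟩ := h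
      rw [Finset.sum_eq_single_of_mem c (by simp)
        fun b hb hbc => by rw [Finset.mem_range] at hb; rw [if_neg (by omega)],
        if_pos (by omega)]
    · refine Finset.sum_eq_zero fun b hb => ?_
      rw [Finset.mem_range] at hb
      rw [if_neg fun h' => h ⟨b, by omega⟩]

/-- The product of the entries along an antidiagonal vanishes at `0` to an order determined by `o`.
-/
theorem natTrailingDegree_prod_tailPoly {p N m : ℕ} {x : F[X]} {o : ℕ → ℕ} (ho : IsOrder x o)
    (hN : ∀ i, 2 * i ≤ m → o i < N) :
    ∏ i ∈ Finset.range (m + 1), tailPoly p N x (m - i) i ≠ 0 ∧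
      (∏ i ∈ Finset.range (m + 1), tailPoly p N x (m - i) i).natTrailingDegree =
        2 * (∑ i ∈ (Finset.range (m + 1)).filter (fun i => 2 * i ≤ m), o i) +
          if Even m then 1 - p else 0 := by
  have h : ∀ i ∈ Finset.range (m + 1), _ := fun i hi =>
    natTrailingDegree_tailPoly (p := p) ho (i := m - i) (j := i) (hN _ (by
      rw [Finset.mem_range] at hi
      omega))
  refine ⟨Finset.prod_ne_zero_iff.2 fun i hi => (h i hi).1, ?_⟩
  rw [natTrailingDegree_prod _ _ fun i hi => (h i hi).1, ← sum_reflect_eq]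
  exact Finset.sum_congr rfl fun i hi => (h i hi).2

end TailPoly

/-! ### The subspaces `W_m` -/

section ParamDim

variable {k : ℕ} {d : Fin k → ℕ}

/-- The number of even integers `l` with `blockSum d m < l ≤ blockSum d (m + 1)`; this is the
dimension of `W_m`. -/
def paramDim (d : Fin k → ℕ) (m : Fin k) : ℕ := blockSum d (m + 1) / 2 - blockSum d m / 2

theorem sum_paramDim : ∑ m, paramDim d m = (∑ i, (d i + 1)) / 2 := by
  have := Fin.sum_univ_eq_sum_range (fun m => blockSum d (m + 1) / 2 - blockSum d m / 2) k
  refine this.trans ?_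
  rw [Finset.sum_range_tsub (f := fun m => blockSum d m / 2)
    fun a b h => Nat.div_le_div_right (blockSum_mono h), blockSum_zero, blockSum_of_le le_rfl]
  simp

/-- All block sizes have the parity of `1 + p`. -/
theorem blockSum_mod_two {p : ℕ} (hp : ∀ i, d i % 2 = p) {a : ℕ} (ha : a ≤ k) :
    blockSum d a % 2 = ((1 + p) * a) % 2 := by
  induction a with
  | zero => simp [blockSum_zero]
  | succ a ih =>
    have h1 := ih (by omega)
    have h2 := blockSum_succ (d := d) ⟨a, ha⟩
    have h3 := hp ⟨a, ha⟩
    simp only at h2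
    rw [h2, mul_add, mul_one]
    omega

/-- Every `l` with `0 < l ≤ n` belongs to one of the ranges `blockSum d m < l ≤ blockSum d (m + 1)`;
then `m + 1` is the least number of blocks with total size at least `l`. -/
theorem exists_blockSum_lt_le {l : ℕ} (h0 : 0 < l) (hl : l ≤ ∑ i, (d i + 1)) :
    ∃ m : Fin k, blockSum d m < l ∧ l ≤ blockSum d (m + 1) := by
  have hex : ∃ a, l ≤ blockSum d a := ⟨k, by rwa [blockSum_of_le le_rfl]⟩
  classical
  obtain ⟨a, ha⟩ : ∃ a, Nat.find hex = a + 1 := by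
    refine Nat.exists_eq_succ_of_ne_zero fun h => ?_
    have := Nat.find_spec hex
    rw [h, blockSum_zero] at this
    omega
  have h1 : Nat.find hex ≤ k := Nat.find_min' hex (by rwa [blockSum_of_le le_rfl])
  rw [ha] at h1
  refine ⟨⟨a, h1⟩, ?_, ?_⟩
  · exact not_le.1 (Nat.find_min hex (by rw [ha]; exact a.lt_succ_self))
  · have := Nat.find_spec hex
    rwa [ha] at this

theorem sum_Iic (m : Fin k) : ∑ i ∈ Finset.Iic m, (d i + 1) = blockSum d (m + 1) := by
  have h : Finset.Iic m = Finset.univ.filter fun i : Fin k => (i : ℕ) < m + 1 := by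
    ext i
    rw [Finset.mem_Iic, Finset.mem_filter, Fin.le_def]
    simp
  rw [blockSum, h]

end ParamDim

section Family

variable {F : Type*} [Field F] {k : ℕ}

/-- The matrix of polynomials attached to a polynomial `x_m` for each antidiagonal `i + j = m`. -/
noncomputable def tailFamily (p : ℕ) (d : Fin k → ℕ) (x : Fin k → F[X]) (i j : Fin k) : F[X] :=
  if h : (i : ℕ) + j < k then tailPoly p (paramDim d ⟨i + j, h⟩) (x ⟨i + j, h⟩) i j else 0

theorem tailFamily_add (p : ℕ) (d : Fin k → ℕ) (x y : Fin k → F[X]) :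
    tailFamily p d (x + y) = tailFamily p d x + tailFamily p d y := by
  ext1 i; ext1 j
  simp only [tailFamily, Pi.add_apply, tailPoly_add]
  split_ifs <;> simp

theorem tailFamily_smul (p : ℕ) (d : Fin k → ℕ) (c : F) (x : Fin k → F[X]) :
    tailFamily p d (c • x) = c • tailFamily p d x := by
  ext1 i; ext1 j
  simp only [tailFamily, Pi.smul_apply, tailPoly_smul]
  split_ifs <;> simp

theorem tailFamily_comp_neg {p : ℕ} (hp : p < 2) (d : Fin k → ℕ) (x : Fin k → F[X])
    (i j : Fin k) :
    ((-1 : F) ^ p) • (tailFamily p d x j i).comp (-X) = - tailFamily p d x i j := by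
  rw [tailFamily, tailFamily]
  by_cases h : (i : ℕ) + j < k
  · have h' : (j : ℕ) + i < k := by omega
    have h2 : (⟨j + i, h'⟩ : Fin k) = ⟨i + j, h⟩ := Fin.ext (add_comm _ _)
    rw [dif_pos h, dif_pos h', h2, tailPoly_comp_neg hp]
  · rw [dif_neg h, dif_neg (by omega)]; simp

theorem tailFamily_eq_zero (p : ℕ) (d : Fin k → ℕ) {x : Fin k → F[X]} {m : ℕ}
    (hx : ∀ m' : Fin k, m < m' → x m' = 0) (i j : Fin k) (h : m < (i : ℕ) + j) :
    tailFamily p d x i j = 0 := by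
  rw [tailFamily]
  split_ifs with h'
  · rw [hx ⟨i + j, h'⟩ h, tailPoly_zero]
  · rfl

theorem prod_tailFamily (p : ℕ) (d : Fin k → ℕ) (x : Fin k → F[X]) (m : Fin k) :
    ∏ i ∈ Finset.Iic m, tailFamily p d x (reflect m i) i =
      ∏ i ∈ Finset.range (m + 1), tailPoly p (paramDim d m) (x m) (m - i) i := by
  refine Finset.prod_nbij Fin.val (fun i hi => ?_) Fin.val_injective.injOn (fun i hi => ?_)
    fun i hi => ?_
  · rw [Finset.mem_Iic, Fin.le_def] at hi
    rw [Finset.mem_range]; omega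
  · have : i < (m : ℕ) + 1 := by simpa using hi
    exact ⟨⟨i, by omega⟩, by simp [Fin.le_def]; omega, rfl⟩
  · rw [Finset.mem_Iic, Fin.le_def] at hi
    have h1 : ((reflect m i : Fin k) : ℕ) = m - i := rfl
    have h2 : ((reflect m i : Fin k) : ℕ) + i < k := by omega
    have h3 : (⟨((reflect m i : Fin k) : ℕ) + i, h2⟩ : Fin k) = m := Fin.ext (by
      rw [Fin.val_mk]; omega)
    rw [tailFamily, dif_pos h2, h3, h1]

end Family

section LeadingOnW

variable {F : Type*} [Field F] [CharZero F] {V : Type*} [AddCommGroup V] [Module F V]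
  [FiniteDimensional F V] {B : LinearMap.BilinForm F V} {e f : Module.End F V} {k : ℕ}
  {d : Fin k → ℕ} {w : Fin k → V} {p : ℕ}

/-- On a family concentrated on the antidiagonals up to `m`, the leading coefficient is the
product of the entries on the antidiagonal `m`: no other minor contributes. -/
theorem IsAdapted.coeff_lineCharpoly_tailFamily (hw : IsAdapted B e d w) (hB : B.Nondegenerate)
    (hd : Antitone d) (hp : ∀ i, d i % 2 = p) (hBp : ∀ v w, B v w = (-1) ^ p * B w v)
    (he : ∀ v w, B (e v) w = -B v (e w)) (hb : Function.Bijective (slicePairing B e f))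
    {x : Fin k → F[X]} {m : Fin k} (hx : ∀ m' : Fin k, m < m' → x m' = 0) {l : ℕ}
    (h1 : blockSum d m < l) (h2 : l ≤ blockSum d (m + 1)) :
    ∃ c : F, c ≠ 0 ∧
      ((lineCharpoly e (sliceMap B e f (dualOf B e w (tailFamily p d x)))).coeff
        (Module.finrank F V - l)).coeff (m + 1) =
      c * (∏ i ∈ Finset.range (m + 1), tailPoly p (paramDim d m) (x m) (m - i) i).coeff
        (blockSum d (m + 1) - l) := by
  have hp2 : p < 2 := by rw [← hp m]; exact Nat.mod_lt _ two_pos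
  have hl : l ≤ Module.finrank F V := by
    rw [hw.1.finrank]
    refine h2.trans ?_
    rw [← blockSum_of_le le_rfl]
    exact blockSum_mono m.2
  set M : Fin k → Fin k → F[X] := fun i j => (-1 : F) ^ p • tailFamily p d x i j with hMdef
  have hM0 : ∀ i j : Fin k, (m : ℕ) < i + j → Matrix.of M i j = 0 := fun i j hij => by
    rw [Matrix.of_apply, hMdef]
    simp only
    rw [tailFamily_eq_zero p d (m := m) (fun m' h => hx m' h) i j hij, smul_zero]
  obtain ⟨u, hu⟩ := det_submatrix_Iic (Matrix.of M) m hM0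
  refine ⟨(-1) ^ ((m : ℕ) + 1) * (((u : ℤ) : F) * ((-1) ^ p) ^ ((m : ℕ) + 1)), ?_, ?_⟩
  · have : ((u : ℤ) : F) ≠ 0 := by
      rw [Int.cast_ne_zero]; exact u.ne_zero
    have h3 : (-1 : F) ≠ 0 := neg_ne_zero.2 one_ne_zero
    exact mul_ne_zero (pow_ne_zero _ h3) (mul_ne_zero this (pow_ne_zero _ (pow_ne_zero _ h3)))
  rw [hw.1.coeff_lineCharpoly_leading hd _ hl h1 M fun i j c hi hj => by
      rw [hw.trace_sliceMap_dualOf hB hBp he hb (tailFamily_comp_neg hp2 d x) i j hi hj,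
        hMdef, neg_one_pow_eq_pow_mod_two (n := d j), hp, coeff_smul, smul_eq_mul],
    Finset.sum_eq_single (Finset.Iic m), sum_Iic, if_pos h2, hu]
  · simp only [Matrix.of_apply, hMdef]
    rw [← prod_tailFamily, Finset.prod_smul, Finset.prod_const, Fin.card_Iic, Units.smul_def,
      coeff_smul, coeff_smul, zsmul_eq_mul, smul_eq_mul]
    ring
  · intro I hI hne
    rw [det_submatrix_eq_zero (Matrix.of M) m hM0 (Finset.mem_powersetCard.1 hI).2 hne]
    simp
  · intro h
    exact absurd (Finset.mem_powersetCard.2 ⟨Finset.subset_univ _, by simp⟩) h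

/-- The difference of `blockSum d (m + 1)` and the order of vanishing in
`natTrailingDegree_prod_tailPoly` is even, and if `s` is less than the dimension of `W_m`, it lies
in the `m`-th range of degrees. -/
theorem natTrailingDegree_mod_two (hp : ∀ i, d i % 2 = p) (m : Fin k) (s : ℕ) :
    (blockSum d (m + 1) - (2 * s + if Even (m : ℕ) then 1 - p else 0)) % 2 = 0 ∧
    (s < paramDim d m → blockSum d m < blockSum d (m + 1) -
      (2 * s + if Even (m : ℕ) then 1 - p else 0)) := by
  have h1 := blockSum_mod_two hp m.2.le
  have h2 := blockSum_mod_two hp (Nat.succ_le_of_lt m.2)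
  have h3 := blockSum_succ (d := d) m
  have h4 := hp m
  have hp2 : p < 2 := by rw [← hp m]; exact Nat.mod_lt _ two_pos
  rw [paramDim]
  rw [Nat.succ_eq_add_one] at h2
  obtain ⟨t, ht⟩ := Nat.even_or_odd' (m : ℕ)
  have hev : Even (m : ℕ) ↔ (m : ℕ) = 2 * t := by rw [Nat.even_iff]; omega
  simp only [hev]
  interval_cases p <;> split_ifs <;> omega

/-- If the top nonzero parameter is `x_m`, some leading coefficient attached to `m` does not vanish:
its index is determined by the order of vanishing of the product along the antidiagonal. -/
theorem IsAdapted.exists_coeff_ne_zero (hw : IsAdapted B e d w) (hB : B.Nondegenerate)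
    (hd : Antitone d) (hp : ∀ i, d i % 2 = p) (hBp : ∀ v w, B v w = (-1) ^ p * B w v)
    (he : ∀ v w, B (e v) w = -B v (e w)) (hb : Function.Bijective (slicePairing B e f))
    {x : Fin k → F[X]} {m : Fin k} (hx : ∀ m' : Fin k, m < m' → x m' = 0) (hm : x m ≠ 0)
    (hdeg : (x m).natDegree < paramDim d m) :
    ∃ i : ℕ, blockSum d m < 2 * (i + 1) ∧ 2 * (i + 1) ≤ blockSum d (m + 1) ∧
      ((lineCharpoly e (sliceMap B e f (dualOf B e w (tailFamily p d x)))).coeff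
        (Module.finrank F V - 2 * (i + 1))).coeff (m + 1) ≠ 0 := by
  obtain ⟨o, ho⟩ := exists_isOrder hm
  have hN : ∀ i : ℕ, 2 * i ≤ (m : ℕ) → o i < paramDim d m := fun i _ =>
    lt_of_le_of_lt (by simpa using ho.sum_le hm {i}) hdeg
  obtain ⟨g1, g2⟩ := natTrailingDegree_prod_tailPoly (p := p) ho hN
  set s := ∑ i ∈ (Finset.range ((m : ℕ) + 1)).filter (fun i : ℕ => 2 * i ≤ (m : ℕ)), o i
  have hs : s < paramDim d m := (ho.sum_le hm _).trans_lt hdeg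
  obtain ⟨h1, h2⟩ := natTrailingDegree_mod_two hp m s
  have h3 := h2 hs
  set D := 2 * s + if Even (m : ℕ) then 1 - p else 0
  -- `D` is the order of vanishing of the product, whose lowest coefficient is the one wanted
  refine ⟨(blockSum d (m + 1) - D) / 2 - 1, by omega, by omega, ?_⟩
  have h4 : 2 * ((blockSum d (m + 1) - D) / 2 - 1 + 1) = blockSum d (m + 1) - D := by omega
  rw [h4]
  obtain ⟨c, hc, hc'⟩ := hw.coeff_lineCharpoly_tailFamily hB hd hp hBp he hb hx h3
    (Nat.sub_le _ _)
  rw [hc', Nat.sub_sub_self (by omega), ← g2]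
  exact mul_ne_zero hc (trailingCoeff_nonzero_iff_nonzero.2 g1)

/-- All the leading coefficients are nonzero functions. -/
theorem IsAdapted.exists_coeff_ne_zero_of_le (hw : IsAdapted B e d w) (hB : B.Nondegenerate)
    (hd : Antitone d) (hp : ∀ i, d i % 2 = p) (hBp : ∀ v w, B v w = (-1) ^ p * B w v)
    (he : ∀ v w, B (e v) w = -B v (e w)) (hb : Function.Bijective (slicePairing B e f))
    {m : Fin k} {i : ℕ} (h1 : blockSum d m < 2 * (i + 1))
    (h2 : 2 * (i + 1) ≤ blockSum d (m + 1)) :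
    ∃ γ, ((lineCharpoly e (sliceMap B e f γ)).coeff
        (Module.finrank F V - 2 * (i + 1))).coeff (m + 1) ≠ 0 := by
  classical
  -- the product has to vanish to the order `blockSum d (m + 1) - 2 (i + 1)`, which is achieved by a
  -- polynomial `q` with roots at the first `v` points belonging to `m / 2` and at no other point
  set v := (blockSum d (m + 1) - 2 * (i + 1) - if Even (m : ℕ) then 1 - p else 0) / 2 with hv
  let q : F[X] := ∏ a ∈ Finset.range v, (X - C (point F (m / 2) a))
  let o : ℕ → ℕ := fun j => if j = m / 2 then v else 0
  have ho : IsOrder q o := by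
    intro j
    have hq : ∀ a, q.eval (point F j a) = 0 ↔ j = m / 2 ∧ a < v := by
      intro a
      simp only [q, eval_prod, Finset.prod_eq_zero_iff, eval_sub, eval_X, eval_C, sub_eq_zero,
        Finset.mem_range]
      constructor
      · rintro ⟨b, hb, h⟩
        obtain ⟨rfl, rfl⟩ := point_injective h
        exact ⟨rfl, hb⟩
      · rintro ⟨rfl, h⟩
        exact ⟨a, h, rfl⟩
    rw [Ne, hq]
    refine ⟨fun a ha => (hq a).2 ?_, ?_⟩
    · simp only [o] at ha
      split_ifs at ha with h
      · exact ⟨h, ha⟩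
      · omega
    · rintro ⟨h, h'⟩
      simp only [o, h, if_true, lt_irrefl] at h'
  have hvN : v < paramDim d m ∧ blockSum d (m + 1) - 2 * (i + 1) =
      2 * v + if Even (m : ℕ) then 1 - p else 0 := by
    have h1' := blockSum_mod_two hp m.2.le
    have h2' := blockSum_mod_two hp (Nat.succ_le_of_lt m.2)
    have h3 := blockSum_succ (d := d) m
    have h4 := hp m
    have hp2 : p < 2 := by rw [← hp m]; exact Nat.mod_lt _ two_pos
    rw [paramDim]
    rw [Nat.succ_eq_add_one] at h2'
    obtain ⟨t, ht⟩ := Nat.even_or_odd' (m : ℕ)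
    have hev : Even (m : ℕ) ↔ (m : ℕ) = 2 * t := by rw [Nat.even_iff]; omega
    simp only [hev] at hv ⊢
    interval_cases p <;> split_ifs at hv ⊢ <;> omega
  obtain ⟨g1, g2⟩ := natTrailingDegree_prod_tailPoly (p := p) ho (N := paramDim d m) (m := m)
    fun j _ => by
      simp only [o]
      split_ifs
      · exact hvN.1
      · exact (Nat.zero_le v).trans_lt hvN.1
  have hs : ∑ j ∈ (Finset.range ((m : ℕ) + 1)).filter (fun j : ℕ => 2 * j ≤ (m : ℕ)), o j = v := by
    rw [Finset.sum_ite_eq' _ _ fun _ => v, if_pos]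
    simp only [Finset.mem_filter, Finset.mem_range]
    omega
  rw [hs, ← hvN.2] at g2
  refine ⟨dualOf B e w (tailFamily p d (Pi.single m q)), ?_⟩
  obtain ⟨c, hc, hc'⟩ := hw.coeff_lineCharpoly_tailFamily hB hd hp hBp he hb
    (x := Pi.single m q) (m := m) (fun m' h => Pi.single_eq_of_ne h.ne' _) h1 h2
  rw [hc', Pi.single_eq_same, ← g2]
  exact mul_ne_zero hc (trailingCoeff_nonzero_iff_nonzero.2 g1)

end LeadingOnW

section Auxiliary

variable {F : Type*} [Field F]

theorem finrank_degreeLT (n : ℕ) : Module.finrank F (degreeLT F n) = n := by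
  rw [(degreeLTEquiv F n).finrank_eq, Module.finrank_fin_fun]

theorem iSupIndep_range_single {ι : Type*} [DecidableEq ι] (M : ι → Type*)
    [∀ i, AddCommGroup (M i)] [∀ i, Module F (M i)] :
    iSupIndep fun i => LinearMap.range (LinearMap.single F M i) := by
  intro i
  have := LinearMap.disjoint_single_single F M {i} {j | j ≠ i} (by simp)
  simpa using this

variable {V : Type*} [AddCommGroup V] [Module F V] {B : LinearMap.BilinForm F V}
  {e f : Module.End F V}

theorem evalAt_lift_adjointAction (g : groupCentraliser B e)
    (γ : Module.Dual F (centraliser B e)) (P : SymmetricAlgebra F (centraliser B e)) :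
    evalAt γ (SymmetricAlgebra.lift
      (SymmetricAlgebra.ι F (centraliser B e) ∘ₗ adjointAction B e g) P) =
      evalAt (γ ∘ₗ adjointAction B e g) P := by
  have : (evalAt γ).comp (SymmetricAlgebra.lift
      (SymmetricAlgebra.ι F (centraliser B e) ∘ₗ adjointAction B e g)) =
      evalAt (γ ∘ₗ adjointAction B e g) := by
    refine SymmetricAlgebra.algHom_ext (LinearMap.ext fun m => ?_)
    change evalAt γ (SymmetricAlgebra.lift _ (SymmetricAlgebra.ι F (centraliser B e) m)) =
      evalAt _ (SymmetricAlgebra.ι F (centraliser B e) m)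
    rw [SymmetricAlgebra.lift_ι_apply, evalAt_ι, LinearMap.comp_apply, evalAt_ι]
    rfl
  exact DFunLike.congr_fun this P

theorem conj_symm_trace_mul (g : V ≃ₗ[F] V) (y x : Module.End F V) :
    LinearMap.trace F V (g.symm.conj y * x) = LinearMap.trace F V (y * g.conj x) := by
  rw [← LinearMap.trace_conj' (g.symm.conj y * x) g]
  congr 1
  ext v
  simp [LinearEquiv.conj_apply]

theorem evalAt_coeff_sliceRestriction [FiniteDimensional F V]
    (γ : Module.Dual F (centraliser B e)) (l q : ℕ) :
    evalAt γ ((gradeHom (sliceRestriction B e f l)).coeff q) =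
      ((lineCharpoly e (sliceMap B e f γ)).coeff (Module.finrank F V - l)).coeff q := by
  rw [evalAt_coeff_gradeHom, lineHom_sliceRestriction]

end Auxiliary

section LeadingForms

variable {F : Type*} [Field F] [CharZero F] {V : Type*} [AddCommGroup V] [Module F V]
  [FiniteDimensional F V] {B : LinearMap.BilinForm F V} {e f : Module.End F V} {k : ℕ}
  {d : Fin k → ℕ} {w : Fin k → V} {p : ℕ}

/-- If `l = 2 (i + 1)` exceeds the total size of the first `m` blocks but not that of the first
`m + 1`, then the component of minimal degree of the restriction of `Δ_l` to the slice has
degree `m + 1`. -/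
theorem IsAdapted.minComponent_sliceRestriction (hw : IsAdapted B e d w) (hB : B.Nondegenerate)
    (hd : Antitone d) (hp : ∀ i, d i % 2 = p) (hBp : ∀ v w, B v w = (-1) ^ p * B w v)
    (he : ∀ v w, B (e v) w = -B v (e w)) (hb : Function.Bijective (slicePairing B e f))
    {m : Fin k} {i : ℕ} (h1 : blockSum d m < 2 * (i + 1))
    (h2 : 2 * (i + 1) ≤ blockSum d (m + 1)) :
    minComponent (sliceRestriction B e f (2 * (i + 1))) =
      (gradeHom (sliceRestriction B e f (2 * (i + 1)))).coeff (m + 1) := by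
  have hl : 2 * (i + 1) ≤ Module.finrank F V := by
    rw [hw.1.finrank, ← blockSum_of_le le_rfl]
    exact h2.trans (blockSum_mono m.2)
  refine minComponent_eq_coeff (fun γ a ha => ?_) ?_
  · rw [lineHom_sliceRestriction]
    exact hw.1.coeff_lineCharpoly_eq_zero hd _ hl
      ((blockSum_mono (Nat.le_of_lt_succ ha)).trans_lt h1)
  · simp_rw [lineHom_sliceRestriction]
    exact hw.exists_coeff_ne_zero_of_le hB hd hp hBp he hb h1 h2

/-- Membership in `S(𝔤_e)^{G_e}` is invariance as a function on `𝔤_e*`. -/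
theorem mem_invariants_iff {P : SymmetricAlgebra F (centraliser B e)} :
    P ∈ invariants B e ↔ ∀ (g : groupCentraliser B e) (γ : Module.Dual F (centraliser B e)),
      evalAt (γ ∘ₗ adjointAction B e g) P = evalAt γ P := by
  rw [invariants, Algebra.mem_iInf]
  refine forall_congr' fun g => ?_
  rw [AlgHom.mem_equalizer, AlgHom.id_apply]
  refine ⟨fun h γ => ?_, fun h => eq_of_evalAt_eq fun γ => ?_⟩
  · rw [← evalAt_lift_adjointAction, h]
  · rw [evalAt_lift_adjointAction, h]

/-- The leading coefficients are invariant: they only depend on the linear form on the centraliser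
of `e` in `𝔤𝔩(V)`. -/
theorem IsCyclicSystem.coeff_mem_invariants (hw : IsCyclicSystem e d w) (hB : B.Nondegenerate)
    (hd : Antitone d) (hBp : ∀ v w, B v w = (-1) ^ p * B w v)
    (he : ∀ v w, B (e v) w = -B v (e w)) (hb : Function.Bijective (slicePairing B e f))
    {m l : ℕ} (h1 : blockSum d m < l) (h2 : l ≤ Module.finrank F V) :
    (gradeHom (sliceRestriction B e f l)).coeff (m + 1) ∈ invariants B e := by
  rw [mem_invariants_iff]
  intro g γ
  rw [evalAt_coeff_sliceRestriction, evalAt_coeff_sliceRestriction]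
  have hge : g.1.symm.conj e = e := by
    ext v
    rw [LinearEquiv.conj_apply_apply, LinearEquiv.symm_symm, ← g.2.2.2,
      LinearEquiv.symm_apply_apply]
  have hginv : ∀ v w, B (g.1.symm v) w = B v (g.1 w) := fun v w => by
    rw [← g.2.1, LinearEquiv.apply_symm_apply]
  have hginv' : ∀ v w, B (g.1 v) w = B v (g.1.symm w) := fun v w => by
    rw [← g.2.1 v, LinearEquiv.apply_symm_apply]
  rw [← lineCharpoly_conj e (sliceMap B e f γ) g.1.symm, hge]
  refine hw.coeff_lineCharpoly_congr hd ?_ h2 h1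
  refine trace_eq_on_glCentraliser hB hBp he (sliceMap_skew hb _) (fun v w => ?_) fun x hx => ?_
  · rw [LinearEquiv.conj_apply_apply, LinearEquiv.conj_apply_apply, LinearEquiv.symm_symm, hginv,
      sliceMap_skew hb, hginv']
  · rw [trace_sliceMap_mul hb _ ⟨x, hx⟩, conj_symm_trace_mul]
    exact (trace_sliceMap_mul hb γ (adjointAction B e g ⟨x, hx⟩)).symm

/-- The map from parameters to `𝔤_e*` whose image is `W`. -/
noncomputable def paramMap (B : LinearMap.BilinForm F V) (e : Module.End F V) (p : ℕ)
    (d : Fin k → ℕ) (w : Fin k → V) :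
    (∀ m : Fin k, degreeLT F (paramDim d m)) →ₗ[F] Module.Dual F (centraliser B e) where
  toFun x := dualOf B e w (tailFamily p d fun m => (x m : F[X]))
  map_add' x y := by
    change dualOf B e w (tailFamily p d ((fun m => (x m : F[X])) + fun m => (y m : F[X]))) = _
    rw [tailFamily_add, dualOf, formOf_add]; rfl
  map_smul' c x := by
    change dualOf B e w (tailFamily p d (c • fun m => (x m : F[X]))) = _
    rw [tailFamily_smul, dualOf, formOf_smul]; rfl

/-- A parameter mapped into the common zeros of the leading forms is zero. -/
theorem IsAdapted.eq_zero_of_paramMap_mem (hw : IsAdapted B e d w) (hB : B.Nondegenerate)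
    (hd : Antitone d) (hp : ∀ i, d i % 2 = p) (hBp : ∀ v w, B v w = (-1) ^ p * B w v)
    (he : ∀ v w, B (e v) w = -B v (e w)) (hb : Function.Bijective (slicePairing B e f))
    {x : ∀ m : Fin k, degreeLT F (paramDim d m)}
    (hx : ∀ i, 2 * (i + 1) ≤ Module.finrank F V → evalAt (paramMap B e p d w x)
      (minComponent (sliceRestriction B e f (2 * (i + 1)))) = 0) : x = 0 := by
  classical
  by_contra hne
  obtain ⟨m, hm⟩ := Finset.exists_maximal (s := Finset.univ.filter fun m => x m ≠ 0) (by
    by_contra h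
    rw [Finset.not_nonempty_iff_eq_empty, Finset.filter_eq_empty_iff] at h
    exact hne (funext fun m => not_not.1 (h (Finset.mem_univ m))))
  have hm0 : (x m : F[X]) ≠ 0 := by simpa using hm.1
  obtain ⟨i, h1, h2, h3⟩ := hw.exists_coeff_ne_zero hB hd hp hBp he hb
    (x := fun m => (x m : F[X])) (m := m) (fun m' h => by
      by_contra hc
      exact h.not_ge (hm.2 (by simpa using hc) h.le)) hm0
    ((natDegree_lt_iff_degree_lt hm0).2 (mem_degreeLT.1 (x m).2))
  have hl : 2 * (i + 1) ≤ Module.finrank F V := by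
    rw [hw.1.finrank, ← blockSum_of_le le_rfl]
    exact h2.trans (blockSum_mono m.2)
  refine h3 ?_
  have := hx i hl
  rwa [hw.minComponent_sliceRestriction hB hd hp hBp he hb h1 h2,
    evalAt_coeff_sliceRestriction] at this

/-- The subspaces `W_m` of the antidiagonal spaces. -/
theorem IsAdapted.exists_subspaces (hw : IsAdapted B e d w) (hB : B.Nondegenerate)
    (hd : Antitone d) (hp : ∀ i, d i % 2 = p) (hBp : ∀ v w, B v w = (-1) ^ p * B w v)
    (he : ∀ v w, B (e v) w = -B v (e w)) (hb : Function.Bijective (slicePairing B e f)) :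
    ∃ W : Fin k → Submodule F (Module.Dual F (centraliser B e)),
      (∀ m, W m ≤ antidiagDualLie B e w m) ∧ iSupIndep W ∧
      Module.finrank F ↥(⨆ m, W m) = Module.finrank F V / 2 ∧
      ∀ γ ∈ ⨆ m, W m, (∀ i, 2 * (i + 1) ≤ Module.finrank F V → evalAt γ
        (minComponent (sliceRestriction B e f (2 * (i + 1)))) = 0) → γ = 0 := by
  classical
  let Φ := paramMap B e p d w
  have hinj : Function.Injective Φ := by
    rw [injective_iff_map_eq_zero]
    intro x hx
    refine hw.eq_zero_of_paramMap_mem hB hd hp hBp he hb fun i hi => ?_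
    change evalAt (Φ x) _ = 0
    obtain ⟨m, h1, h2⟩ := exists_blockSum_lt_le (d := d) (l := 2 * (i + 1)) (by omega)
      (by rwa [hw.1.finrank] at hi)
    rw [hx, hw.minComponent_sliceRestriction hB hd hp hBp he hb h1 h2,
      ← zero_smul F (0 : Module.Dual F (centraliser B e)), evalAt_smul_coeff_gradeHom]
    simp
  let M : Fin k → Type _ := fun m => degreeLT F (paramDim d m)
  let W : Fin k → Submodule F (Module.Dual F (centraliser B e)) := fun m =>
    (LinearMap.range (LinearMap.single F (fun m => degreeLT F (paramDim d m)) m)).map Φ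
  have hsup : ⨆ m, W m = LinearMap.range Φ := by
    rw [← Submodule.map_iSup, LinearMap.iSup_range_single, Submodule.map_top]
  refine ⟨W, fun m => ?_, LinearMap.iSupIndep_map Φ hinj (iSupIndep_range_single _), ?_, ?_⟩
  · rintro _ ⟨_, ⟨q, rfl⟩, rfl⟩
    have hp2 : p < 2 := by rw [← hp m]; exact Nat.mod_lt _ two_pos
    refine hw.dualOf_mem_antidiagDualLie hBp he (tailFamily_comp_neg hp2 d _) m
      fun i j hij => ?_
    rw [tailFamily]
    split_ifs with h
    · rw [LinearMap.single_apply, Pi.single_eq_of_ne fun h' => hij (congrArg Fin.val h')]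
      exact tailPoly_zero _ _ _ _
    · rfl
  · rw [hsup, LinearMap.finrank_range_of_inj hinj, Module.finrank_pi_fintype, hw.1.finrank,
      ← sum_paramDim]
    exact Finset.sum_congr rfl fun m _ => finrank_degreeLT _
  · intro γ hγ h
    rw [hsup] at hγ
    obtain ⟨x, rfl⟩ := hγ
    rw [hw.eq_zero_of_paramMap_mem hB hd hp hBp he hb h, map_zero]

end LeadingForms

/-! ### Existence of adapted cyclic vectors -/

section AdaptedExists

variable {F : Type*} [Field F]

/-- The rank of `e ^ s` on the span of independent Jordan chains. -/
theorem finrank_map_pow {V : Type*} [AddCommGroup V] [Module F V] {e : Module.End F V} {k : ℕ}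
    {d : Fin k → ℕ} {w : Fin k → V} (h0 : ∀ i, (e ^ (d i + 1)) (w i) = 0)
    (hli : LinearIndependent F
      fun q : Σ i : Fin k, Fin (d i + 1) => (e ^ (q.2 : ℕ)) (w q.1)) (s : ℕ) :
    Module.finrank F ((Submodule.span F (Set.range
      fun q : Σ i : Fin k, Fin (d i + 1) => (e ^ (q.2 : ℕ)) (w q.1))).map (e ^ s)) =
      ∑ i, (d i + 1 - s) := by
  let φ : (Σ i : Fin k, Fin (d i + 1 - s)) → Σ i : Fin k, Fin (d i + 1) :=
    fun q => ⟨q.1, ⟨q.2 + s, by have := q.2.2; omega⟩⟩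
  have hφ : Function.Injective φ := by
    rintro ⟨i, a⟩ ⟨j, b⟩ h
    obtain ⟨rfl, h2⟩ := Sigma.mk.inj_iff.1 h
    have h3 := congrArg Fin.val (eq_of_heq h2)
    simp only [add_left_inj] at h3
    rw [Fin.ext h3]
  have h1 : (Submodule.span F (Set.range
      fun q : Σ i : Fin k, Fin (d i + 1) => (e ^ (q.2 : ℕ)) (w q.1))).map (e ^ s) =
      Submodule.span F (Set.range ((fun q : Σ i : Fin k, Fin (d i + 1) =>
        (e ^ (q.2 : ℕ)) (w q.1)) ∘ φ)) := by
    rw [Submodule.map_span]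
    refine le_antisymm (Submodule.span_le.2 ?_) (Submodule.span_mono ?_)
    · rintro _ ⟨_, ⟨q, rfl⟩, rfl⟩
      simp only [SetLike.mem_coe]
      rw [← Module.End.mul_apply, ← pow_add, add_comm]
      by_cases hq : (q.2 : ℕ) < d q.1 + 1 - s
      · exact Submodule.subset_span ⟨⟨q.1, ⟨q.2, hq⟩⟩, rfl⟩
      · rw [pow_apply_eq_zero_of_le (h0 q.1) (by omega)]
        exact Submodule.zero_mem _
    · rintro _ ⟨q, rfl⟩
      refine ⟨_, ⟨⟨q.1, ⟨q.2, by have := q.2.2; omega⟩⟩, rfl⟩, ?_⟩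
      simp only [Function.comp_apply, φ]
      rw [← Module.End.mul_apply, ← pow_add, add_comm]
  rw [h1, finrank_span_eq_card (hli.comp φ hφ)]
  simp

theorem IsCyclicSystem.finrank_range_pow {V : Type*} [AddCommGroup V] [Module F V]
    {e : Module.End F V} {k : ℕ} {d : Fin k → ℕ} {w : Fin k → V} (hw : IsCyclicSystem e d w)
    (s : ℕ) : Module.finrank F (LinearMap.range (e ^ s)) = ∑ i, (d i + 1 - s) := by
  rw [← finrank_map_pow hw.1 hw.2.1 s, hw.2.2, Submodule.map_top]

variable {V : Type*} [AddCommGroup V] [Module F V] {B : LinearMap.BilinForm F V}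
  {e : Module.End F V}

/-- A vector `u` with `(u, e ^ D u) = 1` can be corrected by the `e ^ (2 j) u` so that `(u, e ^ s u)`
vanishes for `s < D`. -/
theorem exists_normalised [CharZero F] {D : ℕ}
    (hBτ : ∀ v w, B v w = (-1) ^ D * B w v) (he : ∀ v w, B (e v) w = -B v (e w))
    (hD : e ^ (D + 1) = 0) {u : V} (hu : B u ((e ^ D) u) = 1) :
    ∃ u, B u ((e ^ D) u) = 1 ∧ ∀ s < D, B u ((e ^ s) u) = 0 := by
  have hz : ∀ s, D < s → e ^ s = 0 := fun s hs => pow_eq_zero_of_le hs hD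
  -- for `s` of the wrong parity, `(u, e ^ s u) = 0` by the symmetry of the form
  have hpar : ∀ (u : V) (s : ℕ), (s + D) % 2 = 1 → B u ((e ^ s) u) = 0 := by
    intro u s hs
    have h1 := hBτ u ((e ^ s) u)
    rw [form_pow_left he, ← mul_assoc, ← pow_add, neg_one_pow_eq_pow_mod_two,
      show (D + s) % 2 = 1 by omega, pow_one, neg_one_mul] at h1
    exact self_eq_neg.1 h1
  -- the condition is achieved for `s ≥ D - 2 j - 1` by induction on `j`; in each step
  -- `u + c e ^ (2 (j + 1)) u` with suitable `c` takes care of `s = D - 2 (j + 1)`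
  have key : ∀ j, ∃ u, B u ((e ^ D) u) = 1 ∧ ∀ s < D, D ≤ s + 2 * j + 1 → B u ((e ^ s) u) = 0 := by
    intro j
    induction j with
    | zero => exact ⟨u, hu, fun s h1 h2 => hpar u s (by omega)⟩
    | succ j ih =>
      obtain ⟨u, h1, h2⟩ := ih
      by_cases hj : D < 2 * (j + 1)
      · exact ⟨u, h1, fun s h3 _ => h2 s h3 (by omega)⟩
      · set c : F := -(B u ((e ^ (D - 2 * (j + 1))) u)) / 2 with hc
        have hexp : ∀ s, B (u + c • (e ^ (2 * (j + 1))) u) ((e ^ s) (u + c • (e ^ (2 * (j + 1))) u)) =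
            B u ((e ^ s) u) + 2 * c * B u ((e ^ (s + 2 * (j + 1))) u) +
              c ^ 2 * B u ((e ^ (s + 2 * (j + 1) + 2 * (j + 1))) u) := by
          intro s
          have e1 : ∀ a b : ℕ, (e ^ a) ((e ^ b) u) = (e ^ (b + a)) u := fun a b => by
            rw [add_comm, pow_add, Module.End.mul_apply]
          have e2 : ((-1 : F) ^ (2 * (j + 1))) = 1 := by rw [pow_mul]; simp
          simp only [map_add, map_smul, LinearMap.add_apply, LinearMap.smul_apply, smul_eq_mul,
            form_pow_left he, e1, e2]
          rw [show 2 * (j + 1) + s = s + 2 * (j + 1) by ring]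
          ring
        refine ⟨u + c • (e ^ (2 * (j + 1))) u, ?_, fun s h3 h4 => ?_⟩
        · rw [hexp, h1, hz _ (by omega), hz _ (by omega)]; simp
        · rw [hexp, hz (s + 2 * (j + 1) + 2 * (j + 1)) (by omega)]
          by_cases h5 : D < s + 2 * (j + 1)
          · rw [hz _ h5, h2 s h3 (by omega)]; simp
          · by_cases h6 : D = s + 2 * (j + 1)
            · rw [← h6, h1, hc, show D - 2 * (j + 1) = s by omega]
              simp; ring
            · rw [hpar u s (by omega), hpar u _ (by omega)]; simp
  obtain ⟨u, h1, h2⟩ := key D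
  exact ⟨u, h1, fun s h3 => h2 s h3 (by omega)⟩

/-- The form `(u, v) ↦ (u, e ^ D v)` is symmetric and nonzero, so it takes the value `1` on some
`(u, u)`. -/
theorem exists_normalised_vector [CharZero F] [IsAlgClosed F] (hB : B.Nondegenerate) {D : ℕ}
    (hBτ : ∀ v w, B v w = (-1) ^ D * B w v) (he : ∀ v w, B (e v) w = -B v (e w))
    (hD : e ^ (D + 1) = 0) (hD' : e ^ D ≠ 0) :
    ∃ u, B u ((e ^ D) u) = 1 ∧ ∀ s < D, B u ((e ^ s) u) = 0 := by
  let β : LinearMap.BilinForm F V := B.compl₂ (e ^ D)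
  have hβ : ∀ u v, β u v = B u ((e ^ D) v) := fun _ _ => rfl
  have hsymm : LinearMap.IsSymm β := ⟨fun u v => by
    rw [RingHom.id_apply, hβ, hβ, hBτ u, form_pow_left he, ← mul_assoc, ← pow_add]
    simp⟩
  have hne : β ≠ 0 := by
    intro h
    refine hD' (LinearMap.ext fun v => hB.2 _ fun u => ?_)
    rw [← hβ, h]; rfl
  have : Invertible (2 : F) := invertibleOfNonzero two_ne_zero
  obtain ⟨x, hx⟩ := LinearMap.BilinForm.exists_bilinForm_self_ne_zero hne hsymm
  obtain ⟨z, hz⟩ := IsAlgClosed.exists_eq_mul_self (β x x)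
  have hz0 : z ≠ 0 := fun h => hx (by rw [hz, h, mul_zero])
  refine exists_normalised hBτ he hD (u := z⁻¹ • x) ?_
  rw [← hβ, map_smul, map_smul, LinearMap.smul_apply, hz, smul_eq_mul, smul_eq_mul]
  field_simp

/-- The coordinates of a vector in the block of `u` are its products with the `e ^ (D - b) u`. -/
theorem form_sum_pow_apply {u : V} {D : ℕ} (he : ∀ v w, B (e v) w = -B v (e w))
    (hD : e ^ (D + 1) = 0) (h1 : B u ((e ^ D) u) = 1) (h2 : ∀ s < D, B u ((e ^ s) u) = 0)
    (c : Fin (D + 1) → F) (b : Fin (D + 1)) :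
    B (∑ a, c a • (e ^ (a : ℕ)) u) ((e ^ (D - b)) u) = (-1) ^ (b : ℕ) * c b := by
  rw [map_sum, LinearMap.sum_apply, Finset.sum_eq_single b]
  · rw [map_smul, LinearMap.smul_apply, form_pow_left he, ← Module.End.mul_apply, ← pow_add,
      show (b : ℕ) + (D - b) = D by have := b.2; omega, h1, smul_eq_mul]
    ring
  · intro a _ hab
    rw [map_smul, LinearMap.smul_apply, form_pow_left he, ← Module.End.mul_apply, ← pow_add]
    have hab' : (a : ℕ) ≠ b := fun h => hab (Fin.ext h)
    have := b.2
    rcases lt_or_gt_of_ne hab' with h | h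
    · rw [h2 _ (by omega)]; simp
    · rw [pow_eq_zero_of_le (show D + 1 ≤ a + (D - b) by omega) hD]; simp
  · simp

theorem coe_restrict_pow {U : Submodule F V} (hU : ∀ v ∈ U, e v ∈ U) (s : ℕ) (v : U) :
    (((e.restrict hU) ^ s) v : V) = (e ^ s) v := by
  induction s generalizing v with
  | zero => rfl
  | succ s ih => rw [pow_succ, Module.End.mul_apply, ih, pow_succ, Module.End.mul_apply]; rfl

theorem finrank_range_restrict_pow {U : Submodule F V} (hU : ∀ v ∈ U, e v ∈ U) (s : ℕ) :
    Module.finrank F (LinearMap.range ((e.restrict hU) ^ s)) =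
      Module.finrank F (U.map (e ^ s)) := by
  have h : (LinearMap.range ((e.restrict hU) ^ s)).map U.subtype = U.map (e ^ s) := by
    ext v
    constructor
    · rintro ⟨_, ⟨u, rfl⟩, rfl⟩
      exact ⟨u, u.2, (coe_restrict_pow hU s u).symm⟩
    · rintro ⟨u, hu, rfl⟩
      exact ⟨_, ⟨⟨u, hu⟩, rfl⟩, coe_restrict_pow hU s ⟨u, hu⟩⟩
  rw [← h, Submodule.finrank_map_subtype_eq]

theorem map_pow_le {U : Submodule F V} (hU : ∀ v ∈ U, e v ∈ U) (s : ℕ) :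
    U.map (e ^ s) ≤ U := by
  rintro _ ⟨u, hu, rfl⟩
  rw [← coe_restrict_pow hU s ⟨u, hu⟩]
  exact Subtype.prop _

theorem finrank_range_pow_of_isCompl [FiniteDimensional F V] {U U' : Submodule F V}
    (h : IsCompl U U') (hU : ∀ v ∈ U, e v ∈ U) (hU' : ∀ v ∈ U', e v ∈ U') (s : ℕ) :
    Module.finrank F (LinearMap.range (e ^ s)) =
      Module.finrank F (U.map (e ^ s)) + Module.finrank F (U'.map (e ^ s)) := by
  rw [← Submodule.finrank_sup_add_finrank_inf_eq, ← Submodule.map_sup, h.sup_eq_top,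
    Submodule.map_top, (h.disjoint.mono (map_pow_le hU s) (map_pow_le hU' s)).eq_bot,
    finrank_bot, add_zero]

theorem finrank_map_pow_block {u : V} {D : ℕ} (hD : e ^ (D + 1) = 0)
    (hli : LinearIndependent F fun a : Fin (D + 1) => (e ^ (a : ℕ)) u) (s : ℕ) :
    Module.finrank F ((Submodule.span F (Set.range
      fun a : Fin (D + 1) => (e ^ (a : ℕ)) u)).map (e ^ s)) = D + 1 - s := by
  have hinj : Function.Injective fun q : Σ _ : Fin 1, Fin (D + 1) => q.2 := by
    rintro ⟨i, a⟩ ⟨j, b⟩ h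
    obtain rfl := Subsingleton.elim i j
    exact congrArg (Sigma.mk i) h
  have h := finrank_map_pow (e := e) (d := fun _ : Fin 1 => D) (w := fun _ => u)
    (fun _ => by rw [hD]; rfl) (hli.comp _ hinj) s
  have hr : (Set.range fun q : Σ _ : Fin 1, Fin (D + 1) => (e ^ (q.2 : ℕ)) u) =
      Set.range fun a : Fin (D + 1) => (e ^ (a : ℕ)) u := by
    ext v
    exact ⟨fun ⟨q, hq⟩ => ⟨q.2, hq⟩, fun ⟨a, ha⟩ => ⟨⟨0, a⟩, ha⟩⟩
  rw [hr] at h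
  simpa using h

/-- Adapted cyclic vectors are split off one at a time; the Jordan type enters through the ranks
of the powers of `e`, which are additive on orthogonal sums. -/
theorem exists_isAdapted_of_finrank_range_pow [CharZero F] [IsAlgClosed F]
    {V : Type*} [AddCommGroup V] [Module F V] [FiniteDimensional F V]
    {B : LinearMap.BilinForm F V} {e : Module.End F V} (hB : B.Nondegenerate) {p : ℕ}
    (hBp : ∀ v w, B v w = (-1) ^ p * B w v) (he : ∀ v w, B (e v) w = -B v (e w))
    {k : ℕ} {d : Fin k → ℕ} (hd : Antitone d) (hp : ∀ i, d i % 2 = p)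
    (hrank : ∀ s, Module.finrank F (LinearMap.range (e ^ s)) = ∑ i, (d i + 1 - s)) :
    ∃ w, IsAdapted B e d w := by
  induction k generalizing V with
  | zero =>
    have h0 := hrank 0
    rw [pow_zero, Module.End.one_eq_id, LinearMap.range_id, finrank_top] at h0
    have : Subsingleton V := Module.finrank_zero_iff.1 (by simpa using h0)
    exact ⟨fun i => 0, ⟨fun i => i.elim0, linearIndependent_empty_type,
      Subsingleton.elim _ _⟩, fun i => i.elim0, fun i => i.elim0, fun i => i.elim0⟩
  | succ k ih =>
    have hp0 : ∀ i, (-1 : F) ^ p = (-1) ^ d i := fun i => by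
      rw [neg_one_pow_eq_pow_mod_two (n := d i), hp]
    have hD : e ^ (d 0 + 1) = 0 := by
      have := hrank (d 0 + 1)
      rw [Finset.sum_eq_zero fun i _ => by have := hd (Fin.zero_le i); omega] at this
      exact LinearMap.range_eq_bot.1 (Submodule.finrank_eq_zero.1 this)
    have hD' : e ^ d 0 ≠ 0 := by
      intro h
      have := hrank (d 0)
      rw [h, LinearMap.range_zero, finrank_bot, Fin.sum_univ_succ] at this
      omega
    -- `U` is a block of maximal size on which the form is non-degenerate; the induction hypothesis
    -- applies to its orthogonal complement `U'`
    obtain ⟨u, hu1, hu2⟩ := exists_normalised_vector hB (D := d 0)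
      (fun v w => by rw [hBp v w, hp0 0]) he hD hD'
    let uv : Fin (d 0 + 1) → V := fun a => (e ^ (a : ℕ)) u
    let U := Submodule.span F (Set.range uv)
    have hUmem : ∀ s, (e ^ s) u ∈ U := fun s => by
      by_cases hs : s < d 0 + 1
      · exact Submodule.subset_span ⟨⟨s, hs⟩, rfl⟩
      · rw [pow_eq_zero_of_le (not_lt.1 hs) hD]
        exact Submodule.zero_mem _
    have hli : LinearIndependent F uv := by
      rw [Fintype.linearIndependent_iff]
      intro c hc b
      have := form_sum_pow_apply he hD hu1 hu2 c b
      rw [hc, map_zero, LinearMap.zero_apply, eq_comm, mul_eq_zero] at this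
      exact this.resolve_left (pow_ne_zero _ (neg_ne_zero.2 one_ne_zero))
    have hUe : ∀ v ∈ U, e v ∈ U := by
      intro v hv
      refine Submodule.span_induction (p := fun v _ => e v ∈ U) ?_ (by simp)
        (fun x y _ _ hx hy => by rw [map_add]; exact U.add_mem hx hy)
        (fun c x _ hx => by rw [map_smul]; exact U.smul_mem c hx) hv
      rintro _ ⟨a, rfl⟩
      have := hUmem (a + 1)
      rwa [pow_succ', Module.End.mul_apply] at this
    let U' := B.orthogonal U
    have hU'mem : ∀ v, v ∈ U' ↔ ∀ x ∈ U, B x v = 0 := fun v =>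
      LinearMap.BilinForm.mem_orthogonal_iff
    have hU'e : ∀ v ∈ U', e v ∈ U' := by
      intro v hv
      rw [hU'mem] at hv ⊢
      intro x hx
      rw [← neg_eq_zero, ← he, hv _ (hUe x hx)]
    have hrefl : B.IsRefl := fun x y h => by rw [hBp, h, mul_zero]
    have hcompl : IsCompl U U' := by
      refine (LinearMap.BilinForm.isCompl_orthogonal_iff_disjoint hrefl).2 ?_
      rw [Submodule.disjoint_def]
      intro x hx hx'
      obtain ⟨c, rfl⟩ := (Submodule.mem_span_range_iff_exists_fun F).1 hx
      refine Finset.sum_eq_zero fun b _ => ?_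
      have h1 := form_sum_pow_apply he hD hu1 hu2 c b
      rw [hBp, (hU'mem _).1 hx' _ (hUmem _), mul_zero, eq_comm, mul_eq_zero] at h1
      rw [h1.resolve_left (pow_ne_zero _ (neg_ne_zero.2 one_ne_zero)), zero_smul]
    have hU's : ∀ (v w : U'), B.restrict U' v w = B v w := fun _ _ => rfl
    have hnd : (B.restrict U').Nondegenerate := by
      have hl : ∀ v : U', (∀ w : U', B v w = 0) → v = 0 := by
        intro v hv
        refine Subtype.ext (hB.1 _ fun y => ?_)
        obtain ⟨a, ha, b, hb, rfl⟩ := Submodule.mem_sup.1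
          (hcompl.sup_eq_top ▸ Submodule.mem_top : y ∈ U ⊔ U')
        rw [map_add, hv ⟨b, hb⟩, hBp, (hU'mem _).1 v.2 a ha, mul_zero, add_zero]
      refine ⟨hl, fun w hw => hl w fun v => ?_⟩
      rw [hBp, show B v w = 0 from hw v, mul_zero]
    obtain ⟨w', hw'1, hw'2, hw'3, hw'4⟩ := ih (B := B.restrict U') (e := e.restrict hU'e)
      (d := fun i => d i.succ) hnd (fun v w => hBp v w) (fun v w => he v w)
      (fun i j hij => hd (Fin.succ_le_succ_iff.2 hij)) (fun i => hp _) fun s => by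
        have h1 := hrank s
        have h2 := finrank_map_pow_block hD hli s
        rw [finrank_range_pow_of_isCompl hcompl hUe hU'e, Fin.sum_univ_succ, h2] at h1
        rw [finrank_range_restrict_pow]
        simpa using h1
    have hcoe := fun s v => coe_restrict_pow hU'e s v
    let w : Fin (k + 1) → V := Fin.cons u fun i => (w' i : V)
    have hspan : Submodule.span F
        (Set.range fun q : Σ i : Fin (k + 1), Fin (d i + 1) => (e ^ (q.2 : ℕ)) (w q.1)) = ⊤ := by
      rw [eq_top_iff, ← hcompl.sup_eq_top, sup_le_iff]
      constructor
      · refine Submodule.span_mono ?_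
        rintro _ ⟨a, rfl⟩
        exact ⟨⟨0, a⟩, rfl⟩
      · have h1 := congrArg (Submodule.map U'.subtype) hw'1.2.2
        rw [Submodule.map_top, Submodule.range_subtype, Submodule.map_span] at h1
        rw [← h1]
        refine Submodule.span_mono ?_
        rintro _ ⟨_, ⟨q, rfl⟩, rfl⟩
        exact ⟨⟨q.1.succ, q.2⟩, (hcoe _ _).symm⟩
    refine ⟨w, ⟨fun i => ?_, ?_, hspan⟩, fun i j hij a b => ?_, fun i s hs => ?_, fun i => ?_⟩
    · refine Fin.cases ?_ (fun i => ?_) i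
      · rw [hD]; rfl
      · have := congrArg Subtype.val (hw'1.1 i)
        rwa [hcoe] at this
    · refine linearIndependent_of_top_le_span_of_card_eq_finrank hspan.ge ?_
      have h0 := hrank 0
      rw [pow_zero, Module.End.one_eq_id, LinearMap.range_id, finrank_top] at h0
      rw [h0]
      simp
    · have horth : ∀ (i : Fin k) (a b : ℕ), B ((e ^ a) u) ((e ^ b) (w' i)) = 0 := fun i a b => by
        rw [← hcoe]
        exact (hU'mem _).1 (Subtype.prop _) _ (hUmem a)
      cases i using Fin.cases with
      | zero =>
        cases j using Fin.cases with
        | zero => exact absurd rfl hij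
        | succ j => exact horth j a b
      | succ i =>
        cases j using Fin.cases with
        | zero =>
          rw [hBp]
          exact mul_eq_zero_of_right _ (horth i b a)
        | succ j =>
          have := hw'2 i j (fun h => hij (by rw [h])) a b
          rwa [hU's, hcoe, hcoe] at this
    · revert hs
      refine Fin.cases (fun hs => hu2 s hs) (fun i hs => ?_) i
      have := hw'3 i s hs
      rwa [hU's, hcoe] at this
    · refine Fin.cases hu1 (fun i => ?_) i
      have := hw'4 i
      rwa [hU's, hcoe] at this

end AdaptedExists

/-! ### Existence of `𝔰𝔩₂`-triples -/

section TripleExists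

variable {F : Type*} [Field F] {V : Type*} [AddCommGroup V] [Module F V]
  {B : LinearMap.BilinForm F V}

theorem skew_of_basis {ι : Type*} (b : Module.Basis ι F V) {x : Module.End F V}
    (h : ∀ i j, B (x (b i)) (b j) = -B (b i) (x (b j))) (v w : V) :
    B (x v) w = -B v (x w) := by
  have : B ∘ₗ x = -(B.compl₂ x) := b.ext fun i => b.ext fun j => by simpa using h i j
  simpa using LinearMap.congr_fun (LinearMap.congr_fun this v) w

variable {e : Module.End F V} {k : ℕ} {d : Fin k → ℕ} {w : Fin k → V}

/-- The operator acting on `e ^ a w_i` as multiplication by `c i a` followed by lowering `a`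
by `t`. -/
noncomputable def IsCyclicSystem.lower (hw : IsCyclicSystem e d w) (t : ℕ) (c : Fin k → ℕ → F) :
    Module.End F V :=
  hw.basis.constr F fun x => c x.1 x.2 • (e ^ ((x.2 : ℕ) - t)) (w x.1)

theorem IsCyclicSystem.lower_pow (hw : IsCyclicSystem e d w) {t : ℕ} {c : Fin k → ℕ → F}
    (hc : ∀ i a, d i < a → a ≤ d i + t → c i a = 0) (i : Fin k) (a : ℕ) :
    hw.lower t c ((e ^ a) (w i)) = c i a • (e ^ (a - t)) (w i) := by
  by_cases ha : a ≤ d i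
  · have h1 : (e ^ a) (w i) = hw.basis ⟨i, ⟨a, Nat.lt_succ_of_le ha⟩⟩ := by rw [hw.basis_apply]
    rw [h1, IsCyclicSystem.lower, Module.Basis.constr_basis]
  · rw [hw.pow_eq_zero (not_le.1 ha), map_zero]
    by_cases h : a ≤ d i + t
    · rw [hc i a (not_le.1 ha) h, zero_smul]
    · rw [hw.pow_eq_zero (by omega), smul_zero]

/-- On each block, the triple acts as the irreducible representation of `𝔰𝔩₂` in its standard basis
`w_i, e w_i, …, e ^ d_i w_i`, of weights `-d_i, 2 - d_i, …, d_i`. -/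
theorem IsAdapted.exists_triple (hw : IsAdapted B e d w) (he : ∀ v w, B (e v) w = -B v (e w)) :
    ∃ h f : Module.End F V, IsTriple B e h f := by
  -- the weight of `e ^ a w_i`, and the factor with which `f` maps it to `e ^ (a - 1) w_i`
  let ch : Fin k → ℕ → F := fun i a => 2 * a - d i
  let cf : Fin k → ℕ → F := fun i a => a * (d i - a + 1)
  have hh : ∀ i a, hw.1.lower 0 ch ((e ^ a) (w i)) = ch i a • (e ^ a) (w i) :=
    hw.1.lower_pow fun i a h1 h2 => by omega
  have hf : ∀ i a, hw.1.lower 1 cf ((e ^ a) (w i)) = cf i a • (e ^ (a - 1)) (w i) :=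
    hw.1.lower_pow fun i a h1 h2 => by
      obtain rfl : a = d i + 1 := by omega
      simp [cf]
  have he' : ∀ i a, e ((e ^ a) (w i)) = (e ^ (a + 1)) (w i) := fun i a => by
    rw [pow_succ', Module.End.mul_apply]
  refine ⟨hw.1.lower 0 ch, hw.1.lower 1 cf, mem_skew_iff.2 (skew_of_basis hw.1.basis ?_),
    mem_skew_iff.2 (skew_of_basis hw.1.basis ?_), hw.1.basis.ext ?_, hw.1.basis.ext ?_,
    hw.1.basis.ext ?_⟩
  · rintro ⟨i, a⟩ ⟨j, b⟩
    rw [hw.1.basis_apply, hw.1.basis_apply]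
    simp only [hh, map_smul, LinearMap.smul_apply, hw.form_pow he, smul_eq_mul]
    split_ifs with h
    · obtain ⟨rfl, h⟩ := h
      have : ((a : ℕ) : F) + (b : ℕ) = d i := by
        simpa using congrArg (Nat.cast : ℕ → F) h
      simp only [ch]
      linear_combination (2 * (-1) ^ (a : ℕ)) * this
    · simp
  · rintro ⟨i, a⟩ ⟨j, b⟩
    rw [hw.1.basis_apply, hw.1.basis_apply]
    simp only [hf, map_smul, LinearMap.smul_apply, hw.form_pow he, smul_eq_mul]
    have ha2 : (a : ℕ) < d i + 1 := a.2
    have hb2 : (b : ℕ) < d j + 1 := b.2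
    rcases Nat.eq_zero_or_pos (a : ℕ) with ha | ha <;> rcases Nat.eq_zero_or_pos (b : ℕ) with hb | hb
    · simp [cf, ha, hb]
    · have hne : ¬ (i = j ∧ (a : ℕ) + ((b : ℕ) - 1) = d i) := by
        rintro ⟨rfl, h⟩
        omega
      rw [if_neg hne]
      simp [cf, ha]
    · have hne : ¬ (i = j ∧ (a : ℕ) - 1 + b = d i) := by
        rintro ⟨rfl, h⟩
        omega
      rw [if_neg hne]
      simp [cf, hb]
    by_cases h : i = j ∧ (a : ℕ) + b = d i + 1
    · rw [if_pos ⟨h.1, by omega⟩, if_pos ⟨h.1, by omega⟩]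
      obtain ⟨rfl, h⟩ := h
      have h3 : ((a : ℕ) : F) + (b : ℕ) = d i + 1 := by
        simpa using congrArg (Nat.cast : ℕ → F) h
      have h4 : (-1 : F) ^ (a : ℕ) = -(-1) ^ ((a : ℕ) - 1) := by
        obtain ⟨t, ht⟩ := Nat.exists_eq_add_of_le' ha
        rw [ht, Nat.add_sub_cancel, pow_succ]; ring
      rw [h4]
      simp only [cf]
      linear_combination ((-1) ^ ((a : ℕ) - 1) * ((b : ℕ) - (a : ℕ) : F)) * h3
    · rw [if_neg fun h' => h ⟨h'.1, by omega⟩, if_neg fun h' => h ⟨h'.1, by omega⟩]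
      simp
  · rintro ⟨i, a⟩
    rw [hw.1.basis_apply]
    simp only [LinearMap.sub_apply, Module.End.mul_apply, LinearMap.smul_apply, hh, he', map_smul,
      ← sub_smul]
    congr 1
    simp only [ch]; push_cast; ring
  · rintro ⟨i, a⟩
    rw [hw.1.basis_apply]
    simp only [LinearMap.sub_apply, Module.End.mul_apply, LinearMap.smul_apply, hh, hf, map_smul,
      smul_smul, ← sub_smul]
    congr 1
    rcases Nat.eq_zero_or_pos (a : ℕ) with ha | ha
    · simp [cf, ha]
    · obtain ⟨t, ht⟩ := Nat.exists_eq_add_of_le' ha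
      simp only [ch, ht, Nat.add_sub_cancel]; push_cast; ring
  · rintro ⟨i, a⟩
    rw [hw.1.basis_apply]
    simp only [LinearMap.sub_apply, Module.End.mul_apply, hh, hf, he', map_smul]
    rcases Nat.eq_zero_or_pos (a : ℕ) with ha | ha
    · simp [cf, ch, ha]
    · rw [Nat.sub_add_cancel ha, Nat.add_sub_cancel, ← sub_smul]
      congr 1
      simp only [cf, ch]; push_cast; ring

end TripleExists

/-! ### The rank of an orthogonal or symplectic Lie algebra -/

section Weights

variable {n : ℕ}

/-- Weights with `weight (σ i) = - weight i`, pairwise distinct if the involution `σ` has at most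
one fixed point. -/
def weight (σ : Fin n → Fin n) (i : Fin n) : ℤ :=
  if i < σ i then (i : ℤ) + 1 else if σ i < i then -((σ i : ℤ) + 1) else 0

variable {σ : Fin n → Fin n}

theorem weight_neg (hσ : Function.Involutive σ) (i : Fin n) : weight σ (σ i) = -weight σ i := by
  rw [weight, weight, hσ i]
  split_ifs <;> omega

theorem weight_injective (hσ : Function.Involutive σ)
    (hfix : ∀ i j, σ i = i → σ j = j → i = j) : Function.Injective (weight σ) := by
  intro i j h
  rw [weight, weight] at h
  split_ifs at h with h1 h2 h3 h4 h5 h6 h7 h8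
  all_goals first
    | exact Fin.ext (by omega)
    | exact hσ.injective (Fin.ext (by omega))
    | exact hfix i j (le_antisymm (not_lt.1 ‹¬ i < σ i›) (not_lt.1 ‹¬ σ i < i›))
        (le_antisymm (not_lt.1 ‹¬ j < σ j›) (not_lt.1 ‹¬ σ j < j›))

/-- An involution of `n` points with at most one fixed point exchanges `n / 2` pairs. -/
theorem card_filter_lt (hσ : Function.Involutive σ)
    (hfix : ∀ i j, σ i = i → σ j = j → i = j) :
    (Finset.univ.filter fun i => i < σ i).card = n / 2 := by
  have h1 : (Finset.univ.filter fun i => σ i < i).card =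
      (Finset.univ.filter fun i => i < σ i).card := by
    refine Finset.card_bij (fun i _ => σ i) (fun i hi => ?_) (fun i _ j _ h => hσ.injective h)
      fun i hi => ⟨σ i, ?_, hσ i⟩
    · simpa [hσ i] using hi
    · simpa [hσ i] using hi
  have h2 : (Finset.univ.filter fun i => σ i = i).card ≤ 1 := by
    rw [Finset.card_le_one]
    intro i hi j hj
    exact hfix i j (by simpa using hi) (by simpa using hj)
  have h3 : (Finset.univ.filter fun i => i < σ i).card +
      ((Finset.univ.filter fun i => σ i < i).card + (Finset.univ.filter fun i => σ i = i).card) =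
      n := by
    rw [← Finset.card_union_of_disjoint, ← Finset.card_union_of_disjoint]
    · rw [show _ ∪ (_ ∪ _) = (Finset.univ : Finset (Fin n)) from ?_, Finset.card_fin]
      ext i
      simp only [Finset.mem_union, Finset.mem_filter, Finset.mem_univ, true_and, iff_true]
      rcases lt_trichotomy i (σ i) with h | h | h
      · exact Or.inl h
      · exact Or.inr (Or.inr h.symm)
      · exact Or.inr (Or.inl h)
    · rw [Finset.disjoint_left]
      intro i hi
      simp only [Finset.mem_union, Finset.mem_filter, Finset.mem_univ, true_and] at hi ⊢
      omega
    · rw [Finset.disjoint_left]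
      intro i hi
      simp only [Finset.mem_filter, Finset.mem_univ, true_and] at hi ⊢
      omega
  omega

end Weights

section Rank

variable {F : Type*} [Field F] {V : Type*} [AddCommGroup V] [Module F V]
  {B : LinearMap.BilinForm F V}

/-- The diagonal operator with the given weights. -/
noncomputable def diagOp {n : ℕ} (b : Module.Basis (Fin n) F V) (c : Fin n → F) :
    Module.End F V :=
  b.constr F fun i => c i • b i

theorem diagOp_apply {n : ℕ} (b : Module.Basis (Fin n) F V) (c : Fin n → F) (i : Fin n) :
    diagOp b c (b i) = c i • b i := by
  rw [diagOp, Module.Basis.constr_basis]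

theorem repr_diagOp {n : ℕ} (b : Module.Basis (Fin n) F V) (c : Fin n → F) (v : V) (i : Fin n) :
    b.repr (diagOp b c v) i = c i * b.repr v i := by
  have : (b.coord i) ∘ₗ diagOp b c = c i • b.coord i := b.ext fun j => by
    rw [LinearMap.comp_apply, diagOp_apply]
    by_cases h : j = i
    · subst h; simp
    · simp [h]
  simpa using LinearMap.congr_fun this v

theorem coe_ad_apply (x y : skewAdjointLieSubalgebra B) :
    ((LieAlgebra.ad F _ x y : skewAdjointLieSubalgebra B) : Module.End F V) =
      x.1 * y.1 - y.1 * x.1 := rfl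

/-- The inclusion of the Lie algebra into `𝔤𝔩(V)`, as a linear map. -/
def skewCoe (B : LinearMap.BilinForm F V) : skewAdjointLieSubalgebra B →ₗ[F] Module.End F V where
  toFun := Subtype.val
  map_add' _ _ := rfl
  map_smul' _ _ := rfl

theorem odd_pow_mem {x : Module.End F V} (hx : x ∈ skewAdjointLieSubalgebra B) (s : ℕ) :
    x ^ (2 * s + 1) ∈ skewAdjointLieSubalgebra B := by
  rw [mem_skew_iff] at hx ⊢
  intro v w
  rw [form_pow_left hx, pow_succ, pow_mul]
  simp

theorem diagOp_pow_apply {n : ℕ} (b : Module.Basis (Fin n) F V) (c : Fin n → F) (s : ℕ)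
    (i : Fin n) : (diagOp b c ^ s) (b i) = c i ^ s • b i := by
  induction s with
  | zero => simp
  | succ s ih =>
    rw [pow_succ, Module.End.mul_apply, diagOp_apply, map_smul, ih, smul_smul, pow_succ, mul_comm]

/-- A regular element whose odd powers are independent bounds the rank from below. -/
theorem le_rank_of_linearIndependent [FiniteDimensional F V] {r : ℕ}
    (x : skewAdjointLieSubalgebra B)
    (hx : LieAlgebra.IsRegular F x)
    (hli : LinearIndependent F fun s : Fin r => x.1 ^ (2 * (s : ℕ) + 1)) :
    r ≤ LieAlgebra.rank F (skewAdjointLieSubalgebra B) := by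
  rw [← (LieAlgebra.isRegular_iff_finrank_engel_eq_rank F x).1 hx]
  let u : Fin r → LieSubalgebra.engel F x := fun s => ⟨⟨x.1 ^ (2 * (s : ℕ) + 1),
    odd_pow_mem x.2 s⟩, (LieSubalgebra.mem_engel_iff F x _).2 ⟨1, Subtype.ext (by
      rw [pow_one, coe_ad_apply, ← pow_succ, ← pow_succ', sub_self]; rfl)⟩⟩
  have hu : LinearIndependent F u := by
    refine LinearIndependent.of_comp (skewCoe B ∘ₗ
        (LieSubalgebra.engel F x).toSubmodule.subtype) ?_
    exact hli
  simpa using hu.fintype_card_le_finrank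

/-- Regularity is an open condition along a line. -/
theorem exists_polynomial_isRegular [Infinite F] {L : Type*} [LieRing L] [LieAlgebra F L]
    [FiniteDimensional F L] {x0 : L} (hx0 : LieAlgebra.IsRegular F x0) (y : L) :
    ∃ q : F[X], q ≠ 0 ∧ ∀ s, q.eval s ≠ 0 → LieAlgebra.IsRegular F (x0 + s • y) := by
  classical
  let c := Module.finBasis F L
  obtain ⟨P, hP⟩ : ∃ P : MvPolynomial (Fin (Module.finrank F L)) F,
      ∀ x : L, LieAlgebra.IsRegular F x ↔ MvPolynomial.eval (c.repr x) P ≠ 0 :=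
    ⟨_, fun x => LieAlgebra.isRegular_iff_coeff_polyCharpoly_rank_ne_zero F c x⟩
  let q : F[X] := MvPolynomial.aeval (fun i => C (c.repr x0 i) + C (c.repr y i) * X) P
  have hq : ∀ s, q.eval s = MvPolynomial.eval (c.repr (x0 + s • y)) P := by
    intro s
    have : (aeval s).comp (MvPolynomial.aeval
        (fun i => C (c.repr x0 i) + C (c.repr y i) * X : _ → F[X])) =
        MvPolynomial.aeval (c.repr (x0 + s • y) : _ → F) := by
      refine MvPolynomial.algHom_ext fun i => ?_
      rw [AlgHom.comp_apply, MvPolynomial.aeval_X, MvPolynomial.aeval_X, map_add, map_mul,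
        aeval_C, aeval_C, aeval_X, map_add, map_smul, Finsupp.add_apply, Finsupp.smul_apply,
        smul_eq_mul, mul_comm s]
      rfl
    have h2 := DFunLike.congr_fun this P
    rwa [AlgHom.comp_apply, coe_aeval_eq_eval, MvPolynomial.aeval_eq_eval] at h2
  refine ⟨q, fun h => ?_, fun s hs => (hP _).2 (by rwa [← hq])⟩
  have h1 := hq 0
  rw [h, zero_smul, add_zero, eval_zero, eq_comm] at h1
  exact (hP x0).1 hx0 h1

/-- Diagonal entries of the odd powers along a line are polynomial functions. -/
theorem exists_polynomial_det {n r : ℕ} (b : Module.Basis (Fin n) F V) (x y : Module.End F V)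
    (t : Fin r → Fin n) : ∃ D : F[X], ∀ s, D.eval s = (Matrix.of fun i j : Fin r =>
      LinearMap.toMatrix b b ((x + s • y) ^ (2 * (i : ℕ) + 1)) (t j) (t j)).det := by
  refine ⟨(Matrix.of fun i j : Fin r => (((LinearMap.toMatrix b b x).map C +
    (X : F[X]) • (LinearMap.toMatrix b b y).map C) ^ (2 * (i : ℕ) + 1)) (t j) (t j)).det,
    fun s => ?_⟩
  have h1 : (evalRingHom s).mapMatrix ((LinearMap.toMatrix b b x).map C +
      (X : F[X]) • (LinearMap.toMatrix b b y).map C) = LinearMap.toMatrix b b (x + s • y) := by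
    ext1 a a'
    rw [RingHom.mapMatrix_apply, Matrix.map_apply, Matrix.add_apply, Matrix.smul_apply]
    simp
    exact mul_comm _ _
  rw [← coe_evalRingHom, RingHom.map_det]
  congr 1
  ext1 i j
  rw [RingHom.mapMatrix_apply, Matrix.map_apply, Matrix.of_apply, Matrix.of_apply,
    ← Matrix.map_apply (f := evalRingHom s), ← RingHom.mapMatrix_apply, map_pow, h1,
    ← LinearMap.toMatrix_pow]

variable [CharZero F]

/-- The torus element with generic weights bounds the rank from above. -/
theorem finrank_engel_diagOp_le {n : ℕ} (b : Module.Basis (Fin n) F V) {σ : Fin n → Fin n}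
    (hσ : Function.Involutive σ) (hfix : ∀ i j, σ i = i → σ j = j → i = j)
    (hb : ∀ i j, B (b i) (b j) ≠ 0 ↔ j = σ i)
    (x : skewAdjointLieSubalgebra B) (hx : x.1 = diagOp b fun i => (weight σ i : F)) :
    Module.finrank F (LieSubalgebra.engel F x) ≤ n / 2 := by
  classical
  have hpow : ∀ (m : ℕ) (y : skewAdjointLieSubalgebra B) (i j : Fin n),
      b.repr ((((LieAlgebra.ad F _ x) ^ m) y).1 (b j)) i =
        ((weight σ i : F) - weight σ j) ^ m * b.repr (y.1 (b j)) i := by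
    intro m
    induction m with
    | zero => intro y i j; simp
    | succ m ih =>
      intro y i j
      rw [pow_succ, Module.End.mul_apply, ih, coe_ad_apply, hx, LinearMap.sub_apply,
        Module.End.mul_apply, Module.End.mul_apply, diagOp_apply, map_smul, map_sub, map_smul,
        Finsupp.sub_apply, Finsupp.smul_apply, repr_diagOp, smul_eq_mul]
      ring
  -- as the weights are distinct, the Engel subalgebra consists of diagonal operators
  have hoff : ∀ y ∈ LieSubalgebra.engel F x, ∀ i j, i ≠ j → b.repr (y.1 (b j)) i = 0 := by
    intro y hy i j hij
    obtain ⟨m, hm⟩ := (LieSubalgebra.mem_engel_iff F x y).1 hy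
    have := hpow m y i j
    rw [hm] at this
    have h0 : (weight σ i : F) - weight σ j ≠ 0 := by
      rw [sub_ne_zero, Ne, Int.cast_inj]
      exact fun h => hij (weight_injective hσ hfix h)
    simpa [h0] using this
  have hval : ∀ y ∈ LieSubalgebra.engel F x, ∀ j, y.1 (b j) = b.repr (y.1 (b j)) j • b j := by
    intro y hy j
    conv_lhs => rw [← b.sum_repr (y.1 (b j))]
    exact Finset.sum_eq_single j (fun i _ hi => by rw [hoff y hy i j hi, zero_smul]) (by simp)
  -- a skew-adjoint diagonal operator is determined by the entries at `i < σ i`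
  have hneg : ∀ y ∈ LieSubalgebra.engel F x, ∀ j,
      b.repr (y.1 (b j)) j = - b.repr (y.1 (b (σ j))) (σ j) := by
    intro y hy j
    have h1 := mem_skew_iff.1 y.2 (b j) (b (σ j))
    rw [hval y hy j, hval y hy (σ j), map_smul, map_smul, LinearMap.smul_apply, smul_eq_mul,
      smul_eq_mul, ← neg_mul] at h1
    exact mul_right_cancel₀ ((hb j (σ j)).2 rfl) h1
  let Ψ : LieSubalgebra.engel F x →ₗ[F] ((Finset.univ.filter fun i => i < σ i) → F) :=
    LinearMap.pi fun i => (b.coord i) ∘ₗ (LinearMap.applyₗ (b i)) ∘ₗ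
      skewCoe B ∘ₗ
        (LieSubalgebra.engel F x).toSubmodule.subtype
  have hΨ : Function.Injective Ψ := by
    rw [injective_iff_map_eq_zero]
    intro y hy
    have hT : ∀ i, i < σ i → b.repr (y.1.1 (b i)) i = 0 := fun i hi =>
      congrFun hy ⟨i, by simpa using hi⟩
    refine Subtype.ext (Subtype.ext (b.ext fun j => ?_))
    rw [hval y.1 y.2 j]
    refine smul_eq_zero_of_left ?_ _
    rcases lt_trichotomy j (σ j) with h | h | h
    · exact hT j h
    · have := hneg y.1 y.2 j
      rw [← h] at this
      exact self_eq_neg.1 this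
    · rw [hneg y.1 y.2 j, hT (σ j) (by rwa [hσ j]), neg_zero]
  have := LinearMap.finrank_le_finrank_of_injective hΨ
  rwa [Module.finrank_fintype_fun_eq_card, Fintype.card_coe, card_filter_lt hσ hfix] at this

open scoped Matrix in
/-- The diagonal entries of the odd powers form a Vandermonde matrix in the squares of the weights,
up to multiplication by the weights. -/
theorem det_weight_ne_zero {n r : ℕ} (b : Module.Basis (Fin n) F V) {σ : Fin n → Fin n}
    (t : Fin r → Fin n) (htinj : Function.Injective t) (ht : ∀ i, t i < σ (t i)) :
    (Matrix.of fun i j : Fin r => LinearMap.toMatrix b b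
      ((diagOp b fun i => (weight σ i : F)) ^ (2 * (i : ℕ) + 1)) (t j) (t j)).det ≠ 0 := by
  have hw : ∀ j, weight σ (t j) = ((t j : ℕ) : ℤ) + 1 := fun j => by
    rw [weight, if_pos (ht j)]
  have h2 : (Matrix.of fun i j : Fin r => LinearMap.toMatrix b b
      ((diagOp b fun i => (weight σ i : F)) ^ (2 * (i : ℕ) + 1)) (t j) (t j)) =
      (Matrix.of fun j i => (weight σ (t j) : F) *
        Matrix.vandermonde (fun j => (weight σ (t j) : F) ^ 2) j i)ᵀ := by
    ext1 i j
    rw [Matrix.of_apply, LinearMap.toMatrix_apply, diagOp_pow_apply, map_smul, Finsupp.smul_apply,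
      Module.Basis.repr_self, Finsupp.single_eq_same, Matrix.transpose_apply, Matrix.of_apply,
      Matrix.vandermonde_apply, smul_eq_mul, mul_one, ← pow_mul, pow_succ, mul_comm]
  rw [h2, Matrix.det_transpose]
  have h3 := Matrix.det_mul_column (fun j => (weight σ (t j) : F))
    (Matrix.vandermonde (fun j => (weight σ (t j) : F) ^ 2))
  rw [h3]
  refine mul_ne_zero (Finset.prod_ne_zero_iff.2 fun j _ => ?_)
    (Matrix.det_vandermonde_ne_zero_iff.2 fun i j hij => ?_)
  · rw [hw, Int.cast_ne_zero]
    omega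
  · simp only [hw] at hij
    have h3 : (((t i : ℕ) : ℤ) + 1) ^ 2 = (((t j : ℕ) : ℤ) + 1) ^ 2 := by exact_mod_cast hij
    have h4 := (sq_eq_sq₀ (by positivity) (by positivity)).1 h3
    exact htinj (Fin.ext (by omega))

/-- On the line through the torus element, which has `n / 2` independent odd powers, and an
arbitrary regular element there is a regular element with `n / 2` independent odd powers. -/
theorem le_rank_of_diagOp [FiniteDimensional F V] {n : ℕ} (b : Module.Basis (Fin n) F V)
    {σ : Fin n → Fin n}
    (hσ : Function.Involutive σ) (hfix : ∀ i j, σ i = i → σ j = j → i = j)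
    (x : skewAdjointLieSubalgebra B) (hx : x.1 = diagOp b fun i => (weight σ i : F)) :
    n / 2 ≤ LieAlgebra.rank F (skewAdjointLieSubalgebra B) := by
  classical
  obtain ⟨x0, hx0⟩ := LieAlgebra.exists_isRegular F (skewAdjointLieSubalgebra B)
  let T := Finset.univ.filter fun i => i < σ i
  let t : Fin (n / 2) ↪o Fin n := T.orderEmbOfFin (card_filter_lt hσ hfix)
  have ht : ∀ i, t i < σ (t i) := fun i =>
    (Finset.mem_filter.1 (T.orderEmbOfFin_mem (card_filter_lt hσ hfix) i)).2
  obtain ⟨q, hq0, hq⟩ := exists_polynomial_isRegular hx0 (x - x0)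
  obtain ⟨D, hD⟩ := exists_polynomial_det b x0.1 (x.1 - x0.1) t
  have hD0 : D ≠ 0 := by
    intro h
    have h1 := hD 1
    rw [h, eval_zero, one_smul, add_sub_cancel, hx, eq_comm] at h1
    exact det_weight_ne_zero b t t.injective ht h1
  obtain ⟨s, hs⟩ : ∃ s, (q * D).eval s ≠ 0 := by
    by_contra hcon
    push Not at hcon
    exact mul_ne_zero hq0 hD0 (Polynomial.funext fun s => by rw [hcon s, eval_zero])
  rw [eval_mul] at hs
  refine le_rank_of_linearIndependent _ (hq s (left_ne_zero_of_mul hs)) ?_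
  have hs2 := right_ne_zero_of_mul hs
  rw [hD] at hs2
  change LinearIndependent F fun i : Fin (n / 2) => (x0.1 + s • (x.1 - x0.1)) ^ (2 * (i : ℕ) + 1)
  rw [Fintype.linearIndependent_iff]
  intro g hg
  refine congrFun (Matrix.eq_zero_of_vecMul_eq_zero hs2 (v := g) (funext fun j => ?_))
  have := congrArg (fun y : Module.End F V => LinearMap.toMatrix b b y (t j) (t j)) hg
  simp only [map_sum, map_smul, Matrix.sum_apply, Matrix.smul_apply, map_zero,
    Matrix.zero_apply, smul_eq_mul] at this
  exact this

/-- The rank is half the dimension of `V`, given a basis that `B` pairs off by an involution with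
at most one fixed point. -/
theorem rank_eq_of_basis [FiniteDimensional F V] {n : ℕ} (b : Module.Basis (Fin n) F V)
    {σ : Fin n → Fin n}
    (hσ : Function.Involutive σ) (hfix : ∀ i j, σ i = i → σ j = j → i = j)
    (hb : ∀ i j, B (b i) (b j) ≠ 0 ↔ j = σ i) :
    LieAlgebra.rank F (skewAdjointLieSubalgebra B) = n / 2 := by
  let x : skewAdjointLieSubalgebra B := ⟨diagOp b fun i => (weight σ i : F), by
    refine mem_skew_iff.2 (skew_of_basis b fun i j => ?_)
    rw [diagOp_apply, diagOp_apply, map_smul, map_smul, LinearMap.smul_apply, smul_eq_mul,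
      smul_eq_mul, ← neg_mul]
    by_cases h : j = σ i
    · rw [h, weight_neg hσ]; simp
    · rw [not_not.1 (mt (hb i j).1 h), mul_zero, mul_zero]⟩
  exact le_antisymm ((LieAlgebra.rank_le_finrank_engel F x).trans
    (finrank_engel_diagOp_le b hσ hfix hb x rfl)) (le_rank_of_diagOp b hσ hfix x rfl)

end Rank

section RankCases

variable {F : Type*} [Field F] [CharZero F] {V : Type*} [AddCommGroup V] [Module F V]
  [FiniteDimensional F V] {B : LinearMap.BilinForm F V}

theorem rank_eq_of_family {n : ℕ} (hn : n = Module.finrank F V) (b : Fin n → V)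
    {σ : Fin n → Fin n} (hσ : Function.Involutive σ)
    (hfix : ∀ i j, σ i = i → σ j = j → i = j)
    (hb : ∀ i j, B (b i) (b j) ≠ 0 ↔ j = σ i) :
    LieAlgebra.rank F (skewAdjointLieSubalgebra B) = Module.finrank F V / 2 := by
  have hli : LinearIndependent F b := by
    rw [Fintype.linearIndependent_iff]
    intro c hc j
    have h1 := congrArg (fun v => B v (b (σ j))) hc
    simp only [map_sum, LinearMap.sum_apply, map_smul, LinearMap.smul_apply, map_zero,
      LinearMap.zero_apply, smul_eq_mul] at h1
    rw [Finset.sum_eq_single j (fun i _ hij => by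
      rw [not_not.1 (mt (hb i (σ j)).1 fun h => hij (hσ.injective h).symm), mul_zero]) (by simp)]
      at h1
    exact (mul_eq_zero.1 h1).resolve_right ((hb j (σ j)).2 rfl)
  have h := rank_eq_of_basis (B := B) (basisOfLinearIndependentOfCardEqFinrank' b hli
    (by simpa using hn))
    hσ hfix (by simpa using hb)
  rw [h, hn]

/-- An orthonormal basis `u` yields the basis `u i + √-1 u (rev i)`, which the form pairs off by
reversing the order. -/
theorem rank_eq_of_isSymm [IsAlgClosed F] (hB : B.Nondegenerate) (hsymm : B.IsSymm) :
    LieAlgebra.rank F (skewAdjointLieSubalgebra B) = Module.finrank F V / 2 := by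
  have : Invertible (2 : F) := invertibleOfNonzero two_ne_zero
  obtain ⟨v, hv⟩ := LinearMap.BilinForm.exists_orthogonal_basis (B := B)
    ⟨fun x y => hsymm.eq x y⟩
  have hvo : ∀ i j, i ≠ j → B (v i) (v j) = 0 := fun i j hij => hv hij
  have hvv : ∀ i, B (v i) (v i) ≠ 0 := by
    intro i h
    refine v.ne_zero i (hB.1 _ fun y => ?_)
    have : B (v i) = 0 := v.ext fun j => by
      by_cases hij : i = j
      · subst hij; simpa using h
      · simpa using hvo i j hij
    rw [this]; rfl
  choose z hz using fun i => IsAlgClosed.exists_eq_mul_self (B (v i) (v i))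
  have hz0 : ∀ i, z i ≠ 0 := fun i h => hvv i (by rw [hz, h, mul_zero])
  obtain ⟨I, hI⟩ := IsAlgClosed.exists_eq_mul_self (-1 : F)
  have hI0 : I ≠ 0 := fun h => by simp [h] at hI
  let u := fun i => (z i)⁻¹ • v i
  have huu : ∀ i j, B (u i) (u j) = if i = j then 1 else 0 := by
    intro i j
    simp only [u, map_smul, LinearMap.smul_apply, smul_eq_mul]
    split_ifs with h
    · subst h
      rw [hz i]
      field_simp [hz0 i]
    · rw [hvo i j h]; simp
  refine rank_eq_of_family rfl (fun i => u i + I • u i.rev) (σ := Fin.rev) Fin.rev_rev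
    (fun i j hi hj => ?_) fun i j => ?_
  · rw [Fin.ext_iff, Fin.val_rev] at hi hj
    exact Fin.ext (by omega)
  · have h1 : B (u i + I • u i.rev) (u j + I • u j.rev) = if j = i.rev then 2 * I else 0 := by
      simp only [map_add, map_smul, LinearMap.add_apply, LinearMap.smul_apply, smul_eq_mul, huu,
        Fin.rev_inj]
      have e1 : i = j.rev ↔ j = i.rev := by rw [← Fin.rev_eq_iff, eq_comm]
      have e2 : i.rev = j ↔ j = i.rev := eq_comm
      simp only [e1, e2]
      split_ifs <;> first | linear_combination (-1 : F) * hI | ring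
    rw [h1]
    simp [hI0]

/-- For blocks of even size the Jordan basis itself is paired off by the form, without fixed points.
-/
theorem IsAdapted.rank_eq_of_odd {e : Module.End F V} {k : ℕ} {d : Fin k → ℕ} {w : Fin k → V}
    (hw : IsAdapted B e d w) (he : ∀ v w, B (e v) w = -B v (e w)) (hd : ∀ i, d i % 2 = 1) :
    LieAlgebra.rank F (skewAdjointLieSubalgebra B) = Module.finrank F V / 2 := by
  let E : JordanIndex d ≃ Fin (Module.finrank F V) := Fintype.equivFinOfCardEq
    (Module.finrank_eq_card_basis hw.1.basis).symm
  let σ : JordanIndex d → JordanIndex d := fun x => ⟨x.1, x.2.rev⟩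
  have hσ : Function.Involutive σ := fun x => by simp [σ]
  refine rank_eq_of_family rfl (fun i => hw.1.basis (E.symm i)) (σ := E ∘ σ ∘ E.symm)
    (fun i => by simp [hσ (E.symm i)]) (fun i j hi _ => ?_) fun i j => ?_
  · exfalso
    have h1 : σ (E.symm i) = E.symm i := by rw [Equiv.eq_symm_apply]; exact hi
    generalize E.symm i = x at h1
    obtain ⟨i, a⟩ := x
    have h2 : a.rev = a := by simpa [σ] using h1
    rw [Fin.ext_iff, Fin.val_rev] at h2
    have := hd i
    omega
  · have h1 : j = (E ∘ σ ∘ E.symm) i ↔ E.symm j = σ (E.symm i) := by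
      rw [Equiv.symm_apply_eq]; rfl
    rw [h1]
    generalize E.symm i = x
    generalize E.symm j = y
    obtain ⟨i, a⟩ := x
    obtain ⟨j, b⟩ := y
    rw [hw.1.basis_apply, hw.1.basis_apply, hw.form_pow he]
    constructor
    · intro h
      split_ifs at h with hc
      · obtain ⟨rfl, hc⟩ := hc
        refine Sigma.ext rfl (heq_of_eq (Fin.ext ?_))
        change (b : ℕ) = (a.rev : ℕ)
        rw [Fin.val_rev]
        change (a : ℕ) + b = d i at hc
        omega
      · exact absurd rfl h
    · intro h
      obtain ⟨rfl, h2⟩ := Sigma.mk.inj_iff.1 h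
      have h3 : (b : ℕ) = (a.rev : ℕ) := congrArg Fin.val (eq_of_heq h2)
      rw [Fin.val_rev] at h3
      rw [if_pos ⟨rfl, by have := a.2; change (a : ℕ) + b = d j; omega⟩]
      exact pow_ne_zero _ (neg_ne_zero.2 one_ne_zero)

end RankCases

/-! ### Systems of parameters on Cohen–Macaulay modules -/

section CohenMacaulay

universe u

open IsLocalRing RingTheory.Sequence CategoryTheory Abelian Limits Pointwise

variable {R : Type u} [CommRing R] [IsLocalRing R]

theorem maximalIdeal_smul_top_lt_top (M : Type u) [AddCommGroup M] [Module R M]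
    [Module.Finite R M] [Nontrivial M] :
    maximalIdeal R • (⊤ : Submodule R M) < ⊤ :=
  lt_top_iff_ne_top.2 (Submodule.top_ne_ideal_smul_of_le_jacobson_annihilator
    (maximalIdeal_le_jacobson _)).symm

variable [IsNoetherianRing R]

/-- Dividing out a regular element lowers the depth by at most one: by Rees's theorem the depth is
detected by the vanishing of `Ext` groups, to which the long exact sequence applies. -/
theorem exists_isRegular_quotSMulTop {M : Type u} [AddCommGroup M] [Module R M]
    [Module.Finite R M] [Nontrivial M] {x : R} (hxm : x ∈ maximalIdeal R)
    (hx : IsSMulRegular M x) {rs : List R} (hrs : IsRegular M rs)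
    (hmem : ∀ r ∈ rs, r ∈ maximalIdeal R) {n : ℕ} (hn : rs.length = n + 1) :
    ∃ rs' : List R, rs'.length = n ∧ (∀ r ∈ rs', r ∈ maximalIdeal R) ∧
      IsRegular (QuotSMulTop x M) rs' := by
  have : Nontrivial (QuotSMulTop x M) := nontrivial_quotSMulTop_of_mem_maximalIdeal M hxm
  let N : ModuleCat.{u} R := ModuleCat.of R (R ⧸ maximalIdeal R)
  have hN : Module.support R N = PrimeSpectrum.zeroLocus (maximalIdeal R) := by
    rw [Module.support_eq_zeroLocus, Ideal.annihilator_quotient]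
  have h1 := ModuleCat.subsingleton_ext_of_exists_isRegular (maximalIdeal R) N hN.subset
    (ModuleCat.of R M) (maximalIdeal_smul_top_lt_top M) rs hmem hrs
  refine ModuleCat.exists_isRegular_of_exists_subsingleton_ext (maximalIdeal R) n
    (ModuleCat.of R (QuotSMulTop x M)) (maximalIdeal_smul_top_lt_top _) N hN fun i hi => ?_
  have zero1 := AddCommGrpCat.isZero_of_iff_subsingleton.mpr (h1 i (by omega))
  have zero2 := AddCommGrpCat.isZero_of_iff_subsingleton.mpr (h1 (i + 1) (by omega))
  have hx' : IsSMulRegular (ModuleCat.of R M) x := hx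
  exact AddCommGrpCat.subsingleton_of_isZero <| ShortComplex.Exact.isZero_of_both_zeros
    ((Ext.covariant_sequence_exact₃' N hx'.smulShortComplex_shortExact) i (i + 1) rfl)
    (zero1.eq_zero_of_src _) (zero2.eq_zero_of_tgt _)

/-- The depth of a module is at most the dimension of each of its associated primes. -/
theorem length_le_ringKrullDim_quotient_of_mem_associatedPrimes (rs : List R) {M : Type u}
    [AddCommGroup M] [Module R M] [Module.Finite R M] (hrs : IsRegular M rs)
    (hmem : ∀ r ∈ rs, r ∈ maximalIdeal R) {Q : Ideal R} (hQ : Q ∈ associatedPrimes R M) :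
    (rs.length : WithBot ℕ∞) ≤ ringKrullDim (R ⧸ Q) := by
  induction rs generalizing M Q with
  | nil =>
    have := hQ.isPrime
    simpa using ringKrullDim_nonneg_of_nontrivial (R := R ⧸ Q)
  | cons x rs ih =>
    obtain ⟨hx, hrs'⟩ := (isRegular_cons_iff M x rs).1 hrs
    have hxm : x ∈ maximalIdeal R := hmem x (by simp)
    have hQp := hQ.isPrime
    -- the elements killed by `Q` do not all lie in `x M`, by Nakayama's lemma
    let N : Submodule R M := Submodule.torsionBySet R M (Q : Set R)
    have hNmem : ∀ m : M, m ∈ N ↔ ∀ q ∈ Q, q • m = 0 := fun m => by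
      simp [N, Submodule.mem_torsionBySet_iff]
    have hN : ∃ m ∈ N, m ∉ x • (⊤ : Submodule R M) := by
      by_contra! hcon
      have hNx : N ≤ Ideal.span {x} • N := by
        intro m hm
        obtain ⟨m', -, rfl⟩ := (Submodule.mem_smul_pointwise_iff_exists _ _ _).1 (hcon m hm)
        refine Submodule.smul_mem_smul (Ideal.mem_span_singleton_self x) ((hNmem _).2 fun q hq => ?_)
        have h2 := (hNmem _).1 hm q hq
        rw [smul_comm] at h2
        exact hx (h2.trans (smul_zero x).symm)
      have hbot : N = ⊥ := Submodule.eq_bot_of_le_smul_of_le_jacobson_bot (Ideal.span {x}) N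
        (IsNoetherian.noetherian N) hNx (by
          rw [Ideal.span_singleton_le_iff_mem]
          exact maximalIdeal_le_jacobson _ hxm)
      obtain ⟨-, m, hm⟩ := isAssociatedPrime_iff.1 hQ
      have hmN : m ∈ N := (hNmem _).2 fun q hq => by
        rw [hm] at hq
        simpa using hq
      rw [hbot, Submodule.mem_bot] at hmN
      apply hQp.ne_top
      rw [hm, hmN]
      ext; simp
    obtain ⟨m, hmN, hmx⟩ := hN
    let m' : QuotSMulTop x M := Submodule.Quotient.mk m
    have hm' : m' ≠ 0 := fun h => hmx ((Submodule.Quotient.mk_eq_zero _).1 h)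
    obtain ⟨Q', hQ', hle⟩ := exists_le_isAssociatedPrime_of_isNoetherianRing R m' hm'
    have hQQ' : Q ≤ Q' := fun q hq => hle (by
      have : q • m' = 0 := by
        change Submodule.Quotient.mk (q • m) = _
        rw [(hNmem m).1 hmN q hq]; rfl
      simpa using this)
    have hxQ' : x ∈ Q' := hle (by
      have : x • m' = 0 := by
        change Submodule.Quotient.mk (x • m) = _
        exact (Submodule.Quotient.mk_eq_zero _).2
          (Submodule.smul_mem_pointwise_smul _ _ _ trivial)
      simpa using this)
    have hxQ : x ∉ Q := fun h => by
      have h3 : x ∈ ⋃ p ∈ associatedPrimes R M, (p : Set R) := Set.mem_biUnion hQ h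
      rw [biUnion_associatedPrimes_eq_compl_regular] at h3
      exact h3 hx
    have h4 := ih hrs' (fun r hr => hmem r (by simp [hr])) hQ'
    have := hQ'.isPrime
    have h5 : ringKrullDim (R ⧸ Q') + 1 ≤ ringKrullDim (R ⧸ Q) := by
      have h6 := ringKrullDim_quotient_succ_le_of_nonZeroDivisor
        (R := R ⧸ Q) (r := Ideal.Quotient.mk Q x) (by
          rw [mem_nonZeroDivisors_iff_ne_zero, Ne, Ideal.Quotient.eq_zero_iff_mem]; exact hxQ)
      refine le_trans (add_le_add_left ?_ 1) h6
      refine ringKrullDim_le_of_surjective (Ideal.Quotient.lift _ (Ideal.Quotient.factor hQQ') ?_) ?_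
      · intro a ha
        obtain ⟨b, rfl⟩ := Ideal.mem_span_singleton'.1 ha
        rw [map_mul]
        have : Ideal.Quotient.factor hQQ' (Ideal.Quotient.mk Q x) = 0 := by
          rw [Ideal.Quotient.factor_mk, Ideal.Quotient.eq_zero_iff_mem]; exact hxQ'
        rw [this, mul_zero]
      · exact Ideal.Quotient.lift_surjective_of_surjective _ _ (Ideal.Quotient.factor_surjective hQQ')
    refine le_trans ?_ h5
    rw [List.length_cons, Nat.cast_add, Nat.cast_one]
    exact add_le_add_left h4 1

/-- Dividing out `fs` lowers the dimension by at most its length. -/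
theorem supportDim_le_supportDim_quotient_ofList_add_length (fs : List R) {M : Type u}
    [AddCommGroup M] [Module R M] [Module.Finite R M] (hfm : ∀ r ∈ fs, r ∈ maximalIdeal R) :
    Module.supportDim R M ≤
      Module.supportDim R (M ⧸ Ideal.ofList fs • (⊤ : Submodule R M)) + fs.length := by
  induction fs generalizing M with
  | nil =>
    rw [Ideal.ofList_nil, Submodule.bot_smul]
    simpa using (Module.supportDim_eq_of_equiv (Submodule.quotEquivOfEqBot ⊥ rfl)).ge
  | cons x fs ih =>
    rw [Module.supportDim_eq_of_equiv (Submodule.quotOfListConsSMulTopEquivQuotSMulTopInner M x _)]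
    refine (Module.supportDim_le_supportDim_quotSMulTop_succ (hfm x (by simp))).trans ?_
    rw [List.length_cons, Nat.cast_add, Nat.cast_one, ← add_assoc]
    exact add_le_add_left (ih (M := QuotSMulTop x M) fun r hr => hfm r (by simp [hr])) 1

/-- On a module whose depth is its dimension, a system of parameters is a regular sequence. -/
theorem isRegular_of_supportDim_quotient_eq_zero (fs : List R) {M : Type u}
    [AddCommGroup M] [Module R M] [Module.Finite R M] [Nontrivial M] {rs : List R}
    (hrs : IsRegular M rs) (hmem : ∀ r ∈ rs, r ∈ maximalIdeal R)
    (hdim : Module.supportDim R M = rs.length) (hlen : fs.length = rs.length)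
    (hfm : ∀ r ∈ fs, r ∈ maximalIdeal R)
    (hf : Module.supportDim R (M ⧸ Ideal.ofList fs • (⊤ : Submodule R M)) ≤ 0) :
    IsRegular M fs := by
  induction fs generalizing M rs with
  | nil => exact IsRegular.nil R M
  | cons x fs ih =>
    have hxm := hfm x (by simp)
    have hfm' : ∀ r ∈ fs, r ∈ maximalIdeal R := fun r hr => hfm r (by simp [hr])
    rw [Module.supportDim_eq_of_equiv
      (Submodule.quotOfListConsSMulTopEquivQuotSMulTopInner M x _)] at hf
    have hle : Module.supportDim R (QuotSMulTop x M) ≤ fs.length :=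
      (supportDim_le_supportDim_quotient_ofList_add_length fs hfm').trans
        ((add_le_add_left hf _).trans (zero_add _).le)
    -- if `x` lay in an associated prime `Q`, the dimension of `Q`, which is at least the depth,
    -- would be at most the dimension of `M / x M`, which is smaller
    have hreg : IsSMulRegular M x := by
      by_contra hcon
      have h1 : x ∈ ⋃ p ∈ associatedPrimes R M, (p : Set R) := by
        rw [biUnion_associatedPrimes_eq_compl_regular]; exact hcon
      obtain ⟨Q, hQ, hxQ⟩ := Set.mem_iUnion₂.1 h1
      have h2 := length_le_ringKrullDim_quotient_of_mem_associatedPrimes rs hrs hmem hQ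
      have h3 : ringKrullDim (R ⧸ Q) ≤ Module.supportDim R (QuotSMulTop x M) := by
        rw [Module.supportDim_eq_ringKrullDim_quotient_annihilator]
        have h7 : (⟨Q, hQ.isPrime⟩ : PrimeSpectrum R) ∈ Module.support R (QuotSMulTop x M) := by
          rw [Module.support_quotSMulTop]
          refine ⟨Module.mem_support_iff_of_finite.2
            (le_of_eq_of_le Submodule.annihilator_top.symm hQ.annihilator_le), ?_⟩
          simpa using hxQ
        exact ringKrullDim_le_of_surjective
          (Ideal.Quotient.factor (Module.mem_support_iff_of_finite.1 h7))
          (Ideal.Quotient.factor_surjective _)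
      have h4 := (h2.trans h3).trans hle
      rw [← hlen, List.length_cons] at h4
      have : fs.length + 1 ≤ fs.length := by exact_mod_cast h4
      omega
    obtain ⟨rs', hl', hm', hr'⟩ := exists_isRegular_quotSMulTop hxm hreg hrs hmem
      (n := fs.length) (by rw [← hlen, List.length_cons])
    have : Nontrivial (QuotSMulTop x M) := nontrivial_quotSMulTop_of_mem_maximalIdeal M hxm
    refine (isRegular_cons_iff M x fs).2 ⟨hreg, ih hr' hm' ?_ hl'.symm hfm' hf⟩
    have h5 := Module.supportDim_quotSMulTop_succ_eq_supportDim hreg hxm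
    rw [hdim, ← hlen, List.length_cons, Nat.cast_add, Nat.cast_one] at h5
    rw [hl']
    exact ENat.WithBot.add_one_cancel.1 h5

end CohenMacaulay

/-! ### Homogeneous systems of parameters in `F[M*]` -/

section Homogeneous

open RingTheory.Sequence

variable {F : Type*} [Field F] {M : Type*} [AddCommGroup M] [Module F M]

/-- The polynomial function `P` on `M*` is homogeneous of degree `m`. -/
def IsHomog (P : SymmetricAlgebra F M) (m : ℕ) : Prop :=
  ∀ (γ : Module.Dual F M) (s : F), evalAt (s • γ) P = s ^ m * evalAt γ P

theorem IsHomog.ι (x : M) : IsHomog (SymmetricAlgebra.ι F M x) 1 := fun γ s => by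
  rw [evalAt_ι, evalAt_ι, LinearMap.smul_apply, smul_eq_mul, pow_one]

theorem isHomog_coeff_gradeHom (P : SymmetricAlgebra F M) (m : ℕ) :
    IsHomog ((gradeHom P).coeff m) m := fun γ s => evalAt_smul_coeff_gradeHom γ s P m

theorem IsHomog.evalAt_zero {P : SymmetricAlgebra F M} {m : ℕ} (hP : IsHomog P m) (hm : m ≠ 0) :
    evalAt 0 P = 0 := by
  have := hP 0 0
  rwa [smul_zero, zero_pow hm, zero_mul] at this

theorem eval_one_gradeHom (P : SymmetricAlgebra F M) : (gradeHom P).eval 1 = P := by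
  have : ((aeval (1 : SymmetricAlgebra F M)).restrictScalars F).comp gradeHom =
      AlgHom.id F (SymmetricAlgebra F M) := by
    refine SymmetricAlgebra.algHom_ext (LinearMap.ext fun m => ?_)
    simp [gradeHom]
  have h := DFunLike.congr_fun this P
  rwa [AlgHom.comp_apply, AlgHom.restrictScalars_apply, coe_aeval_eq_eval] at h

section Infinite

variable [Infinite F] [FiniteDimensional F M]

theorem coeff_zero_gradeHom (P : SymmetricAlgebra F M) :
    (gradeHom P).coeff 0 = algebraMap F _ (evalAt 0 P) := by
  refine eq_of_evalAt_eq fun γ => ?_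
  rw [evalAt_coeff_gradeHom, coeff_zero_eq_eval_zero, eval_lineHom, zero_smul, AlgHom.commutes]
  rfl

theorem IsHomog.gradeHom_eq {P : SymmetricAlgebra F M} {m : ℕ} (hP : IsHomog P m) :
    gradeHom P = monomial m P := by
  ext n : 1
  refine eq_of_evalAt_eq fun γ => ?_
  have h : lineHom γ P = monomial m (evalAt γ P) := by
    refine Polynomial.funext fun s => ?_
    rw [eval_lineHom, hP, eval_monomial, mul_comm]
  rw [evalAt_coeff_gradeHom, h, coeff_monomial, coeff_monomial]
  split_ifs <;> simp

end Infinite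

/-- A polynomial whose constant term is a unit is not a zero divisor. -/
theorem eq_zero_of_mul_eq_zero_of_isUnit_coeff_zero {Q : Type*} [CommRing Q] {p q : Q[X]}
    (hp : IsUnit (p.coeff 0)) (h : p * q = 0) : q = 0 := by
  nontriviality Q
  by_contra hq
  have h1 := coeff_mul_natTrailingDegree_add_natTrailingDegree (p := p) (q := q)
  have h2 : p.trailingCoeff = p.coeff 0 := by
    rw [trailingCoeff, natTrailingDegree_eq_zero.2 (Or.inr hp.ne_zero)]
  rw [h, coeff_zero, h2, eq_comm, hp.mul_right_eq_zero, trailingCoeff_eq_zero] at h1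
  exact hq h1

/-- Multiplication by a function that does not vanish at the origin is injective modulo an ideal
generated by homogeneous functions. -/
theorem mem_span_of_mul_mem_span [Infinite F] [FiniteDimensional F M]
    {T : Set (SymmetricAlgebra F M)} (hT : ∀ t ∈ T, ∃ m, IsHomog t m)
    {u a : SymmetricAlgebra F M} (hu : evalAt 0 u ≠ 0) (h : u * a ∈ Ideal.span T) :
    a ∈ Ideal.span T := by
  set J := Ideal.span T
  -- the grading descends to the quotient by `J`; under `P ↦ P(s ·)` the function `u` becomes a
  -- polynomial in `s` whose constant term is a unit
  let φ : SymmetricAlgebra F M →+* (SymmetricAlgebra F M ⧸ J)[X] :=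
    (mapRingHom (Ideal.Quotient.mk J)).comp (gradeHom : SymmetricAlgebra F M →ₐ[F] _).toRingHom
  have hφ : ∀ P, φ P = (gradeHom P).map (Ideal.Quotient.mk J) := fun P => rfl
  have hJ : J ≤ RingHom.ker φ := by
    refine Ideal.span_le.2 fun t ht => ?_
    obtain ⟨m, hm⟩ := hT t ht
    change φ t = 0
    rw [hφ, hm.gradeHom_eq, map_monomial, Ideal.Quotient.eq_zero_iff_mem.2 (Ideal.subset_span ht),
      monomial_zero_right]
  have h1 : φ u * φ a = 0 := by rw [← map_mul]; exact hJ h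
  have h2 : φ a = 0 := by
    refine eq_zero_of_mul_eq_zero_of_isUnit_coeff_zero ?_ h1
    rw [hφ, coeff_map, coeff_zero_gradeHom]
    exact ((isUnit_iff_ne_zero.2 hu).map (algebraMap F _)).map (Ideal.Quotient.mk J)
  have h3 := congrArg (Polynomial.eval 1) h2
  rw [hφ, eval_zero, ← map_one (Ideal.Quotient.mk J), eval_map_apply, eval_one_gradeHom] at h3
  exact Ideal.Quotient.eq_zero_iff_mem.1 h3

theorem isNoetherianRing_symmetricAlgebra [FiniteDimensional F M] :
    IsNoetherianRing (SymmetricAlgebra F M) :=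
  isNoetherianRing_of_ringEquiv _
    (SymmetricAlgebra.equivMvPolynomial (Module.finBasis F M)).symm.toRingEquiv

/-- The variables form a regular sequence. -/
theorem isWeaklyRegular_X (F : Type*) [Field F] (n : ℕ) :
    IsWeaklyRegular (MvPolynomial (Fin n) F)
      (List.ofFn fun i => (MvPolynomial.X i : MvPolynomial (Fin n) F)) := by
  rw [isWeaklyRegular_iff]
  intro i hi
  have hi' : i < n := by rwa [List.length_ofFn] at hi
  have h1 : Ideal.ofList ((List.ofFn fun j => (MvPolynomial.X j : MvPolynomial (Fin n) F)).take i) =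
      Ideal.span (MvPolynomial.X '' {j : Fin n | (j : ℕ) < i}) := by
    rw [Ideal.ofList]
    congr 1
    ext P
    rw [Set.mem_ofPred_eq, List.mem_take_iff_getElem, Set.mem_image]
    constructor
    · rintro ⟨j, hj, rfl⟩
      rw [lt_min_iff, List.length_ofFn] at hj
      exact ⟨⟨j, hj.2⟩, hj.1, by rw [List.getElem_ofFn]⟩
    · rintro ⟨j, hj, rfl⟩
      refine ⟨j, ?_, by rw [List.getElem_ofFn]⟩
      rw [lt_min_iff, List.length_ofFn]
      exact ⟨hj, j.2⟩
  rw [smul_eq_mul, Ideal.mul_top, h1, isSMulRegular_quotient_iff_mem_of_smul_mem]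
  intro P hP
  rw [List.getElem_ofFn, smul_eq_mul, MvPolynomial.mem_ideal_span_X_image] at hP
  rw [MvPolynomial.mem_ideal_span_X_image]
  intro m hm
  obtain ⟨j, hj, hj'⟩ := hP (m + Finsupp.single ⟨i, hi'⟩ 1) (by
    rw [MvPolynomial.mem_support_iff] at hm ⊢
    rwa [mul_comm, MvPolynomial.coeff_mul_X])
  refine ⟨j, hj, ?_⟩
  have hne : (⟨i, hi'⟩ : Fin n) ≠ j := fun h => by
    have : (j : ℕ) < i := hj
    rw [← h] at this
    exact lt_irrefl _ this
  rwa [Finsupp.add_apply, Finsupp.single_eq_of_ne hne.symm, add_zero] at hj'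

theorem isWeaklyRegular_ι {n : ℕ} (b : Module.Basis (Fin n) F M) :
    IsWeaklyRegular (SymmetricAlgebra F M)
      (List.ofFn fun i => SymmetricAlgebra.ι F M (b i)) := by
  refine (AddEquiv.isWeaklyRegular_congr
    (e := (SymmetricAlgebra.equivMvPolynomial b).symm.toRingEquiv.toAddEquiv) ?_).1
      (isWeaklyRegular_X F n)
  rw [List.forall₂_iff_get]
  refine ⟨by simp, fun i h1 h2 P => ?_⟩
  simp only [List.get_eq_getElem, List.getElem_ofFn, smul_eq_mul]
  change (SymmetricAlgebra.equivMvPolynomial b).symm (_ * P) =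
    _ * (SymmetricAlgebra.equivMvPolynomial b).symm P
  rw [map_mul, SymmetricAlgebra.equivMvPolynomial_symm_X]

theorem evalAt_eq_eval {n : Type*} [Finite n] (b : Module.Basis n F M) (γ : Module.Dual F M)
    (P : SymmetricAlgebra F M) :
    evalAt γ P =
      MvPolynomial.eval (fun i => γ (b i)) (SymmetricAlgebra.equivMvPolynomial b P) := by
  have : evalAt γ = (MvPolynomial.aeval fun i => γ (b i)).comp
      (SymmetricAlgebra.equivMvPolynomial b).toAlgHom := by
    refine SymmetricAlgebra.algHom_ext (b.ext fun i => ?_)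
    change evalAt γ (SymmetricAlgebra.ι F M (b i)) = MvPolynomial.aeval (fun i => γ (b i))
      (SymmetricAlgebra.equivMvPolynomial b (SymmetricAlgebra.ι F M (b i)))
    rw [evalAt_ι, SymmetricAlgebra.equivMvPolynomial_ι_apply, MvPolynomial.aeval_X]
  rw [this]
  exact congrFun (MvPolynomial.aeval_eq_eval _) _

/-- Hilbert's Nullstellensatz on `M*`. -/
theorem mem_radical_of_evalAt_eq_zero [IsAlgClosed F] [FiniteDimensional F M]
    {I : Ideal (SymmetricAlgebra F M)} {P : SymmetricAlgebra F M}
    (h : ∀ γ : Module.Dual F M, (∀ Q ∈ I, evalAt γ Q = 0) → evalAt γ P = 0) :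
    P ∈ I.radical := by
  let b := Module.finBasis F M
  let φ := SymmetricAlgebra.equivMvPolynomial b
  have h1 : φ P ∈ (I.comap (φ.symm : _ →+* SymmetricAlgebra F M)).radical := by
    rw [← MvPolynomial.vanishingIdeal_zeroLocus_eq_radical (K := F),
      MvPolynomial.mem_vanishingIdeal_iff]
    intro x hx
    have key : ∀ R, MvPolynomial.aeval x (φ R) = evalAt (b.constr F x) R := fun R => by
      rw [evalAt_eq_eval b]
      simp only [Module.Basis.constr_basis]
      exact congrFun (MvPolynomial.aeval_eq_eval _) _
    rw [key]
    refine h _ fun Q hQ => ?_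
    rw [← key]
    refine (MvPolynomial.mem_zeroLocus_iff.1 hx) _ ?_
    rw [Ideal.mem_comap]
    change φ.symm (φ Q) ∈ I
    rwa [AlgEquiv.symm_apply_apply]
  rw [← Ideal.comap_radical, Ideal.mem_comap] at h1
  change φ.symm (φ P) ∈ _ at h1
  rwa [AlgEquiv.symm_apply_apply] at h1

/-- The maximal ideal of the origin of `M*`. -/
def originIdeal (F M : Type*) [Field F] [AddCommGroup M] [Module F M] :
    Ideal (SymmetricAlgebra F M) :=
  RingHom.ker (evalAt (0 : Module.Dual F M))

instance : (originIdeal F M).IsMaximal :=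
  RingHom.ker_isMaximal_of_surjective _ fun c => ⟨algebraMap F _ c, AlgHom.commutes _ c⟩

theorem mem_originIdeal {P : SymmetricAlgebra F M} : P ∈ originIdeal F M ↔ evalAt 0 P = 0 :=
  Iff.rfl

theorem ofList_ι_eq_originIdeal [Infinite F] [FiniteDimensional F M] {n : ℕ}
    (b : Module.Basis (Fin n) F M) :
    Ideal.ofList (List.ofFn fun i => SymmetricAlgebra.ι F M (b i)) = originIdeal F M := by
  refine le_antisymm (Ideal.span_le.2 ?_) fun P hP => ?_
  · intro P hP
    rw [Set.mem_ofPred_eq, List.mem_ofFn] at hP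
    obtain ⟨i, rfl⟩ := hP
    exact (IsHomog.ι _).evalAt_zero one_ne_zero
  · let φ := SymmetricAlgebra.equivMvPolynomial b
    have h1 : φ P ∈ Ideal.span (MvPolynomial.X '' (Set.univ : Set (Fin n))) := by
      rw [MvPolynomial.mem_ideal_span_X_image]
      intro m hm
      by_contra! hcon
      have hm0 : m = 0 := Finsupp.ext fun i => hcon i trivial
      rw [mem_originIdeal, evalAt_eq_eval b] at hP
      rw [hm0, MvPolynomial.mem_support_iff] at hm
      apply hm
      rw [← MvPolynomial.constantCoeff_eq, ← MvPolynomial.eval_zero]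
      exact hP
    have h2 := Ideal.mem_map_of_mem (φ.symm : _ →+* SymmetricAlgebra F M) h1
    rw [Ideal.map_span] at h2
    have h3 : (φ.symm : _ →+* SymmetricAlgebra F M) (φ P) = P := φ.symm_apply_apply P
    rw [h3] at h2
    refine Ideal.span_mono ?_ h2
    rintro _ ⟨_, ⟨i, -, rfl⟩, rfl⟩
    rw [Set.mem_ofPred_eq, List.mem_ofFn]
    exact ⟨i, (SymmetricAlgebra.equivMvPolynomial_symm_X b i).symm⟩

open IsLocalRing in
/-- As many homogeneous functions of positive degree as the dimension, with the origin as their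
only common zero, form a weakly regular sequence: this holds in the local ring of the origin, which
is Cohen–Macaulay, and can be checked there by homogeneity. -/
theorem isWeaklyRegular_of_common_zero [IsAlgClosed F] [FiniteDimensional F M]
    {fs : List (SymmetricAlgebra F M)} (hhom : ∀ P ∈ fs, ∃ m ≠ 0, IsHomog P m)
    (hlen : fs.length = Module.finrank F M)
    (hzero : ∀ γ : Module.Dual F M, (∀ P ∈ fs, evalAt γ P = 0) → γ = 0) :
    IsWeaklyRegular (SymmetricAlgebra F M) fs := by
  have := isNoetherianRing_symmetricAlgebra (F := F) (M := M)
  let R := Localization.AtPrime (originIdeal F M)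
  let b := Module.finBasis F M
  have hmem : ∀ P ∈ fs, P ∈ originIdeal F M := fun P hP => by
    obtain ⟨m, hm, h⟩ := hhom P hP
    exact h.evalAt_zero hm
  have hmax : ∀ {l : List (SymmetricAlgebra F M)}, (∀ P ∈ l, P ∈ originIdeal F M) →
      ∀ r ∈ l.map (algebraMap _ R), r ∈ maximalIdeal R := fun {l} hl r hr => by
    obtain ⟨P, hP, rfl⟩ := List.mem_map.1 hr
    exact (IsLocalization.AtPrime.to_map_mem_maximal_iff R (originIdeal F M) P).2 (hl P hP)
  have hxs : ∀ P ∈ List.ofFn fun i => SymmetricAlgebra.ι F M (b i), P ∈ originIdeal F M := by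
    intro P hP
    obtain ⟨i, rfl⟩ := List.mem_ofFn.1 hP
    exact (IsHomog.ι _).evalAt_zero one_ne_zero
  have hreg : IsRegular R ((List.ofFn fun i => SymmetricAlgebra.ι F M (b i)).map
      (algebraMap _ R)) :=
    (isWeaklyRegular_ι b).isRegular_of_isLocalization_of_mem R (originIdeal F M) hxs
  -- the local ring has a regular sequence of coordinates, and its dimension is their number
  have hdim : ringKrullDim R = Module.finrank F M := by
    rw [← ringKrullDim_add_length_eq_ringKrullDim_of_isRegular _ hreg, ← Ideal.map_ofList,
      ofList_ι_eq_originIdeal, Localization.AtPrime.map_eq_maximalIdeal, List.length_map,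
      List.length_ofFn]
    have hres : ringKrullDim (R ⧸ maximalIdeal R) = 0 :=
      ringKrullDim_eq_zero_of_field (ResidueField R)
    exact (congrArg (· + _) hres).trans (zero_add _)
  -- by the Nullstellensatz, the maximal ideal is the only prime ideal of the local ring that
  -- contains `fs`
  have hR : Module.supportDim R (R ⧸ Ideal.ofList (fs.map (algebraMap _ R)) • (⊤ : Ideal R)) ≤ 0 := by
    rw [smul_eq_mul, Ideal.mul_top, Module.supportDim_quotient_eq_ringKrullDim, ringKrullDim_quotient]
    have hle : maximalIdeal R ≤ (Ideal.ofList (fs.map (algebraMap _ R))).radical := by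
      rw [← Localization.AtPrime.map_eq_maximalIdeal, ← Ideal.map_ofList]
      refine (Ideal.map_mono fun P hP => ?_).trans (Ideal.map_radical_le _)
      refine mem_radical_of_evalAt_eq_zero fun γ hγ => ?_
      rw [hzero γ fun Q hQ => hγ Q (Ideal.subset_span hQ)]
      exact hP
    have : Subsingleton (PrimeSpectrum.zeroLocus
        (Ideal.ofList (fs.map (algebraMap _ R)) : Set R)) := by
      have key : ∀ p ∈ PrimeSpectrum.zeroLocus
          (Ideal.ofList (fs.map (algebraMap _ R)) : Set R), p.asIdeal = maximalIdeal R := by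
        intro p hp
        refine ((maximalIdeal.isMaximal R).eq_of_le p.isPrime.ne_top (hle.trans ?_)).symm
        exact p.isPrime.radical_le_iff.2 hp
      exact ⟨fun p q => Subtype.ext (PrimeSpectrum.ext ((key _ p.2).trans (key _ q.2).symm))⟩
    exact Order.krullDim_nonpos_of_subsingleton
  have hfR : IsRegular R (fs.map (algebraMap _ R)) :=
    isRegular_of_supportDim_quotient_eq_zero _ hreg (hmax hxs)
      (by rw [Module.supportDim_self_eq_ringKrullDim, hdim, List.length_map, List.length_ofFn])
      (by rw [List.length_map, List.length_map, List.length_ofFn, hlen]) (hmax hmem) hR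
  -- membership in the ideals generated by the initial segments of `fs` descends from the
  -- localisation
  rw [isWeaklyRegular_iff]
  intro i hi
  rw [smul_eq_mul, Ideal.mul_top, isSMulRegular_quotient_iff_mem_of_smul_mem]
  intro a ha
  have h1 := hfR.regular_mod_prev i (by rwa [List.length_map])
  rw [smul_eq_mul, Ideal.mul_top, isSMulRegular_quotient_iff_mem_of_smul_mem, ← List.map_take,
    ← Ideal.map_ofList] at h1
  have h2 := h1 (algebraMap _ R a) (by
    rw [List.getElem_map, smul_eq_mul, ← map_mul]
    exact Ideal.mem_map_of_mem _ ha)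
  rw [IsLocalization.algebraMap_mem_map_algebraMap_iff (originIdeal F M).primeCompl] at h2
  obtain ⟨u, hu, hua⟩ := h2
  refine mem_span_of_mul_mem_span (fun t ht => ?_) hu hua
  obtain ⟨m, -, hm⟩ := hhom t (List.mem_of_mem_take ht)
  exact ⟨m, hm⟩

end Homogeneous

/-! ### Heights of minimal primes and irreducible components -/

section Components

open RingTheory.Sequence IsLocalRing

/-- Krull's height theorem bounds the height from above; as `fs` remains regular in the local ring
at `P`, its length bounds the height from below. -/
theorem height_eq_length_of_isWeaklyRegular {A : Type*} [CommRing A] [IsNoetherianRing A]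
    {fs : List A} (hfs : IsWeaklyRegular A fs) {P : Ideal A}
    (hP : P ∈ (Ideal.ofList fs).minimalPrimes) : P.height = fs.length := by
  classical
  have hPp : P.IsPrime := hP.1.1
  refine le_antisymm ?_ ?_
  · have hP' : P ∈ (Ideal.span (fs.toFinset : Set A)).minimalPrimes := by
      rw [List.coe_toFinset]; exact hP
    refine (Ideal.height_le_card_of_mem_minimalPrimes_span_finset hP').trans ?_
    exact_mod_cast List.toFinset_card_le fs
  · have hreg := hfs.isRegular_of_isLocalization_of_mem (Localization.AtPrime P) P
      fun r hr => hP.1.2 (Ideal.subset_span hr)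
    have h1 := ringKrullDim_add_length_eq_ringKrullDim_of_isRegular _ hreg
    rw [IsLocalization.AtPrime.ringKrullDim_eq_height P (Localization.AtPrime P), List.length_map] at h1
    have : Nontrivial (Localization.AtPrime P ⧸
        Ideal.ofList (fs.map (algebraMap A (Localization.AtPrime P)))) := by
      refine Ideal.Quotient.nontrivial_iff.2 fun h => hreg.top_ne_smul ?_
      rw [h, smul_eq_mul, Ideal.mul_top]
    have h2 : (0 : WithBot ℕ∞) + fs.length ≤ P.height :=
      (add_le_add_left ringKrullDim_nonneg_of_nontrivial _).trans h1.le
    rw [zero_add] at h2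
    exact_mod_cast h2

variable {F : Type*} [Field F] {M : Type*} [AddCommGroup M] [Module F M]

theorem mem_vanishingIdeal {Z : Set (Module.Dual F M)} {P : SymmetricAlgebra F M} :
    P ∈ vanishingIdeal Z ↔ ∀ γ ∈ Z, evalAt γ P = 0 := by
  simp [vanishingIdeal, RingHom.mem_ker]

/-- A set is irreducible in the Zariski topology if and only if its ideal is prime. -/
theorem isIrreducible_iff_isPrime_vanishingIdeal {Z : Set (Module.Dual F M)} :
    @IsIrreducible _ (zariskiTopology F M) Z ↔ (vanishingIdeal Z).IsPrime := by
  let := zariskiTopology F M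
  constructor
  · rintro ⟨⟨γ, hγ⟩, hZ⟩
    refine ⟨fun h => ?_, fun {P Q} hPQ => ?_⟩
    · have h1 : (1 : SymmetricAlgebra F M) ∈ vanishingIdeal Z := h ▸ Submodule.mem_top
      have := mem_vanishingIdeal.1 h1 γ hγ
      rw [map_one] at this
      exact one_ne_zero this
    · have hcl : ∀ P : SymmetricAlgebra F M, IsClosed {γ : Module.Dual F M | evalAt γ P = 0} :=
        fun P => (isClosed_zariski_iff _).2 ⟨{P}, by simp⟩
      have h := isPreirreducible_iff_isClosed_union_isClosed.1 hZ _ _ (hcl P) (hcl Q)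
        (fun γ hγ => by
          have := mem_vanishingIdeal.1 hPQ γ hγ
          rw [map_mul, mul_eq_zero] at this
          exact this)
      exact h.imp (fun h => mem_vanishingIdeal.2 h) fun h => mem_vanishingIdeal.2 h
  · intro hp
    refine ⟨?_, isPreirreducible_iff_isClosed_union_isClosed.2 ?_⟩
    · by_contra hne
      rw [Set.not_nonempty_iff_eq_empty] at hne
      exact hp.ne_top ((Ideal.eq_top_iff_one _).2 (mem_vanishingIdeal.2 (by simp [hne])))
    · intro Z1 Z2 h1 h2 hZ
      obtain ⟨s1, rfl⟩ := (isClosed_zariski_iff _).1 h1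
      obtain ⟨s2, rfl⟩ := (isClosed_zariski_iff _).1 h2
      by_contra! hcon
      obtain ⟨⟨γ1, hγ1, hn1⟩, ⟨γ2, hγ2, hn2⟩⟩ :=
        And.imp Set.not_subset.1 Set.not_subset.1 hcon
      simp only [Set.mem_ofPred_eq, not_forall] at hn1 hn2
      obtain ⟨P, hP, hP'⟩ := hn1
      obtain ⟨Q, hQ, hQ'⟩ := hn2
      have hPQ : P * Q ∈ vanishingIdeal Z := mem_vanishingIdeal.2 fun γ hγ => by
        rw [map_mul, mul_eq_zero]
        exact (hZ hγ).imp (fun h => h P hP) fun h => h Q hQ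
      rcases hp.mem_or_mem hPQ with h | h
      · exact hP' (mem_vanishingIdeal.1 h γ1 hγ1)
      · exact hQ' (mem_vanishingIdeal.1 h γ2 hγ2)

/-- By the Nullstellensatz, the components of a zero set correspond to minimal primes of its ideal.
-/
theorem vanishingIdeal_mem_minimalPrimes [IsAlgClosed F] [FiniteDimensional F M]
    {I : Ideal (SymmetricAlgebra F M)} {Z : Set (Module.Dual F M)}
    (hZ : Z ∈ components {γ : Module.Dual F M | ∀ P ∈ I, evalAt γ P = 0}) :
    vanishingIdeal Z ∈ I.minimalPrimes := by
  obtain ⟨⟨h1, h2⟩, h3⟩ := hZ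
  refine ⟨⟨isIrreducible_iff_isPrime_vanishingIdeal.1 h1,
    fun P hP => mem_vanishingIdeal.2 fun γ hγ => h2 hγ P hP⟩, fun Q ⟨hQ, hIQ⟩ hle => ?_⟩
  have hQv : vanishingIdeal {γ : Module.Dual F M | ∀ P ∈ Q, evalAt γ P = 0} = Q := by
    refine le_antisymm (fun P hP => ?_) fun P hP => mem_vanishingIdeal.2 fun γ hγ => hγ P hP
    rw [← hQ.radical]
    exact mem_radical_of_evalAt_eq_zero fun γ hγ => mem_vanishingIdeal.1 hP γ hγ
  have h4 : {γ : Module.Dual F M | ∀ P ∈ Q, evalAt γ P = 0} ⊆ Z :=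
    h3 ⟨isIrreducible_iff_isPrime_vanishingIdeal.2 (hQv.symm ▸ hQ), fun γ hγ P hP => hγ P (hIQ hP)⟩
      fun γ hγ P hP => mem_vanishingIdeal.1 (hle hP) γ hγ
  rw [← hQv]
  exact fun P hP => mem_vanishingIdeal.2 fun γ hγ => mem_vanishingIdeal.1 hP γ (h4 hγ)

/-- The components of the common zero set of a weakly regular sequence have the expected
codimension. -/
theorem codim_eq_length_of_isWeaklyRegular [IsAlgClosed F] [FiniteDimensional F M]
    {fs : List (SymmetricAlgebra F M)} (hfs : IsWeaklyRegular (SymmetricAlgebra F M) fs)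
    {Z : Set (Module.Dual F M)}
    (hZ : Z ∈ components {γ : Module.Dual F M | ∀ P ∈ fs, evalAt γ P = 0}) :
    codim Z = fs.length := by
  have := isNoetherianRing_symmetricAlgebra (F := F) (M := M)
  have h : {γ : Module.Dual F M | ∀ P ∈ fs, evalAt γ P = 0} =
      {γ : Module.Dual F M | ∀ P ∈ Ideal.ofList fs, evalAt γ P = 0} := by
    ext γ
    refine ⟨fun hγ P hP => ?_, fun hγ P hP => hγ P (Ideal.subset_span hP)⟩
    have : Ideal.ofList fs ≤ RingHom.ker (evalAt γ) := Ideal.span_le.2 hγ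
    exact this hP
  rw [h] at hZ
  exact height_eq_length_of_isWeaklyRegular hfs (vanishingIdeal_mem_minimalPrimes hZ)

/-- A subspace of `M*` of dimension `r` is cut out by `dim M - r` linear functions. -/
theorem exists_forms_of_finrank (W : Submodule F (Module.Dual F M)) [FiniteDimensional F M] {r : ℕ}
    (hW : Module.finrank F W = r) : ∃ l : List M, l.length + r = Module.finrank F M ∧
      ∀ γ : Module.Dual F M, (∀ x ∈ l, γ x = 0) → γ ∈ W := by
  let b := Module.finBasis F W.dualCoannihilator
  refine ⟨List.ofFn fun i => (b i : M), ?_, fun γ hγ => ?_⟩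
  · rw [List.length_ofFn, ← hW, add_comm]
    exact Subspace.finrank_add_finrank_dualCoannihilator_eq W
  · rw [← Subspace.dualCoannihilator_dualAnnihilator_eq (W := W), Submodule.mem_dualAnnihilator]
    have h1 : γ ∘ₗ W.dualCoannihilator.subtype = 0 := b.ext fun i => hγ _ (List.mem_ofFn.2 ⟨i, rfl⟩)
    exact fun x hx => LinearMap.congr_fun h1 ⟨x, hx⟩

/-- If homogeneous functions of positive degree have the origin as their only common zero on a
subspace of `M*` whose dimension is their number, then they form a regular sequence. -/
theorem isRegular_of_disjoint_subspace [IsAlgClosed F] [FiniteDimensional F M]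
    {fs : List (SymmetricAlgebra F M)} (hhom : ∀ P ∈ fs, ∃ m ≠ 0, IsHomog P m)
    {W : Submodule F (Module.Dual F M)} (hW : Module.finrank F W = fs.length)
    (hzero : ∀ γ ∈ W, (∀ P ∈ fs, evalAt γ P = 0) → γ = 0) :
    IsRegular (SymmetricAlgebra F M) fs := by
  obtain ⟨l, hl, hlW⟩ := exists_forms_of_finrank W hW
  have h := isWeaklyRegular_of_common_zero (fs := fs ++ l.map (SymmetricAlgebra.ι F M)) (by
      intro P hP
      rcases List.mem_append.1 hP with h | h
      · exact hhom P h
      · obtain ⟨x, -, rfl⟩ := List.mem_map.1 h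
        exact ⟨1, one_ne_zero, IsHomog.ι x⟩)
    (by rw [List.length_append, List.length_map, add_comm, hl]) fun γ hγ =>
      hzero γ (hlW γ fun x hx => by
        rw [← evalAt_ι]
        exact hγ _ (List.mem_append_right _ (List.mem_map_of_mem hx)))
        fun P hP => hγ P (List.mem_append_left _ hP)
  refine ⟨((isWeaklyRegular_append_iff _ _ _).1 h).1, fun htop => ?_⟩
  rw [smul_eq_mul, Ideal.mul_top] at htop
  have hle : Ideal.ofList fs ≤ originIdeal F M := Ideal.span_le.2 fun P hP => by
    obtain ⟨m, hm, h⟩ := hhom P hP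
    exact h.evalAt_zero hm
  rw [← htop, top_le_iff] at hle
  exact (inferInstance : (originIdeal F M).IsMaximal).ne_top hle

end Components

/-! ### The index of the centraliser -/

section Index

/-- The nearest-neighbour pairing `0 ↔ 1`, `2 ↔ 3`, … of the blocks; if their number is odd, then
the last one is its own partner. -/
def partner {k : ℕ} (i : Fin k) : Fin k :=
  if (i : ℕ) % 2 = 1 then ⟨i - 1, by omega⟩
  else if h : (i : ℕ) + 1 < k then ⟨i + 1, h⟩ else i

theorem partner_of_odd {k : ℕ} {i : Fin k} (h : (i : ℕ) % 2 = 1) :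
    (partner i : ℕ) = i - 1 := by rw [partner, if_pos h]

theorem partner_of_even {k : ℕ} {i : Fin k} (h : (i : ℕ) % 2 = 0) (h' : (i : ℕ) + 1 < k) :
    (partner i : ℕ) = i + 1 := by rw [partner, if_neg (by omega), dif_pos h']

theorem partner_of_last {k : ℕ} {i : Fin k} (h : (i : ℕ) % 2 = 0) (h' : k ≤ (i : ℕ) + 1) :
    partner i = i := by rw [partner, if_neg (by omega), dif_neg (by omega)]

theorem partner_cases {k : ℕ} (i : Fin k) :
    ((i : ℕ) % 2 = 1 ∧ (partner i : ℕ) = i - 1) ∨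
    ((i : ℕ) % 2 = 0 ∧ (i : ℕ) + 1 < k ∧ (partner i : ℕ) = i + 1) ∨
    ((i : ℕ) % 2 = 0 ∧ k ≤ (i : ℕ) + 1 ∧ (partner i : ℕ) = i) := by
  rcases Nat.mod_two_eq_zero_or_one i with h | h
  · by_cases h' : (i : ℕ) + 1 < k
    · exact Or.inr (Or.inl ⟨h, h', partner_of_even h h'⟩)
    · exact Or.inr (Or.inr ⟨h, by omega, by rw [partner_of_last h (by omega)]⟩)
  · exact Or.inl ⟨h, partner_of_odd h⟩

theorem partner_partner {k : ℕ} (i : Fin k) : partner (partner i) = i := by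
  have h1 := partner_cases i
  have h2 := partner_cases (partner i)
  have := i.2
  apply Fin.ext
  omega

variable {F : Type*} [Field F]

/-- The coefficients of the generic linear form on the centraliser: `j + 1` and `-τ (j + 1)` on the
`j`-th pair of blocks, and `0` on an unpaired block. -/
def pairCoeff (τ : F) {k : ℕ} (i : Fin k) : F :=
  if (i : ℕ) % 2 = 1 then ((i / 2 + 1 : ℕ) : F)
  else if (i : ℕ) + 1 < k then -τ * ((i / 2 + 1 : ℕ) : F) else 0

theorem pairCoeff_partner {τ : F} (hτ : τ * τ = 1) {k : ℕ} (i : Fin k) :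
    pairCoeff τ (partner i) = -τ * pairCoeff τ i := by
  rcases partner_cases i with ⟨h, h'⟩ | ⟨h, h1, h'⟩ | ⟨h, h1, h'⟩
  · have := i.2
    rw [pairCoeff, pairCoeff, h', if_neg (by omega), if_pos (by omega), if_pos h,
      show ((i : ℕ) - 1) / 2 = i / 2 by omega]
  · rw [pairCoeff, pairCoeff, h', if_pos (by omega), if_neg (by omega), if_pos h1,
      show ((i : ℕ) + 1) / 2 = i / 2 by omega]
    linear_combination (-((i / 2 + 1 : ℕ) : F)) * hτ
  · rw [Fin.ext h', pairCoeff, if_neg (by omega), if_neg (by omega), mul_zero]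

/-- The squares of the coefficients are distinct for different pairs, and also distinct from that of
an unpaired block. -/
theorem pairCoeff_sq {τ : F} (hτ : τ * τ = 1) {k : ℕ} (i : Fin k) :
    pairCoeff τ i ^ 2 = ((i / 2 + 1 : ℕ) : F) ^ 2 ∨
      (pairCoeff τ i = 0 ∧ (i : ℕ) % 2 = 0 ∧ k ≤ (i : ℕ) + 1) := by
  rw [pairCoeff]
  split_ifs with h1 h2
  · exact Or.inl rfl
  · exact Or.inl (by linear_combination ((i / 2 + 1 : ℕ) : F) ^ 2 * hτ)
  · exact Or.inr ⟨rfl, by omega, by omega⟩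

/-- The relations satisfied by an element of the stabiliser force its component between two
different pairs of blocks to vanish: moving around twice multiplies it by a scalar other
than `1` and shifts it in the direction where it is eventually zero. -/
theorem eq_zero_of_pair_relations {k : ℕ} {d : Fin k → ℕ} {σ : Fin k → Fin k} {α : Fin k → F}
    {κ : F} (hκ : κ ≠ 0) (hσ : ∀ i, σ (σ i) = i) (hα : ∀ i, α (σ i) = κ * α i)
    {Y : Fin k → Fin k → ℕ → F} (hY : ∀ a b t, d a < t → Y a b t = 0)
    (hE : ∀ a b s t, s + d a = t + d (σ b) → α a * Y (σ a) (σ b) s = α b * Y a b t)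
    {a b : Fin k} (h1 : d b ≤ d (σ a)) (h2 : d (σ b) ≤ d a) (h0 : α a ≠ 0)
    (hne : α a ^ 2 ≠ α b ^ 2) (v : ℕ) : Y a b v = 0 := by
  -- apply the relation twice: from `(a, b)` to `(σ a, σ b)` and back
  have key : ∀ v, α a ^ 2 * Y a b v =
      α b ^ 2 * Y a b (v + (d (σ a) - d b) + (d a - d (σ b))) := fun v => by
    have e1 := hE (σ a) (σ b) v (v + (d (σ a) - d b)) (by rw [hσ]; omega)
    have e2 := hE a b (v + (d (σ a) - d b)) (v + (d (σ a) - d b) + (d a - d (σ b))) (by omega)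
    rw [hσ, hσ, hα, hα] at e1
    apply mul_left_cancel₀ hκ
    linear_combination α a * e1 + κ * α b * e2
  have hall : ∀ n v, d a < v + n → Y a b v = 0 := by
    intro n
    induction n with
    | zero => exact fun v hv => hY a b v (by simpa using hv)
    | succ n ih =>
      intro v hv
      have hk := key v
      rcases Nat.eq_zero_or_pos (d (σ a) - d b + (d a - d (σ b))) with hc | hc
      · rw [show v + (d (σ a) - d b) + (d a - d (σ b)) = v by omega] at hk
        have : (α a ^ 2 - α b ^ 2) * Y a b v = 0 := by linear_combination hk
        exact (mul_eq_zero.1 this).resolve_left (sub_ne_zero.2 hne)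
      · rw [ih (v + (d (σ a) - d b) + (d a - d (σ b))) (by omega), mul_zero] at hk
        exact (mul_eq_zero.1 hk).resolve_left (pow_ne_zero 2 h0)
  exact hall (d a + 1) v (by omega)

variable {V : Type*} [AddCommGroup V] [Module F V]
  {B : LinearMap.BilinForm F V} {e : Module.End F V} {k p : ℕ} {d : Fin k → ℕ} {w : Fin k → V}

/-- The product of `ξ_a^{c,s} v` with `w_c` is that of `e ^ t v` with `w_a`, where
`t = s + d_a - d_c`; there is no sign as all `d_i` have the same parity. -/
theorem IsAdapted.form_xi (hw : IsAdapted B e d w) (hp : ∀ i, d i % 2 = p)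
    (he : ∀ v w, B (e v) w = -B v (e w)) {a c : Fin k} {s t : ℕ} (h : s + d a = t + d c) (v : V) :
    B (hw.1.xi a c s v) (w c) = B ((e ^ t) v) (w a) := by
  have hle : d c ≤ s + d a := by omega
  suffices h : (B.flip (w c)) ∘ₗ hw.1.xi a c s = (B.flip (w a)) ∘ₗ (e ^ t) from
    LinearMap.congr_fun h v
  refine hw.1.basis.ext fun x => ?_
  rw [hw.1.basis_apply]
  change B (hw.1.xi a c s ((e ^ (x.2 : ℕ)) (w x.1))) (w c) =
    B ((e ^ t) ((e ^ (x.2 : ℕ)) (w x.1))) (w a)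
  generalize (x.2 : ℕ) = m
  generalize x.1 = j
  rw [← Module.End.mul_apply (e ^ t), ← pow_add]
  have hf := hw.form_pow he
  have h1 := hf c c (m + s) 0
  have h2 := hf j a (t + m) 0
  rw [pow_zero, Module.End.one_apply] at h1 h2
  rw [h2]
  by_cases hj : j = a
  · rw [hj, hw.1.xi_pow_same hle, h1]
    by_cases h3 : m + s + 0 = d c
    · rw [if_pos ⟨rfl, h3⟩, if_pos ⟨rfl, by omega⟩, neg_one_pow_eq_pow_mod_two,
        neg_one_pow_eq_pow_mod_two (n := t + _)]
      have := hp a; have := hp c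
      congr 1
      omega
    · rw [if_neg fun h => h3 h.2, if_neg fun h => h3 (by omega)]
  · rw [hw.1.xi_pow_of_ne hle _ hj, map_zero, LinearMap.zero_apply, if_neg fun h => hj h.1]

/-- The generic linear form `y ↦ ∑ α_i (y w_i, w_i')`. -/
def pairForm (B : LinearMap.BilinForm F V) (τ : F) (w : Fin k → V) :
    Module.Dual F (Module.End F V) :=
  ∑ i, pairCoeff τ i • (B.flip (w (partner i))) ∘ₗ (LinearMap.applyₗ (w i))

theorem pairForm_apply (τ : F) (y : Module.End F V) :
    pairForm B τ w y = ∑ i, pairCoeff τ i * B (y (w i)) (w (partner i)) := by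
  simp [pairForm]

theorem sum_comp_partner {A : Type*} [AddCommMonoid A] (f : Fin k → A) :
    ∑ i, f (partner i) = ∑ i, f i :=
  Fintype.sum_equiv (Function.Involutive.toPerm partner partner_partner) _ _ fun _ => rfl

theorem pairForm_selfAdjoint [CharZero F] {τ : F} (hτ : τ * τ = 1)
    (hBτ : ∀ v w, B v w = τ * B w v) {y : Module.End F V}
    (hy : ∀ v w, B (y v) w = B v (y w)) : pairForm B τ w y = 0 := by
  refine self_eq_neg.1 ?_
  rw [pairForm_apply, ← Finset.sum_neg_distrib]
  conv_lhs => rw [← sum_comp_partner]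
  refine Finset.sum_congr rfl fun i _ => ?_
  rw [pairCoeff_partner hτ, partner_partner, hy, hBτ]
  linear_combination (-pairCoeff τ i * B (y (w i)) (w (partner i))) * hτ

/-- The linear map `x ↦ (y ↦ ψ([x, y]))`, whose range is the tangent space at `ψ` to its coadjoint
orbit. -/
def coadjoint (B : LinearMap.BilinForm F V) (e : Module.End F V)
    (ψ : Module.Dual F (Module.End F V)) :
    centraliser B e →ₗ[F] Module.Dual F (centraliser B e) :=
  (((LinearMap.mul F (Module.End F V)) - (LinearMap.mul F (Module.End F V)).flip).compr₂
    ψ).domRestrict₁₂ (centraliser B e) (centraliser B e)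

theorem centraliser_le_glCentraliser : centraliser B e ≤ glCentraliser e := inf_le_right

variable {τ : F}

/-- An element of the stabiliser of `pairForm` is also orthogonal to the commutators with all of
the centraliser of `e` in `𝔤𝔩(V)`. -/
theorem pairForm_commutator [CharZero F] [FiniteDimensional F V] (hB : B.Nondegenerate)
    (hτ : τ * τ = 1) (hBτ : ∀ v w, B v w = τ * B w v) (he : ∀ v w, B (e v) w = -B v (e w))
    {x : centraliser B e} (hx : coadjoint B e (pairForm B τ w) x = 0) {y : Module.End F V}
    (hy : y ∈ glCentraliser e) : pairForm B τ w (x.1 * y - y * x.1) = 0 := by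
  have h := eq_on_glCentraliser hB hBτ he
    (φ := pairForm B τ w ∘ₗ (LinearMap.mulLeft F x.1 - LinearMap.mulRight F x.1)) (ψ := 0)
    (fun z hz => LinearMap.congr_fun hx ⟨z, hz⟩) (fun z _ hz => ?_) y hy
  · exact h
  · have hxs := (mem_centraliser.1 x.2).1
    refine pairForm_selfAdjoint hτ hBτ fun v w => ?_
    change B (x.1 (z v) - z (x.1 v)) w = B v (x.1 (z w) - z (x.1 w))
    rw [map_sub, LinearMap.sub_apply, map_sub, hxs, hz, hz, hxs]
    ring

/-- The coordinates `(e ^ t x w_b, w_a)` of `x`. -/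
def blockCoord (B : LinearMap.BilinForm F V) (e : Module.End F V) (w : Fin k → V)
    (a b : Fin k) (t : ℕ) : Module.End F V →ₗ[F] F :=
  (B.flip (w a)) ∘ₗ (e ^ t) ∘ₗ (LinearMap.applyₗ (w b))

theorem blockCoord_apply (a b : Fin k) (t : ℕ) (x : Module.End F V) :
    blockCoord B e w a b t x = B ((e ^ t) (x (w b))) (w a) := rfl

theorem IsAdapted.blockCoord_eq_zero (hw : IsAdapted B e d w)
    (he : ∀ v w, B (e v) w = -B v (e w)) (x : Module.End F V) {a : Fin k} (b : Fin k) {t : ℕ}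
    (h : d a < t) : blockCoord B e w a b t x = 0 := by
  rw [blockCoord_apply, form_pow_left he, hw.1.pow_eq_zero h, map_zero, mul_zero]

theorem blockCoord_swap (he : ∀ v w, B (e v) w = -B v (e w)) (hBτ : ∀ v w, B v w = τ * B w v)
    {x : Module.End F V} (hx : x ∈ centraliser B e) (a b : Fin k) (t : ℕ) :
    blockCoord B e w b a t x = -τ * (-1) ^ t * blockCoord B e w a b t x := by
  rw [blockCoord_apply, blockCoord_apply, form_pow_left he, (mem_centraliser.1 hx).1,
    pow_comm_of_mem (centraliser_le_glCentraliser hx), hBτ]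
  ring

/-- An element of the centraliser is determined by its coordinates. -/
theorem IsAdapted.eq_zero_of_blockCoord (hw : IsAdapted B e d w) (hB : B.Nondegenerate)
    (he : ∀ v w, B (e v) w = -B v (e w)) {x : Module.End F V}
    (hx : x ∈ glCentraliser e) (h : ∀ a b t, blockCoord B e w a b t x = 0) : x = 0 := by
  refine hw.1.ext hx (Submodule.zero_mem _) fun b => ?_
  refine hB.1 _ fun v => ?_
  suffices h : B (x (w b)) = 0 by rw [h, LinearMap.zero_apply]
  refine hw.1.basis.ext fun y => ?_
  have h1 := h y.1 b y.2
  rw [blockCoord_apply, form_pow_left he] at h1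
  rw [hw.1.basis_apply, LinearMap.zero_apply]
  exact (mul_eq_zero.1 h1).resolve_left (pow_ne_zero _ (neg_ne_zero.2 one_ne_zero))

/-- The coordinates of an element `x` of the stabiliser satisfy the relation expressing that
`pairForm` vanishes on its commutator with `ξ_a^{b',s}`, where `b'` is the partner of `b`. -/
theorem IsAdapted.blockCoord_relation [CharZero F] [FiniteDimensional F V]
    (hw : IsAdapted B e d w) (hp : ∀ i, d i % 2 = p) (hB : B.Nondegenerate)
    (hτ : τ * τ = 1) (hBτ : ∀ v w, B v w = τ * B w v) (he : ∀ v w, B (e v) w = -B v (e w))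
    {x : centraliser B e} (hx : coadjoint B e (pairForm B τ w) x = 0) {a b : Fin k} {s t : ℕ}
    (h : s + d a = t + d (partner b)) :
    pairCoeff τ a * blockCoord B e w (partner a) (partner b) s x.1 =
      pairCoeff τ b * blockCoord B e w a b t x.1 := by
  have hle : d (partner b) ≤ s + d a := by omega
  have h1 := pairForm_commutator hB hτ hBτ he hx (hw.1.xi_mem hle)
  rw [map_sub, sub_eq_zero, pairForm_apply, pairForm_apply, Finset.sum_eq_single a,
    Finset.sum_eq_single b] at h1
  · have h2 := hw.1.xi_pow_same hle 0
    rw [pow_zero, Module.End.one_apply, zero_add] at h2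
    rw [Module.End.mul_apply, Module.End.mul_apply, h2,
      pow_comm_of_mem (centraliser_le_glCentraliser x.2), hw.form_xi hp he h] at h1
    exact h1
  · intro j _ hj
    rw [Module.End.mul_apply]
    have hne : partner b ≠ partner j := fun h => hj (by
      rw [← partner_partner j, ← h, partner_partner])
    -- the image of `ξ_a^{b',s}` lies in the block of `b'`, orthogonal to `w_j'`
    have h2 : (B.flip (w (partner j))) ∘ₗ hw.1.xi a (partner b) s = 0 := by
      refine hw.1.basis.ext fun y => ?_
      rw [hw.1.basis_apply]
      change B (hw.1.xi a (partner b) s ((e ^ (y.2 : ℕ)) (w y.1))) (w (partner j)) = 0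
      generalize (y.2 : ℕ) = m
      generalize y.1 = i
      by_cases hy : i = a
      · rw [hy, hw.1.xi_pow_same hle]
        exact hw.2.1 _ _ hne _ 0
      · rw [hw.1.xi_pow_of_ne hle _ hy, map_zero, LinearMap.zero_apply]
    rw [show B (hw.1.xi a (partner b) s (x.1 (w j))) (w (partner j)) = 0 from
      LinearMap.congr_fun h2 _, mul_zero]
  · simp
  · intro j _ hj
    have h2 := hw.1.xi_pow_of_ne hle 0 hj
    rw [pow_zero, Module.End.one_apply] at h2
    rw [Module.End.mul_apply, h2, map_zero, map_zero, LinearMap.zero_apply, mul_zero]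
  · simp

/-- The number of free coordinates of the stabiliser in the `i`-th block of rows. -/
def stabCount (d : Fin k → ℕ) (i : Fin k) : ℕ :=
  if (i : ℕ) % 2 = 0 then (d i + 1) / 2 else d i / 2 + 1

/-- Two partners together contribute half of their total size; an unpaired block contributes half of
its size, rounded down. -/
theorem sum_stabCount_le (hp : ∀ i, d i % 2 = p) : ∑ i, stabCount d i ≤ (∑ i, (d i + 1)) / 2 := by
  rw [Nat.le_div_iff_mul_le two_pos]
  -- with an odd number of blocks of odd size, the last one contributes one less
  suffices h : (∑ i, stabCount d i) * 2 + (if k % 2 = 1 then 1 - p else 0) ≤ ∑ i, (d i + 1) from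
    (Nat.le_add_right _ _).trans h
  induction k with
  | zero => simp
  | succ k ih =>
    have h1 : (∑ i : Fin k, stabCount d i.castSucc) * 2 + (if k % 2 = 1 then 1 - p else 0) ≤
        ∑ i : Fin k, (d i.castSucc + 1) := ih (d := fun i => d i.castSucc) fun i => hp i.castSucc
    have h2 := hp (Fin.last k)
    have h4 : stabCount d (Fin.last k) =
      if k % 2 = 0 then (d (Fin.last k) + 1) / 2 else d (Fin.last k) / 2 + 1 := rfl
    rw [Fin.sum_univ_castSucc, Fin.sum_univ_castSucc, h4]
    split_ifs at h1 ⊢ <;> omega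

/-- The coordinates of `x` that determine it if it lies in the stabiliser of `pairForm`. -/
def stabCoord (B : LinearMap.BilinForm F V) (e : Module.End F V) (p : ℕ) (d : Fin k → ℕ)
    (w : Fin k → V) : Module.End F V →ₗ[F] (Σ i : Fin k, Fin (stabCount d i)) → F :=
  LinearMap.pi fun q => if (q.1 : ℕ) % 2 = 0 then blockCoord B e w q.1 q.1 (2 * q.2 + 1 - p)
    else blockCoord B e w q.1 (partner q.1) (2 * q.2)

/-- The relations between the coordinates leave only those in `stabCoord` free: coordinates between
different pairs vanish, and the two diagonal and off-diagonal families within a pair are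
proportional to each other. -/
theorem IsAdapted.eq_zero_of_stabCoord [CharZero F] [FiniteDimensional F V]
    (hw : IsAdapted B e d w) (hd : Antitone d) (hp : ∀ i, d i % 2 = p) (hB : B.Nondegenerate)
    (hBp : ∀ v w, B v w = (-1) ^ p * B w v) (he : ∀ v w, B (e v) w = -B v (e w))
    {x : centraliser B e} (hx : coadjoint B e (pairForm B ((-1) ^ p) w) x = 0)
    (h0 : stabCoord B e p d w x.1 = 0) : x = 0 := by
  have hτ : ((-1) ^ p * (-1) ^ p : F) = 1 := by rw [← mul_pow]; simp
  have hκ : (-(-1) ^ p : F) ≠ 0 := neg_ne_zero.2 (left_ne_zero_of_mul_eq_one hτ)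
  have hnat : ∀ i : ℕ, ((i + 1 : ℕ) : F) ≠ 0 := fun i => Nat.cast_ne_zero.2 i.succ_ne_zero
  set Y : Fin k → Fin k → ℕ → F := fun a b t => blockCoord B e w a b t x.1 with hYdef
  have hY : ∀ a b t, d a < t → Y a b t = 0 := fun a b t h => hw.blockCoord_eq_zero he x.1 b h
  have hE : ∀ a b s t, s + d a = t + d (partner b) →
      pairCoeff ((-1) ^ p) a * Y (partner a) (partner b) s = pairCoeff ((-1) ^ p) b * Y a b t :=
    fun a b s t h => hw.blockCoord_relation hp hB hτ hBp he hx h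
  have hS : ∀ a b t, Y b a t = -(-1) ^ p * (-1) ^ t * Y a b t := fun a b t =>
    blockCoord_swap he hBp x.2 a b t
  -- coordinates between different pairs
  have hc : ∀ a b : Fin k, (a : ℕ) < b → partner a ≠ b → ∀ t, Y a b t = 0 := by
    intro a b hab hne
    have h1 := partner_cases a
    have h2 := partner_cases b
    have h3 : (partner a : ℕ) ≠ b := fun h => hne (Fin.ext h)
    have := b.2
    have ha : pairCoeff ((-1 : F) ^ p) a ^ 2 = ((a / 2 + 1 : ℕ) : F) ^ 2 :=
      (pairCoeff_sq hτ a).resolve_right fun h => by omega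
    have ha0 : pairCoeff ((-1 : F) ^ p) a ≠ 0 := fun h => by
      rw [h, zero_pow two_ne_zero] at ha
      exact pow_ne_zero 2 (hnat _) ha.symm
    refine eq_zero_of_pair_relations hκ partner_partner (pairCoeff_partner hτ) hY hE
      (hd (Fin.le_def.2 (by omega))) (hd (Fin.le_def.2 (by omega))) ha0 ?_
    rw [ha]
    rcases pairCoeff_sq hτ b with h | ⟨h, -⟩
    · rw [h]
      have : (a : ℕ) / 2 + 1 ≠ b / 2 + 1 := by omega
      intro h4
      exact this (Nat.pow_left_injective two_ne_zero (by exact_mod_cast h4))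
    · rw [h, zero_pow two_ne_zero]
      exact pow_ne_zero 2 (hnat _)
  -- diagonal coordinates at the first member of a pair or an unpaired block: half of them vanish by
  -- skew-adjointness, the others by assumption
  have hdiag0 : ∀ a : Fin k, (a : ℕ) % 2 = 0 → ∀ t, Y a a t = 0 := by
    intro a ha t
    by_cases ht : (t + p) % 2 = 0
    · have h1 := hS a a t
      rw [neg_mul, ← pow_add, add_comm p t, neg_one_pow_eq_pow_mod_two, ht, pow_zero, neg_one_mul]
        at h1
      exact self_eq_neg.1 h1
    · by_cases htd : d a < t
      · exact hY a a t htd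
      · have hpa := hp a
        have hN : (t + p) / 2 < stabCount d a := by
          rw [stabCount, if_pos ha]; omega
        have h1 := congrFun h0 ⟨a, ⟨(t + p) / 2, hN⟩⟩
        rw [stabCoord, LinearMap.pi_apply, if_pos ha] at h1
        rwa [show 2 * ((t + p) / 2) + 1 - p = t by omega] at h1
  -- those at the second member are proportional to them
  have hdiag : ∀ a t, Y a a t = 0 := by
    intro a t
    rcases Nat.mod_two_eq_zero_or_one a with ha | ha
    · exact hdiag0 a ha t
    · have h1 := partner_cases a
      have hle : d a ≤ d (partner a) := hd (Fin.le_def.2 (by omega))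
      have h2 := hE (partner a) (partner a) t (t + (d (partner a) - d a))
        (by rw [partner_partner]; omega)
      rw [partner_partner, hdiag0 (partner a) (by omega), mul_zero] at h2
      refine (mul_eq_zero.1 h2).resolve_left ?_
      rw [pairCoeff_partner hτ, pairCoeff, if_pos ha]
      exact mul_ne_zero hκ (hnat _)
  -- coordinates between the two members of a pair: those with odd `t` vanish as the relation and
  -- skew-adjointness give opposite signs, the others by assumption
  have hpart1 : ∀ a : Fin k, (a : ℕ) % 2 = 1 → ∀ t, Y a (partner a) t = 0 := by
    intro a ha t
    rcases Nat.mod_two_eq_zero_or_one t with ht | ht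
    · by_cases htd : d a < t
      · exact hY _ _ t htd
      · have hN : t / 2 < stabCount d a := by
          rw [stabCount, if_neg (by omega)]; omega
        have h1 := congrFun h0 ⟨a, ⟨t / 2, hN⟩⟩
        rw [stabCoord, LinearMap.pi_apply, if_neg (by simp only; omega)] at h1
        rwa [show 2 * (t / 2) = t by omega] at h1
    · have h1 := hE a (partner a) t t (by rw [partner_partner])
      rw [partner_partner, hS a (partner a), pairCoeff_partner hτ, neg_one_pow_eq_pow_mod_two (n := t), ht,
        pow_one] at h1
      have ha0 : pairCoeff ((-1 : F) ^ p) a ≠ 0 := by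
        rw [pairCoeff, if_pos ha]; exact hnat _
      apply self_eq_neg.1
      apply mul_left_cancel₀ (mul_ne_zero hκ ha0)
      linear_combination -h1
  have hpart : ∀ a t, Y a (partner a) t = 0 := by
    intro a t
    rcases partner_cases a with h | h | h
    · exact hpart1 a h.1 t
    · have h1 := hpart1 (partner a) (by omega) t
      rw [partner_partner] at h1
      rw [hS (partner a) a, h1, mul_zero]
    · rw [Fin.ext h.2.2, hdiag]
  refine Subtype.ext (hw.eq_zero_of_blockCoord hB he (centraliser_le_glCentraliser x.2)
    fun a b t => ?_)
  change Y a b t = 0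
  rcases lt_trichotomy (a : ℕ) b with h | h | h
  · by_cases hab : partner a = b
    · rw [← hab, hpart]
    · exact hc a b h hab t
  · rw [Fin.ext h, hdiag]
  · by_cases hab : partner b = a
    · rw [← hab, hS b (partner b), hpart, mul_zero]
    · rw [hS b a, hc b a h hab, mul_zero]

/-- The stabiliser of `pairForm` in `𝔤_e` has dimension at most the rank of `𝔤`; hence the index
of `𝔤_e` is at most that rank. -/
theorem IsAdapted.finrank_ker_coadjoint_le [CharZero F] [FiniteDimensional F V]
    (hw : IsAdapted B e d w) (hd : Antitone d) (hp : ∀ i, d i % 2 = p) (hB : B.Nondegenerate)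
    (hBp : ∀ v w, B v w = (-1) ^ p * B w v) (he : ∀ v w, B (e v) w = -B v (e w)) :
    Module.finrank F (LinearMap.ker (coadjoint B e (pairForm B ((-1) ^ p) w))) ≤
      Module.finrank F V / 2 := by
  let Φ : LinearMap.ker (coadjoint B e (pairForm B ((-1) ^ p) w)) →ₗ[F]
      (Σ i : Fin k, Fin (stabCount d i)) → F :=
    stabCoord B e p d w ∘ₗ (centraliser B e).subtype ∘ₗ Submodule.subtype _
  have hΦ : Function.Injective Φ := by
    rw [injective_iff_map_eq_zero]
    exact fun x hx => Subtype.ext (hw.eq_zero_of_stabCoord hd hp hB hBp he x.2 hx)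
  refine (LinearMap.finrank_le_finrank_of_injective hΦ).trans ?_
  rw [Module.finrank_fintype_fun_eq_card, Fintype.card_sigma, hw.1.finrank]
  simpa using sum_stabCount_le hp

end Index

/-! ### Invariants vanishing on a slice to a coadjoint orbit -/

section Lowest

variable {F : Type*} [Field F] [CharZero F] {M : Type*} [AddCommGroup M] [Module F M]

/-- If `Q` vanishes along the curve `t ↦ t D(t)⁻¹ δ(t)`, then its component of minimal degree
vanishes at the tangent vector `δ(0)`. -/
theorem evalAt_minComponent_eq_zero {Q : SymmetricAlgebra F M} {δ : M →ₗ[F] F[X]} {D : F[X]}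
    (hD : D.coeff 0 ≠ 0)
    (h : ∀ t, D.eval t ≠ 0 → evalAt ((t * (D.eval t)⁻¹) • (Polynomial.leval t ∘ₗ δ)) Q = 0) :
    evalAt (Polynomial.lcoeff F 0 ∘ₗ δ) (minComponent Q) = 0 := by
  set g := gradeHom Q with hg
  set m := g.natTrailingDegree
  set N := g.natDegree
  let Λ : SymmetricAlgebra F M →ₐ[F] F[X] := SymmetricAlgebra.lift δ
  have hΛ : ∀ t P, (Λ P).eval t = evalAt (Polynomial.leval t ∘ₗ δ) P := fun t P => by
    have : (aeval t).comp Λ = evalAt (Polynomial.leval t ∘ₗ δ) := by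
      refine SymmetricAlgebra.algHom_ext (LinearMap.ext fun x => ?_)
      change aeval t (Λ (SymmetricAlgebra.ι F M x)) = evalAt _ (SymmetricAlgebra.ι F M x)
      rw [evalAt_ι, SymmetricAlgebra.lift_ι_apply, coe_aeval_eq_eval]
      rfl
    rw [← this, AlgHom.comp_apply, coe_aeval_eq_eval]
  have hev : ∀ t s, evalAt (s • (Polynomial.leval t ∘ₗ δ)) Q =
      ∑ j ∈ Finset.range (N + 1), (Λ (g.coeff j)).eval t * s ^ j := fun t s => by
    rw [← eval_lineHom, ← map_evalAt_gradeHom, eval_map, eval₂_eq_sum_range]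
    exact Finset.sum_congr rfl fun j _ => by rw [hΛ]; rfl
  -- `R` is `Q` along the curve, with denominators cleared and divided by `t ^ m`; its value at `0`
  -- comes from the component of degree `m`
  let R : F[X] := ∑ j ∈ Finset.range (N + 1), Λ (g.coeff j) * X ^ (j - m) * D ^ (N - j)
  have hR : R * (X ^ m * D) = 0 := by
    refine Polynomial.funext fun t => ?_
    rw [eval_mul, eval_mul, eval_zero, eval_pow, eval_X]
    by_cases ht : D.eval t = 0
    · rw [ht, mul_zero, mul_zero]
    · have h1 : t ^ m * R.eval t = D.eval t ^ N *
          evalAt ((t * (D.eval t)⁻¹) • (Polynomial.leval t ∘ₗ δ)) Q := by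
        rw [hev, Finset.mul_sum, eval_finsetSum, Finset.mul_sum]
        refine Finset.sum_congr rfl fun j hj => ?_
        rw [eval_mul, eval_mul, eval_pow, eval_pow, eval_X]
        by_cases hjm : j < m
        · rw [coeff_eq_zero_of_lt_natTrailingDegree hjm, map_zero, eval_zero]; ring
        · have hjN : j ≤ N := by simpa [Nat.lt_succ_iff] using hj
          obtain ⟨c, rfl⟩ := Nat.exists_eq_add_of_le (not_lt.1 hjm)
          obtain ⟨r, hr⟩ := Nat.exists_eq_add_of_le hjN
          rw [hr, Nat.add_sub_cancel_left, Nat.add_sub_cancel_left, mul_pow, inv_pow]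
          field_simp
          ring
      rw [h t ht, mul_zero] at h1
      linear_combination D.eval t * h1
  have hD0 : D ≠ 0 := fun h => hD (by rw [h, coeff_zero])
  have hR0 : R = 0 := (mul_eq_zero.1 hR).resolve_right (mul_ne_zero (pow_ne_zero _ X_ne_zero) hD0)
  by_cases hmN : m ≤ N
  · have h2 := congrArg (Polynomial.eval 0) hR0
    rw [eval_zero, eval_finsetSum, Finset.sum_eq_single m] at h2
    · rw [Nat.sub_self, pow_zero, mul_one, eval_mul, eval_pow, hΛ] at h2
      rw [coeff_zero_eq_eval_zero] at hD
      have h3 := (mul_eq_zero.1 h2).resolve_right (pow_ne_zero _ hD)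
      have h4 : (Polynomial.lcoeff F 0 ∘ₗ δ : Module.Dual F M) = Polynomial.leval 0 ∘ₗ δ :=
        LinearMap.ext fun x => coeff_zero_eq_eval_zero _
      rw [h4]
      exact h3
    · intro j _ hj
      rcases lt_or_gt_of_ne hj with h | h
      · rw [coeff_eq_zero_of_lt_natTrailingDegree h, map_zero, zero_mul, zero_mul, eval_zero]
      · rw [eval_mul, eval_mul, eval_pow, eval_X, zero_pow (by omega), mul_zero, zero_mul]
    · intro h
      exact absurd (Finset.mem_range.2 (Nat.lt_succ_of_le hmN)) h
  · exact absurd (natTrailingDegree_le_natDegree g) hmN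

end Lowest

section Cayley

/-- The Cayley transform of `x M`, multiplied by the determinant `1 + x ^ 2 D` of its denominator,
to first order in `x`. -/
theorem exists_cayley_expansion {n : Type*} [Fintype n] [DecidableEq n] {R : Type*} [CommRing R]
    {M : Matrix n n R} {x D : R} (h : (1 - x • M).det = 1 + x ^ 2 * D) :
    ∃ E, (1 + x • M) * (1 - x • M).adjugate = 1 + (2 * x) • M + x ^ 2 • E := by
  have h1 := (1 - x • M).adjugate_mul
  set A := (1 - x • M).adjugate
  have h2 : A = 1 + x • M + x ^ 2 • (D • (1 + x • M) + A * (M * M)) := by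
    have h3 : A * (1 - x • M) * (1 + x • M) = A - x ^ 2 • (A * (M * M)) := by
      simp only [mul_sub, mul_add, sub_mul, mul_one, Matrix.mul_smul, Matrix.smul_mul, smul_smul,
        mul_assoc]
      module
    rw [h1, h, Matrix.smul_mul, one_mul] at h3
    rw [← sub_eq_zero]
    rw [eq_sub_iff_add_eq] at h3
    rw [← sub_eq_zero] at h3
    rw [← neg_eq_zero, ← h3]
    module
  refine ⟨M * M + (1 + x • M) * (D • (1 + x • M) + A * (M * M)), ?_⟩
  nth_rewrite 1 [h2]
  simp only [mul_add, add_mul, mul_one, one_mul, Matrix.mul_smul, Matrix.smul_mul, smul_smul,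
    smul_add]
  module

/-- Conjugation by a Cayley transform, to first order: its derivative is twice the commutator. -/
theorem cayley_product {R A : Type*} [CommRing R] [Ring A] [Algebra R A] (x : R)
    (M Y E E' : A) : ∃ Z, (1 + (2 * x) • M + x ^ 2 • E) * Y * (1 + (2 * x) • (-M) + x ^ 2 • E') =
      Y + (2 * x) • (M * Y - Y * M) + x ^ 2 • Z := by
  refine ⟨-(4 : R) • (M * Y * M) + E * Y * (1 + (2 * x) • (-M) + x ^ 2 • E') +
    (1 + (2 * x) • M) * Y * E', ?_⟩
  simp only [mul_add, add_mul, mul_one, one_mul, mul_smul_comm, smul_mul_assoc, smul_smul,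
    smul_add, smul_sub, mul_neg, smul_neg, mul_assoc]
  module

variable {F : Type*} [Field F] {V : Type*} [AddCommGroup V] [Module F V] [FiniteDimensional F V]
  {B : LinearMap.BilinForm F V} {e : Module.End F V}

theorem det_adj (hB : B.Nondegenerate) (x : Module.End F V) :
    LinearMap.det (adj hB x) = LinearMap.det x := by
  rw [adj, LinearEquiv.conj_apply, LinearMap.comp_assoc]
  exact (LinearMap.det_conj _ (B.toDual hB).symm).trans (LinearMap.det_dualMap x)

/-- The determinant is even in `t` for skew-adjoint `x`, as `1 - t x` is the adjoint of `1 + t x`.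
-/
theorem det_one_sub_smul (hB : B.Nondegenerate) {x : Module.End F V}
    (hx : ∀ v w, B (x v) w = -B v (x w)) (t : F) :
    LinearMap.det (1 - t • x) = LinearMap.det (1 + t • x) := by
  rw [← det_adj hB (1 + t • x)]
  congr 1
  refine ext_form hB fun v w => ?_
  rw [adj_apply]
  simp [hx]

/-- The Cayley transform `(1 + t x)(1 - t x)⁻¹` of an element of `𝔤_e` lies in `G_e`. -/
theorem exists_cayley_transform (hB : B.Nondegenerate) {x : Module.End F V}
    (hx : x ∈ centraliser B e) {t : F} (ht : LinearMap.det (1 - t • x) ≠ 0) :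
    ∃ g ∈ groupCentraliser B e, ∀ v, g (v - t • x v) = v + t • x v := by
  obtain ⟨hx1, hx2⟩ := mem_centraliser.1 hx
  have ht' : LinearMap.det (1 + t • x) ≠ 0 := by rwa [← det_one_sub_smul hB hx1]
  let u := LinearMap.equivOfDetNeZero (1 - t • x) ht
  let v := LinearMap.equivOfDetNeZero (1 + t • x) ht'
  have hu : ∀ a, u a = a - t • x a := fun a => rfl
  have hv : ∀ a, v a = a + t • x a := fun a => rfl
  have hg : ∀ a, (u.symm.trans v) (u a) = v a := fun a => by simp
  refine ⟨u.symm.trans v, ⟨fun a b => ?_, ?_, fun a => ?_⟩, hg⟩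
  · obtain ⟨a, rfl⟩ := u.surjective a
    obtain ⟨b, rfl⟩ := u.surjective b
    rw [hg, hg, hu, hu, hv, hv]
    simp only [map_add, map_sub, LinearMap.add_apply, LinearMap.sub_apply, map_smul,
      LinearMap.smul_apply, smul_eq_mul, hx1]
    ring
  · refine Units.ext ?_
    have h1 : (u.symm.trans v : V ≃ₗ[F] V).toLinearMap * (1 - t • x) = 1 + t • x :=
      LinearMap.ext hg
    have h2 := congrArg LinearMap.det h1
    rw [map_mul, ← det_one_sub_smul hB hx1] at h2
    rw [LinearEquiv.coe_det]
    exact mul_right_cancel₀ ht (h2.trans (one_mul _).symm)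
  · obtain ⟨a, rfl⟩ := u.surjective a
    have h3 : ∀ a, e (x a) = x (e a) := LinearMap.congr_fun hx2
    have h1 : e (u a) = u (e a) := by rw [hu, hu, map_sub, map_smul, h3]
    have h2 : e (v a) = v (e a) := by rw [hv, hv, map_add, map_smul, h3]
    rw [h1, hg, hg, h2]

/-- Conjugation by `G = W U⁻¹` with the denominators cleared. -/
theorem adjugate_conj {n : Type*} [Fintype n] [DecidableEq n] {R : Type*} [CommRing R]
    {G U W Y Z : Matrix n n R} (hG : G * U = W) (hZ : Z * G = G * Y) :
    (W * U.adjugate) * Y * (U * W.adjugate) = (U.det * W.det) • Z := by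
  rw [← hG, mul_assoc G, Matrix.mul_adjugate, Matrix.mul_smul, mul_one, Matrix.smul_mul, ← hZ,
    Matrix.smul_mul, mul_assoc Z, ← mul_assoc G, Matrix.mul_adjugate, Matrix.mul_smul, mul_one,
    smul_smul]

/-- A linear form along the curve of Cayley transforms, with denominators cleared: there is a
polynomial curve whose value at `t` is `Δ(t)²` times the transform of `φ`, where
`Δ(t) = det (1 - t x)`, and whose derivative at `0` is twice the coadjoint action of `x`. -/
theorem exists_cayley_curve [CharZero F] (hB : B.Nondegenerate) {x : Module.End F V}
    (hx : ∀ v w, B (x v) w = -B v (x w)) : ∃ Δ : F[X], Δ.coeff 0 = 1 ∧ Δ.coeff 1 = 0 ∧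
      (∀ t, Δ.eval t = LinearMap.det (1 - t • x)) ∧ ∀ φ : Module.Dual F (Module.End F V),
        ∃ c : Module.End F V →ₗ[F] F[X], (∀ y, (c y).coeff 0 = φ y) ∧
          (∀ y, (c y).coeff 1 = 2 * φ (x * y - y * x)) ∧
          ∀ (t : F) (g : V ≃ₗ[F] V), (∀ v, g (v - t • x v) = v + t • x v) →
            ∀ y, (c y).eval t = Δ.eval t ^ 2 * φ (g.conj y) := by
  let b := Module.finBasis F V
  let mat := LinearMap.toMatrixAlgEquiv b
  let M : Matrix _ _ F[X] := (mat x).map C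
  have hev : ∀ (t : F) (Z : Module.End F V), (evalRingHom t).mapMatrix ((mat Z).map C) = mat Z :=
    fun t Z => by ext; simp
  have hev1 : ∀ t, (evalRingHom t).mapMatrix (1 - (X : F[X]) • M) = mat (1 - t • x) := fun t => by
    ext i j
    simp [M, mat, Matrix.one_apply, apply_ite (Polynomial.eval t)]
    exact mul_comm _ _
  have hev2 : ∀ t, (evalRingHom t).mapMatrix (1 + (X : F[X]) • M) = mat (1 + t • x) := fun t => by
    ext i j
    simp [M, mat, Matrix.one_apply, apply_ite (Polynomial.eval t)]
    exact mul_comm _ _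
  have hdet : ∀ Z : Module.End F V, (mat Z).det = LinearMap.det Z := fun Z =>
    LinearMap.det_toMatrix b Z
  let Δ := (1 - (X : F[X]) • M).det
  have hΔ : ∀ t, Δ.eval t = LinearMap.det (1 - t • x) := fun t => by
    rw [← hdet, ← hev1, ← RingHom.map_det]; rfl
  have hΔ' : (1 + (X : F[X]) • M).det = Δ := Polynomial.funext fun t => by
    rw [hΔ, det_one_sub_smul hB hx, ← hdet, ← hev2, ← RingHom.map_det]; rfl
  have h0 : Δ.coeff 0 = 1 := by
    rw [coeff_zero_eq_eval_zero, hΔ, zero_smul, sub_zero, map_one]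
  -- `Δ` is an even polynomial, so `Δ = 1 + X ^ 2 D`
  have h1 : Δ.coeff 1 = 0 := by
    have h2 : Δ.comp (-X) = Δ := Polynomial.funext fun t => by
      rw [eval_comp, eval_neg, eval_X, hΔ, hΔ, neg_smul, sub_neg_eq_add, det_one_sub_smul hB hx]
    have h3 := congrArg (fun P => Polynomial.coeff P 1) h2
    rw [show (-X : F[X]) = C (-1) * X by simp] at h3
    simp only [comp_C_mul_X_coeff] at h3
    rw [pow_one, mul_neg_one] at h3
    exact self_eq_neg.1 h3.symm
  obtain ⟨D, hD⟩ : X ^ 2 ∣ Δ - 1 := X_pow_dvd_iff.2 fun i hi => by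
    interval_cases i
    · rw [coeff_sub, h0, coeff_one_zero, sub_self]
    · rw [coeff_sub, h1, coeff_one, if_neg (by norm_num), sub_self]
  rw [sub_eq_iff_eq_add'] at hD
  obtain ⟨E, hE⟩ := exists_cayley_expansion (M := M) (x := (X : F[X])) hD
  have hneg : 1 - (X : F[X]) • (-M) = 1 + (X : F[X]) • M := by rw [smul_neg, sub_neg_eq_add]
  obtain ⟨E', hE'⟩ := exists_cayley_expansion (M := -M) (x := (X : F[X]))
    (by rw [hneg, hΔ']; exact hD)
  rw [hneg, smul_neg, ← sub_eq_add_neg] at hE'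
  -- `N` and `N'` are `Δ` times the Cayley transform and its inverse
  set N := (1 + (X : F[X]) • M) * (1 - (X : F[X]) • M).adjugate with hN
  set N' := (1 - (X : F[X]) • M) * (1 + (X : F[X]) • M).adjugate with hN'
  refine ⟨Δ, h0, h1, hΔ, fun φ => ?_⟩
  obtain ⟨G, hG⟩ := exists_trace_mul φ
  have htr : ∀ Z : Module.End F V, φ Z = (mat G * mat Z).trace := fun Z => by
    rw [hG, ← map_mul]
    exact LinearMap.trace_eq_matrix_trace F b _
  let c : Module.End F V →ₗ[F] F[X] :=
    { toFun := fun y => ((mat G).map C * (N * (mat y).map C * N')).trace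
      map_add' := fun y z => by
        rw [map_add, Matrix.map_add _ (fun _ _ => C_add), mul_add, add_mul, mul_add,
          Matrix.trace_add]
      map_smul' := fun r y => by
        have : (mat (r • y)).map C = C r • (mat y).map C := by
          rw [map_smul]; ext i j : 2; simp
        rw [this, Matrix.mul_smul, Matrix.smul_mul, Matrix.mul_smul, Matrix.trace_smul,
          RingHom.id_apply, smul_eq_C_mul, smul_eq_mul] }
  have hexp : ∀ y, ∃ q, c y = C (φ y) + X * (C (2 * φ (x * y - y * x)) + X * q) := fun y => by
    obtain ⟨Z, hZ⟩ := cayley_product (X : F[X]) M ((mat y).map C) E E'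
    rw [← hE, ← hE'] at hZ
    refine ⟨((mat G).map C * Z).trace, ?_⟩
    change ((mat G).map C * (N * (mat y).map C * N')).trace = _
    have hC : ∀ P Q : Matrix (Fin (Module.finrank F V)) (Fin (Module.finrank F V)) F,
        P.map C * Q.map C = (P * Q).map (C : F →+* F[X]) := fun P Q => (Matrix.map_mul).symm
    have hCt : ∀ P : Matrix (Fin (Module.finrank F V)) (Fin (Module.finrank F V)) F,
        (P.map (C : F →+* F[X])).trace = C P.trace := fun P => by
      simp [Matrix.trace]
    rw [hZ, mul_add, mul_add, Matrix.mul_smul, Matrix.mul_smul, Matrix.trace_add, Matrix.trace_add,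
      Matrix.trace_smul, Matrix.trace_smul, mul_sub, Matrix.trace_sub, hC, hC, hC, hC, hC, hCt,
      hCt, hCt, map_sub φ, htr, htr, htr, map_mul mat, map_mul mat, smul_eq_mul, smul_eq_mul,
      C_mul, C_sub]
    rw [show C (2 : F) = (2 : F[X]) from rfl]
    ring
  refine ⟨c, fun y => ?_, fun y => ?_, fun t g hg y => ?_⟩
  · obtain ⟨q, hq⟩ := hexp y
    simp [hq]
  · obtain ⟨q, hq⟩ := hexp y
    rw [hq, coeff_add, coeff_C, if_neg one_ne_zero, zero_add, coeff_X_mul, coeff_add, coeff_C_zero,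
      coeff_X_mul_zero, add_zero]
  · let ψ : Matrix (Fin (Module.finrank F V)) (Fin (Module.finrank F V)) F[X] →+*
      Matrix (Fin (Module.finrank F V)) (Fin (Module.finrank F V)) F := (evalRingHom t).mapMatrix
    have hψ : ∀ P : Matrix (Fin (Module.finrank F V)) (Fin (Module.finrank F V)) F[X],
        P.trace.eval t = (ψ P).trace := fun P => by
      simp [Matrix.trace, ψ, eval_finsetSum]
    have hadj : ∀ P : Matrix (Fin (Module.finrank F V)) (Fin (Module.finrank F V)) F[X],
        ψ P.adjugate = (ψ P).adjugate := fun P => RingHom.map_adjugate _ _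
    have e1 : g.toLinearMap * (1 - t • x) = 1 + t • x := LinearMap.ext hg
    have e2 : g.conj y * g.toLinearMap = g.toLinearMap * y :=
      LinearMap.ext fun v => by simp [LinearEquiv.conj_apply]
    have e3 := congrArg mat e1
    have e4 := congrArg mat e2
    rw [map_mul] at e3
    rw [map_mul, map_mul] at e4
    change (((mat G).map C * (N * (mat y).map C * N')).trace).eval t = _
    rw [hψ, map_mul ψ, map_mul ψ, map_mul ψ, hN, hN', map_mul ψ, map_mul ψ, hadj, hadj]
    rw [show ψ ((mat G).map C) = mat G from hev t G, show ψ ((mat y).map C) = mat y from hev t y,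
      show ψ (1 - (X : F[X]) • M) = _ from hev1 t, show ψ (1 + (X : F[X]) • M) = _ from hev2 t,
      adjugate_conj e3 e4, Matrix.mul_smul, Matrix.trace_smul, ← htr, hdet, hdet,
      ← det_one_sub_smul hB hx, ← hΔ, smul_eq_mul, sq]

end Cayley

section Slice

variable {F : Type*} [Field F] {M : Type*} [AddCommGroup M] [Module F M]

/-- Translation by `ψ` of functions on `M*`. -/
def translate (ψ : Module.Dual F M) : SymmetricAlgebra F M →ₐ[F] SymmetricAlgebra F M :=
  SymmetricAlgebra.lift (SymmetricAlgebra.ι F M + Algebra.linearMap F _ ∘ₗ ψ)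

theorem evalAt_translate (ψ δ : Module.Dual F M) (P : SymmetricAlgebra F M) :
    evalAt δ (translate ψ P) = evalAt (ψ + δ) P := by
  have : (evalAt δ).comp (translate ψ) = evalAt (ψ + δ) := by
    refine SymmetricAlgebra.algHom_ext (LinearMap.ext fun m => ?_)
    change evalAt δ (translate ψ (SymmetricAlgebra.ι F M m)) =
      evalAt (ψ + δ) (SymmetricAlgebra.ι F M m)
    rw [evalAt_ι, translate, SymmetricAlgebra.lift_ι_apply, LinearMap.add_apply, map_add, evalAt_ι,
      LinearMap.comp_apply, Algebra.linearMap_apply, AlgHom.commutes, LinearMap.add_apply, add_comm]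
    rfl
  exact DFunLike.congr_fun this P

theorem eq_zero_of_minComponent_eq_zero {Q : SymmetricAlgebra F M} (h : minComponent Q = 0) :
    Q = 0 := by
  rw [minComponent, trailingCoeff_eq_zero] at h
  rw [← eval_one_gradeHom Q, h, eval_zero]

variable [CharZero F] {V : Type*} [AddCommGroup V] [Module F V] [FiniteDimensional F V]
  {B : LinearMap.BilinForm F V} {e : Module.End F V}

/-- An invariant that vanishes on an affine subspace through `ψ` whose direction, together with the
tangent space of the coadjoint orbit of `ψ`, spans `𝔤_e*` is zero. Indeed every tangent vector at
`ψ` is the direction of a curve on which the invariant vanishes, obtained by moving a line in the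
affine subspace by Cayley transforms; so the leading form of the invariant at `ψ` is zero. -/
theorem eq_zero_of_mem_invariants_of_vanishing (hB : B.Nondegenerate)
    {P : SymmetricAlgebra F (centraliser B e)} (hP : P ∈ invariants B e)
    (ψ : Module.Dual F (Module.End F V)) {L : Submodule F (Module.Dual F (centraliser B e))}
    (hL : LinearMap.range (coadjoint B e ψ) ⊔ L = ⊤)
    (h : ∀ l ∈ L, evalAt (ψ ∘ₗ (centraliser B e).subtype + l) P = 0) : P = 0 := by
  have hQ : translate (ψ ∘ₗ (centraliser B e).subtype) P = 0 := by
    refine eq_zero_of_minComponent_eq_zero (eq_of_evalAt_eq fun δ₀ => ?_)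
    rw [map_zero]
    obtain ⟨_, ⟨x, rfl⟩, l, hl, hδ⟩ := Submodule.mem_sup.1
      (hL.symm ▸ Submodule.mem_top : δ₀ ∈ LinearMap.range (coadjoint B e ψ) ⊔ L)
    obtain ⟨l', hl'⟩ := LinearMap.exists_extend l
    -- the factor `1 / 2` cancels the one in the derivative of the Cayley transform
    let x' : centraliser B e := (2 : F)⁻¹ • x
    obtain ⟨Δ, h0, h1, hΔ, hc⟩ := exists_cayley_curve hB (mem_centraliser.1 x'.2).1
    obtain ⟨c₁, a0, a1, a2⟩ := hc ψ
    obtain ⟨c₂, b0, -, b2⟩ := hc l'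
    -- `ψ + t Δ(t)⁻² δ(t)` is the transform of `ψ + t l`, and `δ(0)` is the sum of the tangent
    -- vector of the orbit in the direction of `x` and of `l`
    let δ : centraliser B e →ₗ[F] F[X] :=
      { toFun := fun y => divX (c₁ y - C (ψ y) * Δ ^ 2) + c₂ y
        map_add' := fun y z => by
          rw [← add_add_add_comm, ← divX_add]
          simp only [Submodule.coe_add, map_add]
          congr 2
          ring
        map_smul' := fun r y => by
          simp only [Submodule.coe_smul, map_smul, RingHom.id_apply, smul_add]
          rw [smul_eq_C_mul (p := divX _), ← divX_C_mul]
          congr 2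
          rw [mul_sub, smul_eq_mul, C_mul, smul_eq_C_mul]
          ring }
    have hmin := evalAt_minComponent_eq_zero (Q := translate (ψ ∘ₗ (centraliser B e).subtype) P)
      (δ := δ) (D := Δ ^ 2)
      (by rw [coeff_zero_eq_eval_zero, eval_pow, ← coeff_zero_eq_eval_zero, h0]; simp)
      fun t ht => ?_
    · have : Polynomial.lcoeff F 0 ∘ₗ δ = δ₀ := by
        rw [← hδ]
        refine LinearMap.ext fun y => ?_
        change (divX (c₁ y - C (ψ y) * Δ ^ 2) + c₂ y).coeff 0 = ψ (x.1 * y.1 - y.1 * x.1) + l y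
        have e1 : (Δ ^ 2).coeff 1 = 0 := by
          rw [sq, coeff_mul, Finset.Nat.sum_antidiagonal_eq_sum_range_succ_mk]
          simp [Finset.sum_range_succ, h1]
        rw [coeff_add, coeff_divX, zero_add, coeff_sub, a1, coeff_C_mul, e1, b0]
        change 2 * ψ ((2 : F)⁻¹ • x.1 * y.1 - y.1 * (2 : F)⁻¹ • x.1) - ψ y * 0 + l' y = _
        rw [smul_mul_assoc, mul_smul_comm, ← smul_sub, map_smul, smul_eq_mul,
          mul_inv_cancel_left₀ two_ne_zero, mul_zero, sub_zero]
        rw [← hl']; rfl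
      rwa [this] at hmin
    · have ht' : Δ.eval t ≠ 0 := fun h => ht (by rw [eval_pow, h, zero_pow two_ne_zero])
      obtain ⟨g, hg, hgx⟩ := exists_cayley_transform hB x'.2 (t := t) (by rwa [← hΔ])
      rw [evalAt_translate]
      have hγ : ψ ∘ₗ (centraliser B e).subtype +
          (t * ((Δ ^ 2).eval t)⁻¹) • (Polynomial.leval t ∘ₗ δ) =
          (ψ ∘ₗ (centraliser B e).subtype + t • l) ∘ₗ adjointAction B e ⟨g, hg⟩ := by
        refine LinearMap.ext fun y => ?_
        have e1 : l (adjointAction B e ⟨g, hg⟩ y) = l' (g.conj y.1) := by rw [← hl']; rfl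
        change ψ y + (t * ((Δ ^ 2).eval t)⁻¹) * (divX (c₁ y - C (ψ y) * Δ ^ 2) + c₂ y).eval t =
          ψ (g.conj y.1) + t * l (adjointAction B e ⟨g, hg⟩ y)
        have e2 := congrArg (Polynomial.eval t) (X_mul_divX_add (c₁ y - C (ψ y) * Δ ^ 2))
        have e3 : (c₁ y - C (ψ y) * Δ ^ 2).coeff 0 = 0 := by
          rw [coeff_sub, a0, coeff_C_mul, coeff_zero_eq_eval_zero (Δ ^ 2), eval_pow,
            ← coeff_zero_eq_eval_zero, h0, one_pow, mul_one, sub_self]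
        rw [e3, C_0, add_zero, eval_mul, eval_X, eval_sub, a2 t g hgx, eval_mul, eval_C,
          eval_pow] at e2
        rw [eval_add, b2 t g hgx, eval_pow, e1]
        field_simp
        linear_combination e2
      rw [hγ, mem_invariants_iff.1 hP]
      exact h _ (L.smul_mem t hl)
  refine eq_of_evalAt_eq fun γ => ?_
  have := evalAt_translate (ψ ∘ₗ (centraliser B e).subtype) (γ - ψ ∘ₗ (centraliser B e).subtype) P
  rw [hQ, map_zero, add_sub_cancel] at this
  rw [map_zero, ← this]

end Slice

/-! ### Integrality over homogeneous parameters -/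

section Integral

variable {F : Type*} [Field F] {M : Type*} [AddCommGroup M] [Module F M]

/-- The algebra `F[M*]` is generated by the linear functions. -/
theorem mem_of_forall_ι_mem {S : Subalgebra F (SymmetricAlgebra F M)}
    (h : ∀ x, SymmetricAlgebra.ι F M x ∈ S) (P : SymmetricAlgebra F M) : P ∈ S := by
  let φ : SymmetricAlgebra F M →ₐ[F] S :=
    SymmetricAlgebra.lift ((SymmetricAlgebra.ι F M).codRestrict (Subalgebra.toSubmodule S) h)
  have : S.val.comp φ = AlgHom.id F _ := by
    refine SymmetricAlgebra.algHom_ext (LinearMap.ext fun x => ?_)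
    change ((φ (SymmetricAlgebra.ι F M x) : S) : SymmetricAlgebra F M) = _
    rw [SymmetricAlgebra.lift_ι_apply]
    rfl
  rw [← AlgHom.id_apply (R := F) P, ← this]
  exact (φ P).2

/-- Functions whose only common zero is the origin generate an ideal of finite codimension. -/
theorem finite_quotient_of_common_zero [IsAlgClosed F] [FiniteDimensional F M]
    {J : Ideal (SymmetricAlgebra F M)}
    (hzero : ∀ γ : Module.Dual F M, (∀ P ∈ J, evalAt γ P = 0) → γ = 0) :
    Module.Finite F (SymmetricAlgebra F M ⧸ J) := by
  have h1 : Algebra.FiniteType F (SymmetricAlgebra F M) :=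
    Algebra.FiniteType.equiv (inferInstance : Algebra.FiniteType F (MvPolynomial _ F))
      (SymmetricAlgebra.equivMvPolynomial (Module.finBasis F M)).symm
  have h2 : Algebra.FiniteType F (SymmetricAlgebra F M ⧸ J) :=
    h1.of_surjective (Ideal.Quotient.mkₐ F J) Ideal.Quotient.mk_surjective
  have h3 : Algebra.IsIntegral F (SymmetricAlgebra F M ⧸ J) := by
    refine ⟨fun a => ?_⟩
    obtain ⟨P, rfl⟩ := Ideal.Quotient.mk_surjective a
    refine mem_of_forall_ι_mem (S := (integralClosure F (SymmetricAlgebra F M ⧸ J)).comap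
      (Ideal.Quotient.mkₐ F J)) (fun x => ?_) P
    have h4 : SymmetricAlgebra.ι F M x ∈ J.radical :=
      mem_radical_of_evalAt_eq_zero fun γ hγ => by
        rw [hzero γ hγ, evalAt_ι, LinearMap.zero_apply]
    obtain ⟨n, hn⟩ := h4
    rw [Subalgebra.mem_comap, mem_integralClosure_iff]
    refine ⟨X ^ n, monic_X_pow n, ?_⟩
    rw [eval₂_pow, eval₂_X, ← map_pow]
    exact Ideal.Quotient.eq_zero_iff_mem.2 hn
  exact Algebra.IsIntegral.finite

/-- `F[M*]` is integral over the algebra generated by homogeneous functions of positive degree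
whose only common zero is the origin (a graded form of Nakayama's lemma). -/
theorem isIntegral_aeval_of_common_zero [IsAlgClosed F] [FiniteDimensional F M] {ι : Type*}
    [Fintype ι] {q : ι → SymmetricAlgebra F M} (hhom : ∀ i, ∃ m ≠ 0, IsHomog (q i) m)
    (hzero : ∀ γ : Module.Dual F M, (∀ i, evalAt γ (q i) = 0) → γ = 0) :
    (MvPolynomial.aeval q : MvPolynomial ι F →ₐ[F] _).toRingHom.IsIntegral := by
  classical
  set φ : MvPolynomial ι F →+* SymmetricAlgebra F M := (MvPolynomial.aeval q).toRingHom
  let J := Ideal.span (Set.range q)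
  have hfin := finite_quotient_of_common_zero (J := J) fun γ hγ =>
    hzero γ fun i => hγ _ (Ideal.subset_span ⟨i, rfl⟩)
  obtain ⟨s, hs⟩ := hfin.fg_top
  -- representatives `T` of a basis modulo `J` have homogeneous components that span `F[M*]` over
  -- the polynomials in `q`, by induction on the degree
  obtain ⟨T, hT⟩ : ∃ T : Finset (SymmetricAlgebra F M),
      Submodule.span F (T : Set (SymmetricAlgebra F M)) ⊔ J.restrictScalars F = ⊤ := by
    refine ⟨s.image Quotient.out, ?_⟩
    let π : SymmetricAlgebra F M →ₗ[F] SymmetricAlgebra F M ⧸ J :=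
      (Ideal.Quotient.mkₐ F J).toLinearMap
    have h1 : LinearMap.range π = ⊤ := LinearMap.range_eq_top.2 Ideal.Quotient.mk_surjective
    have h2 : LinearMap.ker π = J.restrictScalars F := by
      ext P; exact Ideal.Quotient.eq_zero_iff_mem
    rw [← h2, ← LinearMap.map_eq_top_iff h1, Submodule.map_span, Finset.coe_image,
      Set.image_image]
    have h3 : (fun a => π (Quotient.out a)) = id := funext fun a => Quotient.out_eq a
    rw [h3, Set.image_id, hs]
  let := φ.toAlgebra
  let N : Submodule (MvPolynomial ι F) (SymmetricAlgebra F M) :=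
    Submodule.span _ (T.biUnion fun t => (gradeHom t).coeffs : Finset (SymmetricAlgebra F M))
  have hsmul : ∀ (c : MvPolynomial ι F) (P : SymmetricAlgebra F M), c • P = φ c * P :=
    fun c P => rfl
  have hCN : ∀ (c : F), ∀ P ∈ N, c • P ∈ N := fun c P hP => by
    have h := N.smul_mem (MvPolynomial.C c) hP
    rwa [hsmul, show φ (MvPolynomial.C c) = algebraMap F _ c from MvPolynomial.aeval_C _ _,
      ← Algebra.smul_def] at h
  have key : ∀ n, ∀ P : SymmetricAlgebra F M, (gradeHom P).coeff n ∈ N := by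
    intro n
    induction n using Nat.strong_induction_on with
    | _ n ih =>
      intro P
      obtain ⟨a, ha, b, hb, rfl⟩ := Submodule.mem_sup.1
        (hT.symm ▸ Submodule.mem_top : P ∈ Submodule.span F
          (T : Set (SymmetricAlgebra F M)) ⊔ J.restrictScalars F)
      rw [map_add, coeff_add]
      refine N.add_mem ?_ ?_
      · induction ha using Submodule.span_induction with
        | mem t ht =>
          by_cases h0 : (gradeHom t).coeff n = 0
          · rw [h0]; exact N.zero_mem
          · exact Submodule.subset_span (Finset.mem_coe.2 (Finset.mem_biUnion.2
              ⟨t, ht, coeff_mem_coeffs h0⟩))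
        | zero => rw [map_zero, coeff_zero]; exact N.zero_mem
        | add x y _ _ hx hy => rw [map_add, coeff_add]; exact N.add_mem hx hy
        | smul c x _ hx => rw [map_smul, coeff_smul]; exact hCN c _ hx
      · obtain ⟨c, rfl⟩ := (Ideal.mem_span_range_iff_exists_fun).1 hb
        rw [map_sum, finsetSum_coeff]
        refine N.sum_mem fun i _ => ?_
        obtain ⟨m, hm, hqm⟩ := hhom i
        rw [map_mul, hqm.gradeHom_eq, ← C_mul_X_pow_eq_monomial,
          ← mul_assoc, coeff_mul_X_pow', coeff_mul_C]
        split_ifs with hmn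
        · have h := N.smul_mem (MvPolynomial.X i) (ih (n - m) (by omega) (c i))
          rwa [hsmul, show φ (MvPolynomial.X i) = q i from MvPolynomial.aeval_X _ _,
            mul_comm] at h
        · exact N.zero_mem
  have hfinite : φ.Finite := by
    refine ⟨⟨_, (top_le_iff.1 fun P _ => ?_ : N = ⊤)⟩⟩
    rw [← eval_one_gradeHom P, eval_eq_sum_range]
    refine N.sum_mem fun i _ => ?_
    rw [one_pow, mul_one]
    exact key i P
  exact hfinite.to_isIntegral

/-- Homogeneous functions as many as `dim M`, with the origin as their only common zero, are
algebraically independent, by comparison of transcendence degrees. -/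
theorem algebraicIndependent_of_common_zero [IsAlgClosed F] [FiniteDimensional F M] {ι : Type}
    [Fintype ι] {q : ι → SymmetricAlgebra F M} (hhom : ∀ i, ∃ m ≠ 0, IsHomog (q i) m)
    (hzero : ∀ γ : Module.Dual F M, (∀ i, evalAt γ (q i) = 0) → γ = 0)
    (hcard : Fintype.card ι = Module.finrank F M) : AlgebraicIndependent F q := by
  have hint := isIntegral_aeval_of_common_zero hhom hzero
  have h1 : Algebra.IsAlgebraic (Algebra.adjoin F (Set.range q)) (SymmetricAlgebra F M) := by
    have : Algebra.IsIntegral (Algebra.adjoin F (Set.range q)) (SymmetricAlgebra F M) := by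
      refine ⟨fun P => ?_⟩
      obtain ⟨μ, hμ, h⟩ := hint P
      let ψ : MvPolynomial ι F →+* Algebra.adjoin F (Set.range q) :=
        ((MvPolynomial.aeval q).codRestrict _ fun p => by
          rw [Algebra.adjoin_range_eq_range_aeval]; exact ⟨p, rfl⟩ : MvPolynomial ι F →ₐ[F] _).toRingHom
      refine ⟨μ.map ψ, hμ.map ψ, ?_⟩
      rw [eval₂_map]
      exact h
    infer_instance
  have h2 : Algebra.trdeg F (SymmetricAlgebra F M) = Module.finrank F M := by
    have h := (SymmetricAlgebra.equivMvPolynomial (Module.finBasis F M)).lift_trdeg_eq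
    rw [MvPolynomial.trdeg_of_isDomain, Cardinal.mk_fin] at h
    simpa using h
  refine (Algebra.IsAlgebraic.isTranscendenceBasis_of_lift_le_trdeg_of_finite F q ?_).1
  rw [h2]
  simp [hcard]

end Integral

/-! ### Invariants and the common zeros of homogeneous parameters -/

section Parameters

variable {F : Type*} [Field F]

/-- Let `f` consist of `r` elements of a subalgebra `A` that embeds into a polynomial ring in at
most `r` variables, and suppose that `f` stays algebraically independent under `ρ`. Then `ρ` is
injective on `A`: a nonzero `v ∈ A` is algebraic over the algebra generated by `f`, so it divides
a nonzero polynomial in `f`. -/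
theorem eq_zero_of_algebraicIndependent_comp {S S' : Type*} [CommRing S] [IsDomain S] [Algebra F S]
    [CommRing S'] [Algebra F S'] {A : Subalgebra F S} {ι : Type} [Fintype ι] {f : ι → S}
    (hf : ∀ i, f i ∈ A) (ρ : S →ₐ[F] S') (hρ : AlgebraicIndependent F (ρ ∘ f)) {l : ℕ}
    (hl : l ≤ Fintype.card ι) (σ : S →ₐ[F] MvPolynomial (Fin l) F)
    (hσ : ∀ P ∈ A, σ P = 0 → P = 0) {v : S} (hv : v ∈ A) (hρv : ρ v = 0) : v = 0 := by
  by_contra hv0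
  have hfi : AlgebraicIndependent F f := hρ.of_comp ρ
  -- otherwise `A` contains `r + 1` algebraically independent elements, but embeds into a polynomial
  -- ring in at most `r` variables
  have halg : IsAlgebraic (Algebra.adjoin F (Set.range f)) v := by
    by_contra htr
    have h1 : AlgebraicIndependent F (fun o : Option ι => o.elim v f) :=
      (hfi.option_iff_transcendental v).2 htr
    have h2 : AlgebraicIndependent F (σ ∘ fun o : Option ι => o.elim v f) := by
      rw [algebraicIndependent_iff] at h1 ⊢
      intro p hp
      refine h1 p (hσ _ ?_ ?_)
      · have : (MvPolynomial.aeval fun o : Option ι => o.elim v f) p ∈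
            Algebra.adjoin F (Set.range fun o : Option ι => o.elim v f) := by
          rw [Algebra.adjoin_range_eq_range_aeval]; exact ⟨p, rfl⟩
        refine Algebra.adjoin_le ?_ this
        rintro _ ⟨o, rfl⟩
        cases o with
        | none => exact hv
        | some i => exact hf i
      · exact (MvPolynomial.comp_aeval_apply _ σ p).trans hp
    have h3 := h2.lift_cardinalMk_le_trdeg
    rw [MvPolynomial.trdeg_of_isDomain] at h3
    simp at h3
    omega
  obtain ⟨q, hq0, hq⟩ :=
    halg.exists_nonzero_coeff_and_aeval_eq_zero (mem_nonZeroDivisors_of_ne_zero hv0)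
  -- the constant term of the algebraic relation is a polynomial in `f` that is divisible by `v`
  obtain ⟨p, hp⟩ : ∃ p : MvPolynomial ι F, MvPolynomial.aeval f p = (q.coeff 0 : S) := by
    have h : ∀ x ∈ Algebra.adjoin F (Set.range f), ∃ p, MvPolynomial.aeval f p = x := fun x hx => by
      rwa [Algebra.adjoin_range_eq_range_aeval] at hx
    exact h _ (q.coeff 0).2
  have h4 : (q.coeff 0 : S) = -v * aeval v (divX q) := by
    have := congrArg (aeval v) (X_mul_divX_add q)
    rw [hq, map_add, map_mul, aeval_X, aeval_C] at this
    change _ + ((q.coeff 0 : _) : S) = 0 at this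
    linear_combination this
  have h5 : MvPolynomial.aeval (ρ ∘ f) p = 0 := by
    refine (MvPolynomial.comp_aeval_apply f ρ p).symm.trans ?_
    rw [hp, h4, map_mul, map_neg, hρv, neg_zero, zero_mul]
  have h6 := (algebraicIndependent_iff.1 hρ) p h5
  rw [h6, map_zero] at hp
  exact hq0 (Subtype.ext hp.symm)

variable {M : Type*} [AddCommGroup M] [Module F M]

theorem evalAt_lift_ι_comp {M' : Type*} [AddCommGroup M'] [Module F M'] (π : M →ₗ[F] M')
    (γ : Module.Dual F M') (P : SymmetricAlgebra F M) :
    evalAt γ (SymmetricAlgebra.lift (SymmetricAlgebra.ι F M' ∘ₗ π) P) = evalAt (γ ∘ₗ π) P := by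
  have : (evalAt γ).comp (SymmetricAlgebra.lift (SymmetricAlgebra.ι F M' ∘ₗ π)) =
      evalAt (γ ∘ₗ π) := by
    refine SymmetricAlgebra.algHom_ext (LinearMap.ext fun x => ?_)
    change evalAt γ (SymmetricAlgebra.lift (SymmetricAlgebra.ι F M' ∘ₗ π)
      (SymmetricAlgebra.ι F M x)) = evalAt (γ ∘ₗ π) (SymmetricAlgebra.ι F M x)
    rw [SymmetricAlgebra.lift_ι_apply, LinearMap.comp_apply, evalAt_ι, evalAt_ι]
    rfl
  exact DFunLike.congr_fun this P

/-- Restriction to an affine subspace `ψ + L` of the dual, in coordinates. -/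
theorem exists_restriction_affine [Infinite F] [FiniteDimensional F M] (ψ : Module.Dual F M)
    (L : Submodule F (Module.Dual F M)) :
    ∃ σ : SymmetricAlgebra F M →ₐ[F] MvPolynomial (Fin (Module.finrank F L)) F,
      ∀ P, σ P = 0 → ∀ l ∈ L, evalAt (ψ + l) P = 0 := by
  have : Module.Free F L := Module.Free.of_divisionRing F L
  let b := Module.finBasis F L
  let σ : SymmetricAlgebra F M →ₐ[F] MvPolynomial (Fin (Module.finrank F L)) F :=
    SymmetricAlgebra.lift (Algebra.linearMap F _ ∘ₗ ψ +
      ∑ j, (LinearMap.toSpanSingleton F _ (MvPolynomial.X j)) ∘ₗ (b j : Module.Dual F M))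
  refine ⟨σ, fun P hP l hl => ?_⟩
  have : (MvPolynomial.aeval fun j => b.repr ⟨l, hl⟩ j).comp σ = evalAt (ψ + l) := by
    refine SymmetricAlgebra.algHom_ext (LinearMap.ext fun x => ?_)
    change MvPolynomial.aeval _ (σ (SymmetricAlgebra.ι F M x)) =
      evalAt (ψ + l) (SymmetricAlgebra.ι F M x)
    have hx : (∑ j, b.repr ⟨l, hl⟩ j • (b j : Module.Dual F M)) x = l x := by
      have h := congrArg L.subtype (b.sum_repr ⟨l, hl⟩)
      rw [map_sum] at h
      exact LinearMap.congr_fun h x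
    rw [SymmetricAlgebra.lift_ι_apply, evalAt_ι, LinearMap.add_apply, LinearMap.add_apply, map_add,
      LinearMap.sum_apply, map_sum]
    refine congrArg₂ (· + ·) (MvPolynomial.aeval_C _ _) (Eq.trans ?_ hx)
    rw [LinearMap.sum_apply]
    refine Finset.sum_congr rfl fun j _ => ?_
    rw [LinearMap.comp_apply, LinearMap.toSpanSingleton_apply, map_smul, MvPolynomial.aeval_X,
      LinearMap.smul_apply, smul_eq_mul, smul_eq_mul, mul_comm]
  rw [← this, AlgHom.comp_apply, hP, map_zero]

/-- Let `f` be homogeneous elements of positive degree of a subalgebra `A` of `F[M*]`, as many as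
the dimension of a subspace `W` which they cut out only in the origin. If the functions in `A` are
determined by their restrictions to an affine subspace of at most that dimension, then all of them
are constant on the common zeros of `f`. For restriction to `W` is injective on `A`, so a monic
equation for the restriction of `P` over the polynomials in `f` holds for `P` itself; on a line of
common zeros through the origin its coefficients are constant. -/
theorem evalAt_eq_evalAt_zero_of_mem [IsAlgClosed F] [FiniteDimensional F M]
    {A : Subalgebra F (SymmetricAlgebra F M)} {ι : Type} [Fintype ι]
    {f : ι → SymmetricAlgebra F M} (hf : ∀ i, f i ∈ A) (hhom : ∀ i, ∃ m ≠ 0, IsHomog (f i) m)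
    {W : Submodule F (Module.Dual F M)} (hW : Module.finrank F W = Fintype.card ι)
    (hzero : ∀ γ ∈ W, (∀ i, evalAt γ (f i) = 0) → γ = 0) (ψ : Module.Dual F M)
    {L : Submodule F (Module.Dual F M)} (hL : Module.finrank F L ≤ Fintype.card ι)
    (hA : ∀ P ∈ A, (∀ l ∈ L, evalAt (ψ + l) P = 0) → P = 0)
    {P : SymmetricAlgebra F M} (hP : P ∈ A) {γ : Module.Dual F M}
    (hγ : ∀ i, evalAt γ (f i) = 0) : evalAt γ P = evalAt 0 P := by
  -- `W` is the dual of `M` modulo the common zeros of `W`, and `ρ` is restriction to `W`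
  let π := W.dualCoannihilator.mkQ
  have hπW : ∀ γ' : Module.Dual F (M ⧸ W.dualCoannihilator), γ' ∘ₗ π ∈ W := fun γ' => by
    refine Subspace.dualCoannihilator_dualAnnihilator_eq.le
      ((Submodule.mem_dualAnnihilator _).2 fun x hx => ?_)
    rw [LinearMap.comp_apply, (Submodule.Quotient.mk_eq_zero _).2 hx |> fun h => (h : π x = 0),
      map_zero]
  have hcard : Fintype.card ι = Module.finrank F (M ⧸ W.dualCoannihilator) := by
    have h1 := Subspace.finrank_add_finrank_dualCoannihilator_eq W
    have h2 := Submodule.finrank_quotient_add_finrank W.dualCoannihilator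
    omega
  let ρ : SymmetricAlgebra F M →ₐ[F] SymmetricAlgebra F (M ⧸ W.dualCoannihilator) :=
    SymmetricAlgebra.lift (SymmetricAlgebra.ι F _ ∘ₗ π)
  have hρ : ∀ γ' Q, evalAt γ' (ρ Q) = evalAt (γ' ∘ₗ π) Q := evalAt_lift_ι_comp π
  have hhom' : ∀ i, ∃ m ≠ 0, IsHomog ((ρ ∘ f) i) m := fun i => by
    obtain ⟨m, hm, h⟩ := hhom i
    refine ⟨m, hm, fun γ' s => ?_⟩
    rw [Function.comp_apply, hρ, hρ, LinearMap.smul_comp, h]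
  have hzero' : ∀ γ' : Module.Dual F (M ⧸ W.dualCoannihilator),
      (∀ i, evalAt γ' ((ρ ∘ f) i) = 0) → γ' = 0 := fun γ' h => by
    have h0 := hzero _ (hπW γ') fun i => by rw [← hρ]; exact h i
    refine LinearMap.ext fun y => ?_
    obtain ⟨x, rfl⟩ := Submodule.mkQ_surjective _ y
    exact LinearMap.congr_fun h0 x
  obtain ⟨σ, hσ⟩ := exists_restriction_affine ψ L
  have hinj : ∀ v ∈ A, ρ v = 0 → v = 0 := fun v hv =>
    eq_zero_of_algebraicIndependent_comp hf ρ
      (algebraicIndependent_of_common_zero hhom' hzero' hcard) hL σ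
      (fun Q hQ h => hA Q hQ (hσ Q h)) hv
  obtain ⟨μ, hμ, hμP⟩ := isIntegral_aeval_of_common_zero hhom' hzero' (ρ P)
  -- the monic equation of the restriction of `P` lifts to `P`, as restriction is injective on `A`
  have hv : eval₂ (MvPolynomial.aeval f : MvPolynomial ι F →ₐ[F] _).toRingHom P μ = 0 := by
    refine hinj _ ?_ ?_
    · rw [eval₂_eq_sum_range]
      refine A.sum_mem fun i _ => A.mul_mem ?_ (A.pow_mem hP i)
      have : MvPolynomial.aeval f (μ.coeff i) ∈ Algebra.adjoin F (Set.range f) := by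
        rw [Algebra.adjoin_range_eq_range_aeval]; exact ⟨_, rfl⟩
      refine Algebra.adjoin_le ?_ this
      rintro _ ⟨j, rfl⟩
      exact hf j
    · have h := hom_eval₂ μ (MvPolynomial.aeval f : MvPolynomial ι F →ₐ[F] _).toRingHom
        ρ.toRingHom P
      refine h.trans ?_
      refine Eq.trans ?_ hμP
      congr 1
      exact RingHom.ext fun p => MvPolynomial.comp_aeval_apply f ρ p
  -- on the line through `γ` the monic equation has constant coefficients
  have hline : ∀ i, lineHom γ (f i) = 0 := fun i => Polynomial.funext fun s => by
    obtain ⟨m, -, h⟩ := hhom i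
    rw [eval_lineHom, h, hγ, mul_zero, eval_zero]
  have hroot : (μ.map MvPolynomial.constantCoeff).comp (lineHom γ P) = 0 := by
    have h := congrArg (lineHom γ) hv
    rw [map_zero] at h
    rw [← h, comp, eval₂_map]
    refine Eq.trans ?_ (hom_eval₂ μ (MvPolynomial.aeval f : MvPolynomial ι F →ₐ[F] _).toRingHom
      (lineHom γ).toRingHom P).symm
    congr 1
    refine MvPolynomial.ringHom_ext (fun a => ?_) fun i => ?_
    · change C (MvPolynomial.constantCoeff (MvPolynomial.C a)) =
        lineHom γ (MvPolynomial.aeval f (MvPolynomial.C a))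
      rw [MvPolynomial.constantCoeff_C, MvPolynomial.aeval_C, AlgHom.commutes]
      rfl
    · change C (MvPolynomial.constantCoeff (MvPolynomial.X i)) =
        lineHom γ (MvPolynomial.aeval f (MvPolynomial.X i))
      rw [MvPolynomial.constantCoeff_X, MvPolynomial.aeval_X, hline, C_0]
  rcases comp_eq_zero_iff.1 hroot with h | ⟨-, h⟩
  · exact absurd h (hμ.map _).ne_zero
  · have h1 := eval_lineHom γ 1 P
    have h0 := eval_lineHom γ 0 P
    rw [one_smul] at h1
    rw [zero_smul] at h0
    rw [← h1, ← h0, h, eval_C, eval_C]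

end Parameters

/-! ### The null-cone -/

section Conclusion

variable {F : Type*} [Field F] [CharZero F] {V : Type*} [AddCommGroup V]
  [Module F V] [FiniteDimensional F V] {B : LinearMap.BilinForm F V} {e f : Module.End F V}
  {k : ℕ} {d : Fin k → ℕ} {w : Fin k → V} {p : ℕ}

/-- The components of minimal degree have positive degree. -/
theorem IsAdapted.isHomog_minComponent (hw : IsAdapted B e d w) (hB : B.Nondegenerate)
    (hd : Antitone d) (hp : ∀ i, d i % 2 = p) (hBp : ∀ v w, B v w = (-1) ^ p * B w v)
    (he : ∀ v w, B (e v) w = -B v (e w)) (hb : Function.Bijective (slicePairing B e f))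
    {i : ℕ} (hi : 2 * (i + 1) ≤ Module.finrank F V) :
    ∃ m ≠ 0, IsHomog (minComponent (sliceRestriction B e f (2 * (i + 1)))) m := by
  obtain ⟨m, h1, h2⟩ := exists_blockSum_lt_le (d := d) (l := 2 * (i + 1)) (by omega)
    (by rwa [hw.1.finrank] at hi)
  refine ⟨m + 1, by omega, ?_⟩
  rw [hw.minComponent_sliceRestriction hB hd hp hBp he hb h1 h2]
  exact isHomog_coeff_gradeHom _ _

theorem IsAdapted.minComponent_mem_invariants (hw : IsAdapted B e d w) (hB : B.Nondegenerate)
    (hd : Antitone d) (hp : ∀ i, d i % 2 = p) (hBp : ∀ v w, B v w = (-1) ^ p * B w v)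
    (he : ∀ v w, B (e v) w = -B v (e w)) (hb : Function.Bijective (slicePairing B e f))
    {i : ℕ} (hi : 2 * (i + 1) ≤ Module.finrank F V) :
    minComponent (sliceRestriction B e f (2 * (i + 1))) ∈ invariants B e := by
  obtain ⟨m, h1, h2⟩ := exists_blockSum_lt_le (d := d) (l := 2 * (i + 1)) (by omega)
    (by rwa [hw.1.finrank] at hi)
  rw [hw.minComponent_sliceRestriction hB hd hp hBp he hb h1 h2]
  exact hw.1.coeff_mem_invariants hB hd hBp he hb h1 hi

/-- An invariant is determined by its restriction to an affine subspace of dimension at most the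
rank, transversal to the coadjoint orbit of a generic point. -/
theorem IsAdapted.exists_affine_section (hw : IsAdapted B e d w) (hB : B.Nondegenerate)
    (hd : Antitone d) (hp : ∀ i, d i % 2 = p) (hBp : ∀ v w, B v w = (-1) ^ p * B w v)
    (he : ∀ v w, B (e v) w = -B v (e w)) :
    ∃ (ψ : Module.Dual F (centraliser B e)) (L : Submodule F (Module.Dual F (centraliser B e))),
      Module.finrank F L ≤ Module.finrank F V / 2 ∧
      ∀ P ∈ invariants B e, (∀ l ∈ L, evalAt (ψ + l) P = 0) → P = 0 := by
  let ψ := pairForm B ((-1) ^ p) w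
  obtain ⟨L, hL⟩ := Submodule.exists_isCompl (LinearMap.range (coadjoint B e ψ))
  refine ⟨ψ ∘ₗ (centraliser B e).subtype, L, ?_, fun P hP h =>
    eq_zero_of_mem_invariants_of_vanishing hB hP ψ hL.sup_eq_top h⟩
  have h1 := Submodule.finrank_add_eq_of_isCompl hL
  have h2 := LinearMap.finrank_range_add_finrank_ker (coadjoint B e ψ)
  have h3 := hw.finrank_ker_coadjoint_le hd hp hB hBp he
  have h4 := Subspace.dual_finrank_eq (K := F) (V := centraliser B e)
  change Module.finrank F (LinearMap.ker (coadjoint B e ψ)) ≤ _ at h3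
  omega

variable [IsAlgClosed F]

/-- The null-cone is cut out by `^eF_1, …, ^eF_r`. -/
theorem IsAdapted.nullCone_eq_nullConeF (hw : IsAdapted B e d w) (hB : B.Nondegenerate)
    (hd : Antitone d) (hp : ∀ i, d i % 2 = p) (hBp : ∀ v w, B v w = (-1) ^ p * B w v)
    (he : ∀ v w, B (e v) w = -B v (e w)) (hb : Function.Bijective (slicePairing B e f))
    (hr : LieAlgebra.rank F (skewAdjointLieSubalgebra B) = Module.finrank F V / 2) :
    nullCone B e = nullConeF B e f := by
  have hi : ∀ i : Fin (LieAlgebra.rank F (skewAdjointLieSubalgebra B)),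
      2 * (i.1 + 1) ≤ Module.finrank F V := fun i => by have := i.2; omega
  ext γ
  constructor
  · intro hγ i
    obtain ⟨m, hm, h⟩ := hw.isHomog_minComponent hB hd hp hBp he hb (hi i)
    refine (hγ _ (hw.minComponent_mem_invariants hB hd hp hBp he hb (hi i))).trans ?_
    exact h.evalAt_zero hm
  · intro hγ P hP
    obtain ⟨W, -, -, hW, hzero⟩ := hw.exists_subspaces hB hd hp hBp he hb
    obtain ⟨ψ, L, hL, hA⟩ := hw.exists_affine_section hB hd hp hBp he
    refine evalAt_eq_evalAt_zero_of_mem (f := eF B e f) (W := ⨆ m, W m)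
      (fun i => hw.minComponent_mem_invariants hB hd hp hBp he hb (hi i))
      (fun i => hw.isHomog_minComponent hB hd hp hBp he hb (hi i))
      (by rw [hW, Fintype.card_fin, hr]) (fun γ' h h' => hzero γ' h fun i h2 => ?_) ψ
      (by rwa [Fintype.card_fin, hr]) hA hP hγ
    exact h' ⟨i, by omega⟩

theorem IsAdapted.isRegular_eF (hw : IsAdapted B e d w) (hB : B.Nondegenerate)
    (hd : Antitone d) (hp : ∀ i, d i % 2 = p) (hBp : ∀ v w, B v w = (-1) ^ p * B w v)
    (he : ∀ v w, B (e v) w = -B v (e w)) (hb : Function.Bijective (slicePairing B e f))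
    (hr : LieAlgebra.rank F (skewAdjointLieSubalgebra B) = Module.finrank F V / 2) :
    RingTheory.Sequence.IsRegular (SymmetricAlgebra F (centraliser B e))
      (List.ofFn (eF B e f)) := by
  obtain ⟨W, -, -, hW, hzero⟩ := hw.exists_subspaces hB hd hp hBp he hb
  refine isRegular_of_disjoint_subspace (W := ⨆ m, W m) (fun P hP => ?_)
    (by rw [hW, List.length_ofFn, hr]) fun γ hγ h => hzero γ hγ fun i hi => ?_
  · obtain ⟨i, rfl⟩ := List.mem_ofFn.1 hP
    exact hw.isHomog_minComponent hB hd hp hBp he hb (by have := i.2; omega)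
  · exact h _ (List.mem_ofFn.2 ⟨⟨i, by omega⟩, rfl⟩)

theorem IsAdapted.codim_eq_rank (hw : IsAdapted B e d w) (hB : B.Nondegenerate)
    (hd : Antitone d) (hp : ∀ i, d i % 2 = p) (hBp : ∀ v w, B v w = (-1) ^ p * B w v)
    (he : ∀ v w, B (e v) w = -B v (e w)) (hb : Function.Bijective (slicePairing B e f))
    (hr : LieAlgebra.rank F (skewAdjointLieSubalgebra B) = Module.finrank F V / 2)
    {Z : Set (Module.Dual F (centraliser B e))} (hZ : Z ∈ components (nullConeF B e f)) :
    codim Z = LieAlgebra.rank F (skewAdjointLieSubalgebra B) := by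
  have h : nullConeF B e f = {γ | ∀ P ∈ List.ofFn (eF B e f), evalAt γ P = 0} := by
    ext γ
    refine ⟨fun hγ P hP => ?_, fun hγ i => hγ _ (List.mem_ofFn.2 ⟨i, rfl⟩)⟩
    obtain ⟨i, rfl⟩ := List.mem_ofFn.1 hP
    exact hγ i
  rw [h] at hZ
  rw [codim_eq_length_of_isWeaklyRegular
    (hw.isRegular_eF hB hd hp hBp he hb hr).toIsWeaklyRegular hZ, List.length_ofFn]

end Conclusion

end NullCone

theorem mainTheorem7 {F : Type*} [Field F] [IsAlgClosed F] [CharZero F]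
    {V : Type*} [AddCommGroup V] [Module F V] [FiniteDimensional F V]
    (B : LinearMap.BilinForm F V) (hB : B.Nondegenerate)
    (e : Module.End F V) (he : e ∈ skewAdjointLieSubalgebra B)
    {k : ℕ} (d : Fin k → ℕ) (hd : Antitone d)
    (hJordan : ∃ w : Fin k → V, NullCone.IsCyclicSystem e d w)
    (htype : (B.IsSymm ∧ ∀ i, Odd (d i + 1)) ∨ (B.IsAlt ∧ ∀ i, Even (d i + 1))) :
    (∀ Z ∈ NullCone.components (NullCone.nullCone B e),
      NullCone.codim Z = LieAlgebra.rank F (skewAdjointLieSubalgebra B)) ∧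
    (∃ w : Fin k → V, NullCone.IsAdapted B e d w) ∧
    (∃ h f : Module.End F V, NullCone.IsTriple B e h f) ∧
    ∀ h f : Module.End F V, NullCone.IsTriple B e h f →
      (∀ w : Fin k → V, NullCone.IsAdapted B e d w →
        ∃ W : Fin k → Submodule F (Module.Dual F (NullCone.centraliser B e)),
          (∀ m, W m ≤ NullCone.antidiagDualLie B e w m) ∧
          iSupIndep W ∧
          Module.finrank F ↥(⨆ m, W m) = LieAlgebra.rank F (skewAdjointLieSubalgebra B) ∧
          ((⨆ m, W m : Submodule F (Module.Dual F (NullCone.centraliser B e))) : Set _) ∩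
            NullCone.nullConeF B e f = {0}) ∧
      (∀ Z ∈ NullCone.components (NullCone.nullConeF B e f),
        NullCone.codim Z = LieAlgebra.rank F (skewAdjointLieSubalgebra B)) ∧
      RingTheory.Sequence.IsRegular (SymmetricAlgebra F (NullCone.centraliser B e))
        (List.ofFn (NullCone.eF B e f)) := by
  have he' := NullCone.mem_skew_iff.1 he
  obtain ⟨p, hp, hBp, hrank⟩ : ∃ p : ℕ, (∀ i, d i % 2 = p) ∧
      (∀ v w, B v w = (-1) ^ p * B w v) ∧
      ∀ w, NullCone.IsAdapted B e d w →
        LieAlgebra.rank F (skewAdjointLieSubalgebra B) = Module.finrank F V / 2 := by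
    rcases htype with ⟨h, hodd⟩ | ⟨h, heven⟩
    · refine ⟨0, fun i => ?_, fun v w => ?_, fun _ _ => NullCone.rank_eq_of_isSymm hB h⟩
      · have := Nat.odd_iff.1 (hodd i); omega
      · rw [pow_zero, one_mul]; exact h.eq v w
    · have hd1 : ∀ i, d i % 2 = 1 := fun i => by have := Nat.even_iff.1 (heven i); omega
      refine ⟨1, hd1, fun v w => ?_, fun w hw => hw.rank_eq_of_odd he' hd1⟩
      rw [pow_one, neg_one_mul]; exact (LinearMap.IsAlt.neg h w v).symm
  obtain ⟨w, hw⟩ := NullCone.exists_isAdapted_of_finrank_range_pow hB hBp he' hd hp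
    hJordan.choose_spec.finrank_range_pow
  have hr := hrank w hw
  have hb : ∀ h f, NullCone.IsTriple B e h f → Function.Bijective (NullCone.slicePairing B e f) :=
    fun h f ht => NullCone.slicePairing_bijective hB hBp he ht
  obtain ⟨h₀, f₀, ht₀⟩ := hw.exists_triple he'
  refine ⟨fun Z hZ => ?_, ⟨w, hw⟩, ⟨h₀, f₀, ht₀⟩, fun h f ht => ⟨fun u hu => ?_, fun Z hZ =>
    hw.codim_eq_rank hB hd hp hBp he' (hb h f ht) hr hZ,
    hw.isRegular_eF hB hd hp hBp he' (hb h f ht) hr⟩⟩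
  · rw [hw.nullCone_eq_nullConeF hB hd hp hBp he' (hb h₀ f₀ ht₀) hr] at hZ
    exact hw.codim_eq_rank hB hd hp hBp he' (hb h₀ f₀ ht₀) hr hZ
  · obtain ⟨W, hW1, hW2, hW3, hW4⟩ := hu.exists_subspaces hB hd hp hBp he' (hb h f ht)
    refine ⟨W, hW1, hW2, hW3.trans hr.symm, Set.eq_singleton_iff_unique_mem.2
      ⟨⟨Submodule.zero_mem _, fun i => ?_⟩, fun γ hγ => hW4 γ hγ.1 fun i hi => ?_⟩⟩
    · obtain ⟨m, hm, hhom⟩ := hw.isHomog_minComponent hB hd hp hBp he' (hb h f ht)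
        (i := i) (by have := i.2; omega)
      exact hhom.evalAt_zero hm
    · exact hγ.2 ⟨i, by omega⟩
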